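/- **Setting.** Let $\mathcal X\subset\mathbb R^d$ be non-empty and let $f\sim\mathcal{GP}(0,k)$ be a centered Gaussian process on $\mathcal X$ with stationary covariance kernel $k$, $k(x,x)=1$. Querying $x_t$ in round $t\ge 1$ returns $y_t=f(x_t)+\epsilon_t$ with $\epsilon_t\sim\mathcal N(0,\sigma^2)$ i.i.d., $\sigma^2>0$. Let $\mu_{t-1}(x)=\mathbf k_{t-1}(x)^\top(\mathbf K+\sigma^2\mathbf I)^{-1}\mathbf y_{t-1}$ and $\sigma^2_{t-1}(x)=k(x,x)-\mathbf k_{t-1}(x)^\top(\mathbf K+\sigma^2\mathbf I)^{-1}\mathbf k_{t-1}(x)$ be the posterior mean and variance of $f(x)$ given the data of rounds $1,\dots,t-1$, where $\mathbf K=(k(x_i,x_j))_{i,j<t}$, $\mathbf k_{t-1}(x)=(k(x,x_i))_{i<t}$ and $\mathbf y_{t-1}=(y_i)_{i<t}$. Let $(\zeta_t)_{t\ge1}$ be non-negative random variables with finite means and moment generating functions $M_t(u)=\mathbb E[e^{u\zeta_t}]$ (so $M_t(-1/2)<\infty$). RGP-UCB queries $$x_t\in\arg\max_{x\in\mathcal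 X}\ \mu_{t-1}(x)+\zeta_t^{1/2}\sigma_{t-1}(x),$$ where $x_t$ is a measurable function of the data of rounds $1,\dots,t-1$, of $\zeta_t$ and possibly of a random seed used for breaking ties; $f$, $(\epsilon_t)_t$, and the pair formed by $(\zeta_t)_t$ and the seed are independent. Let $\mathrm{BCR}_T=\mathbb E\big[\sum_{t=1}^T (f(x^*)-f(x_t))\big]$ with $x^*\in\arg\max_{x\in\mathcal X}f(x)$. Let $\gamma_T=\sup_{a_1,\dots,a_T\in\mathcal X} I\big((f(a_i)+\epsilon_i)_{i\le T};(f(a_i))_{i\le T}\big)$ be the maximum information gain ($I$ is Shannon mutual information; repetitions among the $a_i$ are allowed), and let $C_1=2/\log(1+\sigma^{-2})$. **Theorem.** (i) If $\mathcal X$ is finite, then for every $T$ the cumulative regret is integrable and $$\mathrm{BCR}_T\le\frac{|\mathcal X|}{\sqrt{2\pi}}\sum_{t=1}^T M_t(-1/2)+\sqrt{C_1\gamma_T\sum_{t=1}^T\mathbb E[\zeta_t]} .$$ If moreover $\mathbb E[\zeta_t]=O(\log t)$ and $\mathbb E[e^{-\zeta_t/2}]=O(1/t^2)$, then $\mathrm{BCR}_T=O\big(\sqrt{T\gamma_T\,\mathbb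 E[\zeta_T]}\big)$ as $T\to\infty$. (ii) Suppose that $\mathcal X\subset[0,r]^d$ ($r>0$) is compact and convex, that the sample paths of $f$ are almost surely differentiable on $\mathcal X$, and that there are $a,b>0$ with $\Pr\big(\sup_{x\in\mathcal X}|\partial f/\partial x_j|>L\big)\le a\,e^{-(L/b)^2}$ for all $L>0$ and $j=1,\dots,d$. Put $\tau_t=b\,d\,r\,t^2\big(\sqrt{\log(ad)}+\sqrt\pi/2\big)$, where $\sqrt{\log(ad)}$ is read as $0$ if $ad<1$. Then for every $T$ the cumulative regret is integrable and $$\mathrm{BCR}_T\le\frac{\pi^2}{6}+\frac1{\sqrt{2\pi}}\sum_{t=1}^T\tau_t^{\,d}M_t(-1/2)+\sqrt{C_1\gamma_T\sum_{t=1}^T\mathbb E[\zeta_t]} .$$ If moreover $\mathbb E[\zeta_t]=O(\log t)$ and $\mathbb E[e^{-\zeta_t/2}]=O\big(1/(\tau_t^{\,d}t^2)\big)$, then $\mathrm{BCR}_T=O\big(\sqrt{T\gamma_T\,\mathbb E[\zeta_T]}\big)$ as $T\to\infty$. (iii) Let $N_t>0$ ($N_t=1$ for the rate in (i), $N_t=\tau_t^{\,d}$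 for the rate in (ii)). The conditions $\mathbb E[\zeta_t]=O(\log t)$ and $\mathbb E[e^{-\zeta_t/2}]=O(1/(N_tt^2))$ hold in each of the following cases: $\zeta_t$ has a Gamma law with shape $\kappa_t>0$ and fixed scale $\theta>0$, where $\kappa_t\ge\log(N_tt^2)/\log(1+\theta/2)$ and $\kappa_t=O(\log t)$; $\zeta_t$ has the law of $s_t+\mathrm{Exp}(\lambda)$ with fixed rate $\lambda>0$, where $s_t\ge\max\{0,2\log(N_tt^2)\}$ and $s_t=O(\log t)$ (two-parameter exponential law); $\zeta_t$ has the law of $\mathcal N(m_t,1)$ conditioned on $[m_t-1,m_t+1]$, where $m_t\ge\max\{1,2\log(N_tt^2)+1/4\}$ and $m_t=O(\log t)$. -/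

import Mathlib

open MeasureTheory ProbabilityTheory Filter
open scoped ENNReal Matrix

noncomputable section

/-- `ℝ^d`. -/
abbrev Pt (d : ℕ) : Type := EuclideanSpace ℝ (Fin d)

/-! Rounds are numbered from `0`: index `t` is the round usually called `t + 1`. -/

/-- `k` is stationary on `X`: `k(x, y)` depends on `x - y` only. -/
def IsStationaryOn {d : ℕ} (X : Set (Pt d)) (k : Pt d → Pt d → ℝ) : Prop :=
  ∃ κ : Pt d → ℝ, ∀ x ∈ X, ∀ y ∈ X, k x y = κ (x - y)

/-- `f ∼ GP(0, k)` on the domain `X`; `f x ω` and `k x y` are irrelevant off `X`. -/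
structure IsCenteredGP {Ω : Type*} [MeasurableSpace Ω] (P : Measure Ω) {d : ℕ}
    (X : Set (Pt d)) (k : Pt d → Pt d → ℝ) (f : Pt d → Ω → ℝ) : Prop where
  measurable : ∀ x ∈ X, Measurable (f x)
  gaussian : IsGaussianProcess (fun x : X => f x) P
  mean_zero : ∀ x ∈ X, ∫ ω, f x ω ∂P = 0
  covariance : ∀ x ∈ X, ∀ y ∈ X, cov[f x, f y; P] = k x y

/-- `ε 0, ε 1, …` are i.i.d. `N(0, σ²)`. -/
structure IsGaussianNoise {Ω : Type*} [MeasurableSpace Ω] (P : Measure Ω)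
    (σ : ℝ) (ε : ℕ → Ω → ℝ) : Prop where
  measurable : ∀ t, Measurable (ε t)
  law : ∀ t, P.map (ε t) = gaussianReal 0 (σ ^ 2).toNNReal
  indep : iIndepFun ε P

/-! ### Gaussian process posterior after `n` observations -/

/-- The regularized kernel matrix `K + σ² I`. -/
def regGram {d : ℕ} (k : Pt d → Pt d → ℝ) (σ : ℝ) {n : ℕ} (xs : Fin n → Pt d) :
    Matrix (Fin n) (Fin n) ℝ :=
  Matrix.of (fun i j => k (xs i) (xs j)) + σ ^ 2 • (1 : Matrix (Fin n) (Fin n) ℝ)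

/-- Posterior mean `k_n(x)ᵀ (K + σ² I)⁻¹ y`. -/
def postMean {d : ℕ} (k : Pt d → Pt d → ℝ) (σ : ℝ) {n : ℕ} (xs : Fin n → Pt d)
    (ys : Fin n → ℝ) (x : Pt d) : ℝ :=
  (fun i => k x (xs i)) ⬝ᵥ ((regGram k σ xs)⁻¹ *ᵥ ys)

/-- Posterior variance `k(x, x) - k_n(x)ᵀ (K + σ² I)⁻¹ k_n(x)`. -/
def postVar {d : ℕ} (k : Pt d → Pt d → ℝ) (σ : ℝ) {n : ℕ} (xs : Fin n → Pt d)
    (x : Pt d) : ℝ :=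
  k x x - (fun i => k x (xs i)) ⬝ᵥ ((regGram k σ xs)⁻¹ *ᵥ (fun i => k x (xs i)))

/-- The randomized upper confidence bound `μ(x) + ζ^{1/2} σ(x)` with confidence parameter `z`. -/
def ucb {d : ℕ} (k : Pt d → Pt d → ℝ) (σ : ℝ) {n : ℕ} (xs : Fin n → Pt d)
    (ys : Fin n → ℝ) (z : ℝ) (x : Pt d) : ℝ :=
  postMean k σ xs ys x + √z * √(postVar k σ xs x)

/-! ### The algorithm -/

/-- The observation `y_t = f(x_t) + ε_t`. -/
def obs {Ω : Type*} {d : ℕ} (f : Pt d → Ω → ℝ) (ε : ℕ → Ω → ℝ) (x : ℕ → Ω → Pt d)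
    (t : ℕ) (ω : Ω) : ℝ :=
  f (x t ω) ω + ε t ω

/-- `x 0, x 1, …` are the queries of RGP-UCB on the domain `X` with confidence parameters `ζ`.
The query `x t` is computed from the data of the earlier rounds, from `ζ t`, and from a random
seed `U` (used for breaking ties), and it maximizes the randomized upper confidence bound. -/
structure IsRGPUCB {Ω S : Type*} [MeasurableSpace Ω] [MeasurableSpace S] (P : Measure Ω) {d : ℕ}
    (X : Set (Pt d)) (k : Pt d → Pt d → ℝ) (σ : ℝ) (f : Pt d → Ω → ℝ) (ε ζ : ℕ → Ω → ℝ)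
    (U : Ω → S) (x : ℕ → Ω → Pt d) : Prop where
  mem : ∀ t ω, x t ω ∈ X
  policy : ∀ t, ∃ φ : (Fin t → Pt d × ℝ) × ℝ × S → Pt d, Measurable φ ∧
    ∀ ω, x t ω = φ (fun i => (x i ω, obs f ε x i ω), ζ t ω, U ω)
  argmax : ∀ t, ∀ᵐ ω ∂P, ∀ z ∈ X,
    ucb k σ (fun i : Fin t => x i ω) (fun i : Fin t => obs f ε x i ω) (ζ t ω) z ≤
      ucb k σ (fun i : Fin t => x i ω) (fun i : Fin t => obs f ε x i ω) (ζ t ω) (x t ω)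

/-- Cumulative regret after `T` rounds. The supremum is the maximum `f(x*)`. -/
def cumRegret {Ω : Type*} {d : ℕ} (X : Set (Pt d)) (f : Pt d → Ω → ℝ) (x : ℕ → Ω → Pt d)
    (T : ℕ) (ω : Ω) : ℝ :=
  ∑ t ∈ Finset.range T, ((⨆ z : X, f z ω) - f (x t ω) ω)

/-- Bayesian cumulative regret `BCR_T`. -/
def BCR {Ω : Type*} [MeasurableSpace Ω] (P : Measure Ω) {d : ℕ} (X : Set (Pt d))
    (f : Pt d → Ω → ℝ) (x : ℕ → Ω → Pt d) (T : ℕ) : ℝ :=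
  ∫ ω, cumRegret X f x T ω ∂P

/-! ### Maximum information gain -/

/-- Shannon mutual information `I(Y ; Z)`: the Kullback-Leibler divergence of the joint law from
the product of the marginals. -/
def mutualInfo {Ω 𝒴 𝒵 : Type*} [MeasurableSpace Ω] [MeasurableSpace 𝒴] [MeasurableSpace 𝒵]
    (P : Measure Ω) (Y : Ω → 𝒴) (Z : Ω → 𝒵) : ℝ≥0∞ :=
  InformationTheory.klDiv (P.map (fun ω => (Y ω, Z ω))) ((P.map Y).prod (P.map Z))

/-- Maximum information gain `γ_T = sup_{a_1, …, a_T ∈ X} I(y_A ; f_A)`, where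
`f_A = (f(a_i))_i` and `y_A = f_A + (ε_i)_i`. Points may be repeated. -/
def maxInfoGain {Ω : Type*} [MeasurableSpace Ω] (P : Measure Ω) {d : ℕ} (X : Set (Pt d))
    (f : Pt d → Ω → ℝ) (ε : ℕ → Ω → ℝ) (T : ℕ) : ℝ :=
  (⨆ a : Fin T → X,
    mutualInfo P (fun ω (i : Fin T) => f (a i) ω + ε i ω) (fun ω (i : Fin T) => f (a i) ω)).toReal

/-- `C₁ = 2 / log(1 + σ⁻²)`. -/
def C₁ (σ : ℝ) : ℝ := 2 / Real.log (1 + (σ ^ 2)⁻¹)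

/-! ### Continuous domains -/

/-- Regularity of a continuous domain and of the sample paths: `X ⊆ [0, r]^d` is compact and
convex, almost every path is differentiable on `X` with gradient `g`, and
`Pr(sup_{x ∈ X} |∂f/∂x_j| > L) ≤ a exp(-(L/b)²)` for all `L > 0` and all `j`.
(The gradient relative to `X` is unique as soon as `X` has an interior point.) -/
structure IsRegularContinuous {Ω : Type*} [MeasurableSpace Ω] (P : Measure Ω) {d : ℕ}
    (X : Set (Pt d)) (f : Pt d → Ω → ℝ) (r a b : ℝ) : Prop where
  r_pos : 0 < r
  a_pos : 0 < a
  b_pos : 0 < b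
  box : ∀ x ∈ X, ∀ j, 0 ≤ x j ∧ x j ≤ r
  compact : IsCompact X
  convex : Convex ℝ X
  gradient : ∃ g : Pt d → Ω → Pt d,
    (∀ᵐ ω ∂P, ∀ x ∈ X, HasGradientWithinAt (fun z => f z ω) (g x ω) X x) ∧
    ∀ j, ∀ L : ℝ, 0 < L →
      P {ω | ∃ x ∈ X, L < |g x ω j|} ≤ ENNReal.ofReal (a * Real.exp (-(L / b) ^ 2))

/-- `τ = b d r t² (√(log (a d)) + √π / 2)` in round `t + 1`. `Real.sqrt` is `0` on negative numbers,
so for `a d < 1` the first root is read as `0`. -/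
def gridSize (d : ℕ) (r a b : ℝ) (t : ℕ) : ℝ :=
  b * d * r * ((t : ℝ) + 1) ^ 2 * (√(Real.log (a * d)) + √Real.pi / 2)

/-! ### Rates -/

/-- `E[ζ_t] = O(log t)` and `E[exp(-ζ_t / 2)] = O(1 / (N_t t²))`. -/
def RateCondition {Ω : Type*} [MeasurableSpace Ω] (P : Measure Ω) (ζ : ℕ → Ω → ℝ)
    (N : ℕ → ℝ) : Prop :=
  ((fun t : ℕ => ∫ ω, ζ t ω ∂P) =O[atTop] fun t : ℕ => Real.log ((t : ℝ) + 1)) ∧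
  ((fun t : ℕ => ∫ ω, Real.exp (-ζ t ω / 2) ∂P) =O[atTop]
    fun t : ℕ => 1 / (N t * ((t : ℝ) + 1) ^ 2))

/-- `BCR_T = O(√(T γ_T E[ζ_T]))`, written with `T = n + 1`. -/
def HasRegretRate {Ω : Type*} [MeasurableSpace Ω] (P : Measure Ω) {d : ℕ} (X : Set (Pt d))
    (f : Pt d → Ω → ℝ) (ε ζ : ℕ → Ω → ℝ) (x : ℕ → Ω → Pt d) : Prop :=
  (fun n : ℕ => BCR P X f x (n + 1)) =O[atTop]
    fun n : ℕ => √(((n : ℝ) + 1) * maxInfoGain P X f ε (n + 1) * ∫ ω, ζ n ω ∂P)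

/-- `ζ_t` is Gamma distributed with shape `κ_t` and fixed scale `θ`, where
`κ_t ≥ log(N_t t²) / log(1 + θ/2)` and `κ_t = O(log t)`. -/
def GammaSchedule {Ω : Type*} [MeasurableSpace Ω] (P : Measure Ω) (ζ : ℕ → Ω → ℝ)
    (N : ℕ → ℝ) : Prop :=
  ∃ (θ : ℝ) (κ : ℕ → ℝ), 0 < θ ∧
    (∀ t : ℕ, 0 < κ t ∧
      Real.log (N t * ((t : ℝ) + 1) ^ 2) / Real.log (1 + θ / 2) ≤ κ t ∧
      HasLaw (ζ t) (gammaMeasure (κ t) θ⁻¹) P) ∧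
    κ =O[atTop] fun t : ℕ => Real.log ((t : ℝ) + 1)

/-- `ζ_t` has the two-parameter exponential distribution (the law of `s_t + Exp(rate)`), where
`s_t ≥ 2 log(N_t t²)`, `s_t ≥ 0` and `s_t = O(log t)`. -/
def ExponentialSchedule {Ω : Type*} [MeasurableSpace Ω] (P : Measure Ω) (ζ : ℕ → Ω → ℝ)
    (N : ℕ → ℝ) : Prop :=
  ∃ (rate : ℝ) (s : ℕ → ℝ), 0 < rate ∧
    (∀ t : ℕ, 0 ≤ s t ∧ 2 * Real.log (N t * ((t : ℝ) + 1) ^ 2) ≤ s t ∧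
      HasLaw (ζ t) ((expMeasure rate).map (fun z => s t + z)) P) ∧
    s =O[atTop] fun t : ℕ => Real.log ((t : ℝ) + 1)

/-- `ζ_t` has the law of `N(m_t, 1)` conditioned on `[m_t - 1, m_t + 1]`, where
`m_t ≥ 2 log(N_t t²) + 1/4`, `m_t ≥ 1` and `m_t = O(log t)`. -/
def TruncatedNormalSchedule {Ω : Type*} [MeasurableSpace Ω] (P : Measure Ω) (ζ : ℕ → Ω → ℝ)
    (N : ℕ → ℝ) : Prop :=
  ∃ m : ℕ → ℝ,
    (∀ t : ℕ, 1 ≤ m t ∧ 2 * Real.log (N t * ((t : ℝ) + 1) ^ 2) + 1 / 4 ≤ m t ∧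
      HasLaw (ζ t) (ProbabilityTheory.cond (gaussianReal (m t) 1)
        (Set.Icc (m t - 1) (m t + 1))) P) ∧
    m =O[atTop] fun t : ℕ => Real.log ((t : ℝ) + 1)

end

noncomputable section

set_option linter.unusedSectionVars false

/-! Condition on the data of the earlier rounds and on the randomness of the algorithm. The value of
`f` at a point computed from these is normal with the posterior mean and variance, even though the
queries were chosen adaptively (`IsAdaptiveDesign.lintegral_posterior`). At a fixed reference point
`p`, `f p` therefore exceeds its upper confidence bound by `s (r - √ζ)` with `r` standard normal and
posterior standard deviation `s ≤ 1`. The positive part has mean at most the normal density at `√ζ`,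
that is `E[exp (-ζ/2)] / √(2π)`. The query maximizes the confidence bound, so the regret of a round
is at most the sum of these failures over the reference points, plus a discretization error, plus
`√ζ` times the posterior standard deviation at the query, plus the error of the posterior mean at
the query, which has mean zero (`exists_round_bound`).

The widths are summed on each sample path by Cauchy-Schwarz, which separates `∑ ζ` from the sum of
posterior variances. The latter is at most `C₁ γ_T`: the mutual information of a design equals `∑
log (1 + σ⁻² σ_t²) / 2`, and `log` is concave (`mutualInfo_designObs`, `sum_postVar_le`). Jensen's
inequality then moves the expectation under the root.

On a finite domain every point is a reference point. On a convex one, cell centers projected to `X`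
form a net of at most `τ_t ^ d` points; a random Lipschitz constant whose mean follows from the
gradient tails makes the discretization error at most `1/t²` in expectation, and these errors sum to
at most `π²/6` (`exists_lipschitz`, `exists_net`).

For the rate, Jensen gives `exp (-E ζ_t / 2) ≤ E exp (-ζ_t / 2) = O(1/t²)`, so `E ζ_t` is at least
of order `log t`, and hence `∑_{t ≤ T} E ζ_t = O(T E ζ_T)`. The bounded terms are absorbed because
`γ_T` is bounded below.

The delicate point is conditioning on adaptive data. The design depends on the observations `y`, so
a Bayes formula valid for almost every `y`, with a null set depending on the design, would not
suffice. Continuity in `y` upgrades it to every `y` (`lintegral_mul_likelihood`). -/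

/-- The first `i` entries of a vector of length `n > i`. -/
abbrev prefixFin {n : ℕ} (y : Fin n → ℝ) (i : Fin n) : Fin i → ℝ :=
  fun j => y (j.castLE i.2.le)

/-! ### Joint densities of sequentially generated Gaussian observations. -/

theorem lintegral_pi_snoc {n : ℕ} {H : (Fin (n + 1) → ℝ) → ℝ≥0∞} (hH : Measurable H) :
    ∫⁻ y, H y = ∫⁻ y : Fin n → ℝ, ∫⁻ η : ℝ, H (Fin.snoc y η) := by
  have h := (volume_preserving_piFinSuccAbove (fun _ : Fin (n + 1) => ℝ) (Fin.last n)).symm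
  rw [← h.lintegral_comp hH, Measure.volume_eq_prod,
    lintegral_prod_symm (fun a => H ((MeasurableEquiv.piFinSuccAbove _ (Fin.last n)).symm a))
      (hH.comp (MeasurableEquiv.measurable _)).aemeasurable]
  refine lintegral_congr fun y => lintegral_congr fun η => ?_
  congr 1
  simp [MeasurableEquiv.piFinSuccAbove, Fin.insertNthEquiv]

theorem measurable_fin_snoc {n : ℕ} {B : Type*} [MeasurableSpace B] {f : B → Fin n → ℝ} {g : B → ℝ}
    (hf : Measurable f) (hg : Measurable g) :
    Measurable (fun b => (Fin.snoc (f b) (g b) : Fin (n + 1) → ℝ)) := by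
  refine measurable_pi_iff.2 fun i => ?_
  refine Fin.lastCases ?_ (fun j => ?_) i
  · simpa using hg
  · simpa using measurable_pi_iff.1 hf j

/-- If `Y t - m t (Z, Y_{<t})` is independent of `(Z, Y_{<t})` and centered Gaussian, then
`Y_{<n}` has the product of the Gaussian densities as conditional density given `Z`. -/
theorem lintegral_sequential_gaussian {Ω B : Type*} [MeasurableSpace Ω] [MeasurableSpace B]
    {P : Measure Ω} [IsProbabilityMeasure P] {Z : Ω → B} (hZ : Measurable Z)
    {Y : ℕ → Ω → ℝ} (hY : ∀ t, AEMeasurable (Y t) P) {v : ℕ → NNReal} (hv : ∀ t, v t ≠ 0)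
    {m : ∀ t : ℕ, B × (Fin t → ℝ) → ℝ} (hm : ∀ t, Measurable (m t)) (N : ℕ)
    (hind : ∀ t < N, IndepFun (fun ω => (Z ω, fun i : Fin t => Y i ω))
      (fun ω => Y t ω - m t (Z ω, fun i : Fin t => Y i ω)) P)
    (hlaw : ∀ t < N, P.map (fun ω => Y t ω - m t (Z ω, fun i : Fin t => Y i ω))
      = gaussianReal 0 (v t)) (n : ℕ) (hn : n ≤ N)
    {H : B × (Fin n → ℝ) → ℝ≥0∞} (hH : Measurable H) :
    ∫⁻ ω, H (Z ω, fun i : Fin n => Y i ω) ∂P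
      = ∫⁻ b, (∫⁻ y : Fin n → ℝ, H (b, y) *
          ∏ i : Fin n, gaussianPDF (m i (b, prefixFin y i)) (v i) (y i)) ∂(P.map Z) := by
  induction n with
  | zero =>
    simp only [Finset.univ_eq_empty, Finset.prod_empty, mul_one]
    rw [lintegral_map (by fun_prop) hZ]
    congr 1 with ω
    rw [volume_pi, Measure.pi_of_empty (x := (fun i : Fin 0 => Y i ω)), lintegral_dirac]
  | succ n ih =>
    set Q : Ω → B × (Fin n → ℝ) := fun ω => (Z ω, fun i : Fin n => Y i ω) with hQ
    have hQm : AEMeasurable Q P :=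
      hZ.aemeasurable.prodMk (aemeasurable_pi_lambda _ fun i => hY i)
    have hDm : AEMeasurable (fun ω => Y n ω - m n (Q ω)) P :=
      (hY n).sub ((hm n).comp_aemeasurable hQm)
    -- The last observation is replaced by its innovation, which is independent of `Q`. Integrating
    -- the innovation out leaves a function of `Q` alone, to which the induction hypothesis applies.
    set H' : (B × (Fin n → ℝ)) × ℝ → ℝ≥0∞ :=
      fun q => H (q.1.1, Fin.snoc q.1.2 (m n q.1 + q.2)) with hH'
    have hmn := hm n
    have hH'm : Measurable H' := by
      refine hH.comp (Measurable.prodMk (by fun_prop) (measurable_fin_snoc (by fun_prop) ?_))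
      fun_prop
    have h1 : ∀ ω, H (Z ω, fun i : Fin (n + 1) => Y i ω) = H' (Q ω, Y n ω - m n (Q ω)) := by
      intro ω
      simp only [hH', hQ]
      congr 2
      ext i
      refine Fin.lastCases ?_ (fun j => ?_) i
      · simp
      · simp
    have h2 : ∀ q : B × (Fin n → ℝ), ∫⁻ r, H' (q, r) ∂(gaussianReal 0 (v n))
        = ∫⁻ η, H (q.1, Fin.snoc q.2 η) * gaussianPDF (m n q) (v n) η := by
      intro q
      have hHs : Measurable fun η : ℝ => H (q.1, (Fin.snoc q.2 η : Fin (n + 1) → ℝ)) :=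
        hH.comp (measurable_const.prodMk (measurable_fin_snoc measurable_const measurable_id))
      have : gaussianReal (m n q) (v n) = (gaussianReal 0 (v n)).map (m n q + ·) := by
        rw [gaussianReal_map_const_add, zero_add]
      calc _ = ∫⁻ η, H (q.1, Fin.snoc q.2 η) ∂(gaussianReal (m n q) (v n)) := by
            rw [this, lintegral_map hHs (by fun_prop)]
        _ = _ := by
            rw [gaussianReal_of_var_ne_zero _ (hv n),
              lintegral_withDensity_eq_lintegral_mul _ (measurable_gaussianPDF _ _) hHs]
            simp only [Pi.mul_apply, mul_comm]
    have hpdf : ∀ i : Fin n, Measurable fun p : B × (Fin n → ℝ) =>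
        gaussianPDF (m i (p.1, prefixFin p.2 i)) (v i) (p.2 i) := by
      intro i
      have hmi := hm i
      have : Measurable fun p : B × (Fin n → ℝ) => m i (p.1, prefixFin p.2 i) := by
        refine hmi.comp (measurable_fst.prodMk (measurable_pi_iff.2 fun j => ?_))
        exact (measurable_pi_apply _).comp measurable_snd
      exact measurable_uncurry_gaussianPDF.comp (this.prodMk (measurable_const.prodMk
        ((measurable_pi_apply i).comp measurable_snd)))
    have hpdfn : Measurable fun p : (B × (Fin n → ℝ)) × ℝ => gaussianPDF (m n p.1) (v n) p.2 :=
      measurable_uncurry_gaussianPDF.comp ((hmn.comp measurable_fst).prodMk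
        (measurable_const.prodMk measurable_snd))
    have hHs : Measurable fun p : (B × (Fin n → ℝ)) × ℝ =>
        H (p.1.1, (Fin.snoc p.1.2 p.2 : Fin (n + 1) → ℝ)) :=
      hH.comp ((by fun_prop : Measurable _).prodMk
        (measurable_fin_snoc (by fun_prop) measurable_snd))
    have h3 : ∫⁻ ω, H (Z ω, fun i : Fin (n + 1) => Y i ω) ∂P
        = ∫⁻ ω, (∫⁻ η, H ((Q ω).1, Fin.snoc (Q ω).2 η) * gaussianPDF (m n (Q ω)) (v n) η) ∂P := by
      calc _ = ∫⁻ ω, H' (Q ω, Y n ω - m n (Q ω)) ∂P := lintegral_congr h1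
        _ = ∫⁻ p, H' p ∂(P.map fun ω => (Q ω, Y n ω - m n (Q ω))) := by
            rw [lintegral_map' hH'm.aemeasurable (hQm.prodMk hDm)]
        _ = ∫⁻ q, ∫⁻ r, H' (q, r) ∂(gaussianReal 0 (v n)) ∂(P.map Q) := by
            rw [(indepFun_iff_map_prod_eq_prod_map_map hQm hDm).1 (hind n hn), hlaw n hn]
            exact lintegral_prod _ hH'm.aemeasurable
        _ = ∫⁻ q, (∫⁻ η, H (q.1, Fin.snoc q.2 η) * gaussianPDF (m n q) (v n) η) ∂(P.map Q) :=
            lintegral_congr h2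
        _ = _ := by
            rw [lintegral_map' _ hQm]
            exact (Measurable.lintegral_prod_right' (f := fun p : (B × (Fin n → ℝ)) × ℝ =>
              H (p.1.1, (Fin.snoc p.1.2 p.2 : Fin (n + 1) → ℝ)) * gaussianPDF (m n p.1) (v n) p.2)
              (hHs.mul hpdfn)).aemeasurable
    rw [h3, ih (Nat.le_of_succ_le hn) (H := fun q : B × (Fin n → ℝ) =>
      ∫⁻ η, H (q.1, Fin.snoc q.2 η) * gaussianPDF (m n q) (v n) η)
      (Measurable.lintegral_prod_right' (f := fun p : (B × (Fin n → ℝ)) × ℝ =>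
              H (p.1.1, (Fin.snoc p.1.2 p.2 : Fin (n + 1) → ℝ)) * gaussianPDF (m n p.1) (v n) p.2)
              (hHs.mul hpdfn))]
    refine lintegral_congr fun b => ?_
    have hmeas : Measurable fun y : Fin (n + 1) → ℝ => H (b, y) *
        ∏ i : Fin (n + 1), gaussianPDF (m i (b, prefixFin y i)) (v i) (y i) := by
      refine (hH.comp (measurable_const.prodMk measurable_id)).mul
        (Finset.measurable_prod _ fun i _ => ?_)
      refine measurable_uncurry_gaussianPDF.comp (Measurable.prodMk ?_ (measurable_const.prodMk
        (measurable_pi_apply i)))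
      refine (hm i).comp (measurable_const.prodMk (measurable_pi_iff.2 fun j => ?_))
      exact measurable_pi_apply _
    rw [lintegral_pi_snoc hmeas]
    refine lintegral_congr fun y => ?_
    rw [← lintegral_mul_const]
    · refine lintegral_congr fun η => ?_
      rw [Fin.prod_univ_castSucc]
      have e1 : ∀ i : Fin n, prefixFin (Fin.snoc y η : Fin (n + 1) → ℝ) i.castSucc
          = prefixFin y i := by
        intro i; ext j
        exact Fin.snoc_castSucc (α := fun _ => ℝ) η y (j.castLE i.2.le)
      have e2 : prefixFin (Fin.snoc y η : Fin (n + 1) → ℝ) (Fin.last n) = y := by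
        ext j
        exact Fin.snoc_castSucc (α := fun _ => ℝ) η y j
      simp only [e1, e2, Fin.snoc_castSucc, Fin.snoc_last, Fin.val_last, Fin.val_castSucc]
      rw [mul_assoc, mul_comm (gaussianPDF _ _ _)]
    · have hHy : Measurable fun η : ℝ => H (b, (Fin.snoc y η : Fin (n + 1) → ℝ)) :=
        hH.comp (measurable_const.prodMk (measurable_fin_snoc measurable_const measurable_id))
      exact hHy.mul (measurable_gaussianPDF _ _)

/-- If `X ⟂ (Y, Z)` and `Y ⟂ Z` then `(X, Y) ⟂ Z`. -/
theorem indepFun_prodMk_assoc {Ω A B C : Type*} [MeasurableSpace Ω] [MeasurableSpace A]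
    [MeasurableSpace B] [MeasurableSpace C] {P : Measure Ω} [IsProbabilityMeasure P]
    {X : Ω → A} {Y : Ω → B} {Z : Ω → C} (hX : AEMeasurable X P) (hY : AEMeasurable Y P)
    (hZ : AEMeasurable Z P) (h : IndepFun X (fun ω => (Y ω, Z ω)) P) (h' : IndepFun Y Z P) :
    IndepFun (fun ω => (X ω, Y ω)) Z P := by
  have hXY : IndepFun X Y P := h.comp measurable_id measurable_fst
  rw [indepFun_iff_map_prod_eq_prod_map_map (hX.prodMk hY) hZ,
    (indepFun_iff_map_prod_eq_prod_map_map hX hY).1 hXY]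
  have e := (indepFun_iff_map_prod_eq_prod_map_map hX (hY.prodMk hZ)).1 h
  rw [(indepFun_iff_map_prod_eq_prod_map_map hY hZ).1 h'] at e
  have := Measure.isProbabilityMeasure_map hX
  have := Measure.isProbabilityMeasure_map hY
  have := Measure.isProbabilityMeasure_map hZ
  have e2 := congrArg (Measure.map MeasurableEquiv.prodAssoc.symm) e
  rw [AEMeasurable.map_map_of_aemeasurable (by fun_prop) (hX.prodMk (hY.prodMk hZ))] at e2
  have e3 := (measurePreserving_prodAssoc (P.map X) (P.map Y) (P.map Z)).symm.map_eq
  rw [e3] at e2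
  exact e2

/-! ### Observations with additive noise and history-dependent means. -/

/-- The additive noise model: `Y t = m t (Z, Y_{<t}) + ε t` with i.i.d. Gaussian noise independent
of `Z`. -/
structure IsNoiseModel {Ω B : Type*} [MeasurableSpace Ω] [MeasurableSpace B] (P : Measure Ω)
    (Z : Ω → B) (ε Y : ℕ → Ω → ℝ) (s : NNReal) (m : ∀ t : ℕ, B × (Fin t → ℝ) → ℝ) : Prop where
  meas_Z : Measurable Z
  meas_ε : ∀ t, Measurable (ε t)
  meas_m : ∀ t, Measurable (m t)
  law : ∀ t, P.map (ε t) = gaussianReal 0 s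
  iIndep : iIndepFun ε P
  indep : IndepFun Z (fun ω t => ε t ω) P
  eq : ∀ t, Y t =ᵐ[P] fun ω => m t (Z ω, fun i : Fin t => Y i ω) + ε t ω

namespace IsNoiseModel

variable {Ω B : Type*} [MeasurableSpace Ω] [MeasurableSpace B] {P : Measure Ω}
  [IsProbabilityMeasure P] {Z : Ω → B} {ε Y : ℕ → Ω → ℝ} {s : NNReal}
  {m : ∀ t : ℕ, B × (Fin t → ℝ) → ℝ}

-- Unrolling the recursion expresses past observations through `Z` and past noise. Measurability of
-- the observations and their independence of the next noise term both follow from this.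
omit [IsProbabilityMeasure P] in
theorem exists_obs_eq (h : IsNoiseModel P Z ε Y s m) (t : ℕ) :
    ∃ Φ : B × (Fin t → ℝ) → (Fin t → ℝ), Measurable Φ ∧
      (fun ω (i : Fin t) => Y i ω) =ᵐ[P] fun ω => Φ (Z ω, fun i : Fin t => ε i ω) := by
  induction t with
  | zero => exact ⟨fun _ => Fin.elim0, measurable_const, ae_of_all _ fun ω => by ext i; exact i.elim0⟩
  | succ t ih =>
    obtain ⟨Φ, hΦ, hΦe⟩ := ih
    have hmt := h.meas_m t
    have hi : Measurable fun q : B × (Fin (t + 1) → ℝ) => Φ (q.1, fun i : Fin t => q.2 i.castSucc) :=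
      hΦ.comp (by fun_prop)
    refine ⟨fun q => Fin.snoc (Φ (q.1, fun i : Fin t => q.2 i.castSucc))
      (m t (q.1, Φ (q.1, fun i : Fin t => q.2 i.castSucc)) + q.2 (Fin.last t)),
      measurable_fin_snoc hi (by fun_prop), ?_⟩
    filter_upwards [hΦe, h.eq t] with ω h1 h2
    ext i
    refine Fin.lastCases ?_ (fun j => ?_) i
    · simp only [Fin.val_last, Fin.snoc_last, Fin.val_castSucc, ← h1]
      exact h2
    · simp only [Fin.snoc_castSucc, Fin.val_castSucc, ← h1]

omit [IsProbabilityMeasure P] in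
theorem aemeasurable_obs (h : IsNoiseModel P Z ε Y s m) (t : ℕ) : AEMeasurable (Y t) P := by
  obtain ⟨Φ, hΦ, hΦe⟩ := h.exists_obs_eq (t + 1)
  have h1 : AEMeasurable (fun ω (i : Fin (t + 1)) => Y i ω) P := by
    refine AEMeasurable.congr (Measurable.aemeasurable ?_) hΦe.symm
    exact hΦ.comp (h.meas_Z.prodMk (measurable_pi_iff.2 fun i => h.meas_ε i))
  exact aemeasurable_pi_iff.1 h1 (Fin.last t)

theorem indepFun_history (h : IsNoiseModel P Z ε Y s m) (t : ℕ) :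
    IndepFun (fun ω => (Z ω, fun i : Fin t => Y i ω)) (ε t) P := by
  obtain ⟨Φ, hΦ, hΦe⟩ := h.exists_obs_eq t
  have hpast : Measurable fun ω (i : Fin t) => ε i ω := measurable_pi_iff.2 fun i => h.meas_ε i
  have h1 : IndepFun (fun ω (i : Fin t) => ε i ω) (ε t) P := by
    have := h.iIndep.indepFun_finset (Finset.range t) {t} (by simp) h.meas_ε
    exact this.comp (φ := fun (e : Finset.range t → ℝ) (i : Fin t) => e ⟨i, by simp⟩)
      (ψ := fun e : ({t} : Finset ℕ) → ℝ => e ⟨t, by simp⟩) (by fun_prop) (by fun_prop)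
  have h2 : IndepFun Z (fun ω => ((fun i : Fin t => ε i ω), ε t ω)) P :=
    h.indep.comp (φ := id) (ψ := fun e : ℕ → ℝ => ((fun i : Fin t => e i), e t)) measurable_id
      (by fun_prop)
  have h3 := indepFun_prodMk_assoc h.meas_Z.aemeasurable hpast.aemeasurable
    (h.meas_ε t).aemeasurable h2 h1
  refine (h3.comp (φ := fun q : B × (Fin t → ℝ) => (q.1, Φ q)) (ψ := id) (by fun_prop)
    measurable_id).congr ?_ ae_eq_rfl
  filter_upwards [hΦe] with ω hω
  simp [← hω]

theorem lintegral_eq (h : IsNoiseModel P Z ε Y s m) (hs : s ≠ 0) (n : ℕ)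
    {H : B × (Fin n → ℝ) → ℝ≥0∞} (hH : Measurable H) :
    ∫⁻ ω, H (Z ω, fun i : Fin n => Y i ω) ∂P
      = ∫⁻ b, (∫⁻ y : Fin n → ℝ, H (b, y) *
          ∏ i : Fin n, gaussianPDF (m i (b, prefixFin y i)) s (y i)) ∂(P.map Z) := by
  have he : ∀ t, (fun ω => Y t ω - m t (Z ω, fun i : Fin t => Y i ω)) =ᵐ[P] ε t := by
    intro t
    filter_upwards [h.eq t] with ω hω
    rw [hω]; ring
  refine lintegral_sequential_gaussian h.meas_Z h.aemeasurable_obs (v := fun _ => s) (fun _ => hs)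
    h.meas_m n (fun t _ => (h.indepFun_history t).congr ae_eq_rfl (he t).symm) (fun t _ => ?_) n
    le_rfl hH
  rw [Measure.map_congr (he t), h.law]

end IsNoiseModel

/-! ### Gaussian process regression on a fixed design. -/

/-- Pooling two independent Gaussian processes gives a Gaussian process. -/
theorem isGaussianProcess_sumElim {Ω S T : Type*} [MeasurableSpace Ω] {P : Measure Ω}
    [IsProbabilityMeasure P] {f : S → Ω → ℝ} {g : T → Ω → ℝ}
    (hf : IsGaussianProcess f P) (hg : IsGaussianProcess g P)
    (h : IndepFun (fun ω s => f s ω) (fun ω t => g t ω) P) :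
    IsGaussianProcess (Sum.elim f g) P where
  hasGaussianLaw I := by
    classical
    have h1 : IndepFun (fun ω => I.toLeft.restrict (f · ω)) (fun ω => I.toRight.restrict (g · ω)) P :=
      h.comp (φ := fun v => I.toLeft.restrict v) (ψ := fun v => I.toRight.restrict v)
        (Finset.measurable_restrict _) (Finset.measurable_restrict _)
    have h2 := h1.hasGaussianLaw (hf.hasGaussianLaw _) (hg.hasGaussianLaw _)
    let L : ((I.toLeft → ℝ) × (I.toRight → ℝ)) →L[ℝ] (I → ℝ) :=
      ContinuousLinearMap.pi fun i => match i with
        | ⟨Sum.inl s, hs⟩ => (ContinuousLinearMap.proj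
            (⟨s, Finset.mem_toLeft.2 hs⟩ : I.toLeft)).comp (.fst ℝ _ _)
        | ⟨Sum.inr t, ht⟩ => (ContinuousLinearMap.proj
            (⟨t, Finset.mem_toRight.2 ht⟩ : I.toRight)).comp (.snd ℝ _ _)
    convert! h2.map L using 1
    ext ω ⟨i, hi⟩
    cases i <;> rfl

/-- Finite linear combinations of a Gaussian process form a Gaussian process. -/
theorem IsGaussianProcess_linearCombination {Ω S T : Type*} [MeasurableSpace Ω] {P : Measure Ω}
    {g : T → Ω → ℝ} (hg : IsGaussianProcess g P) (c : S → T →₀ ℝ) :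
    IsGaussianProcess (fun s ω => Finsupp.linearCombination ℝ (fun t => g t ω) (c s)) P := by
  refine hg.of_isGaussianProcess fun s => ⟨(c s).support,
    ∑ i : (c s).support, (c s i) • ContinuousLinearMap.proj i, fun ω => ?_⟩
  simp only [Finsupp.linearCombination_apply, Finsupp.sum, sum_apply,
    smul_apply, ContinuousLinearMap.proj_apply, Finset.restrict]
  exact (Finset.sum_coe_sort (c s).support (fun i => c s i • g i ω)).symm

/-- A centered Gaussian process with unit variance, observed with independent Gaussian noise. -/
structure IsGPRegression {Ω : Type*} [MeasurableSpace Ω] (P : Measure Ω) {d : ℕ}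
    (X : Set (Pt d)) (k : Pt d → Pt d → ℝ) (σ : ℝ) (f : Pt d → Ω → ℝ) (ε : ℕ → Ω → ℝ) : Prop where
  sigma_pos : 0 < σ
  gp : IsCenteredGP P X k f
  unit : ∀ z ∈ X, k z z = 1
  noise : IsGaussianNoise P σ ε
  indep : IndepFun (fun ω (z : X) => f z ω) (fun ω (t : ℕ) => ε t ω) P

namespace IsGPRegression

variable {Ω : Type*} [MeasurableSpace Ω] {P : Measure Ω} [IsProbabilityMeasure P] {d : ℕ}
  {X : Set (Pt d)} {k : Pt d → Pt d → ℝ} {σ : ℝ} {f : Pt d → Ω → ℝ} {ε : ℕ → Ω → ℝ}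

theorem noise_hasGaussianLaw (h : IsGPRegression P X k σ f ε) (t : ℕ) :
    HasGaussianLaw (ε t) P :=
  ⟨by rw [h.noise.law]; infer_instance⟩

theorem noise_memLp (h : IsGPRegression P X k σ f ε) (t : ℕ) : MemLp (ε t) 2 P :=
  (h.noise_hasGaussianLaw t).memLp_two

theorem integral_noise (h : IsGPRegression P X k σ f ε) (t : ℕ) : ∫ ω, ε t ω ∂P = 0 := by
  rw [← integral_map (f := fun x : ℝ => x) (h.noise.measurable t).aemeasurable (by fun_prop),
    h.noise.law, integral_id_gaussianReal]

theorem variance_noise (h : IsGPRegression P X k σ f ε) (t : ℕ) : Var[ε t; P] = σ ^ 2 := by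
  have := variance_map (X := id) (μ := P) (by fun_prop) (h.noise.measurable t).aemeasurable
  rw [Function.id_comp] at this
  rw [← this, h.noise.law, variance_id_gaussianReal, Real.coe_toNNReal _ (sq_nonneg σ)]

theorem gp_memLp (h : IsGPRegression P X k σ f ε) (z : X) : MemLp (f z) 2 P :=
  (h.gp.gaussian.hasGaussianLaw_eval z).memLp_two

theorem pooled (h : IsGPRegression P X k σ f ε) :
    IsGaussianProcess (Sum.elim (fun z : X => f z) ε) P := by
  refine isGaussianProcess_sumElim h.gp.gaussian ?_ h.indep
  exact ⟨fun I => (h.noise.indep.precomp (g := fun i : I => (i : ℕ))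
    Subtype.val_injective).hasGaussianLaw fun i => h.noise_hasGaussianLaw i⟩

theorem covariance_gp_noise (h : IsGPRegression P X k σ f ε) (z : X) (t : ℕ) :
    cov[f z, ε t; P] = 0 := by
  have : IndepFun (f z) (ε t) P :=
    h.indep.comp (φ := fun v : X → ℝ => v z) (ψ := fun e : ℕ → ℝ => e t) (by fun_prop) (by fun_prop)
  exact this.covariance_eq_zero (h.gp_memLp z) (h.noise_memLp t)

theorem covariance_noise (h : IsGPRegression P X k σ f ε) (s t : ℕ) :
    cov[ε s, ε t; P] = if s = t then σ ^ 2 else 0 := by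
  split_ifs with hst
  · rw [hst, covariance_self (h.noise.measurable t).aemeasurable, h.variance_noise]
  · exact (h.noise.indep.indepFun hst).covariance_eq_zero (h.noise_memLp s) (h.noise_memLp t)

/-- The observation of noise index `i` at the point `a i` of a fixed design. -/
def designObs (f : Pt d → Ω → ℝ) (ε : ℕ → Ω → ℝ) {n : ℕ} (a : Fin n → X) (ω : Ω) (i : Fin n) : ℝ :=
  f (a i) ω + ε i ω

/-- The weights of the posterior mean. -/
def postWeight (k : Pt d → Pt d → ℝ) (σ : ℝ) {n : ℕ} (a : Fin n → X) (z : X) : Fin n → ℝ :=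
  (fun i => k z (a i)) ᵥ* (regGram k σ fun i => (a i : Pt d))⁻¹

omit [MeasurableSpace Ω] in
theorem postMean_eq_sum {n : ℕ} (a : Fin n → X) (y : Fin n → ℝ) (z : X) :
    postMean k σ (fun i => (a i : Pt d)) y z = ∑ i, postWeight k σ a z i * y i := by
  rw [postMean, Matrix.dotProduct_mulVec]; rfl

theorem postVar_eq_sum {n : ℕ} (a : Fin n → X) (z : X) :
    postVar k σ (fun i => (a i : Pt d)) z = k z z - ∑ i, postWeight k σ a z i * k z (a i) := by
  rw [postVar, Matrix.dotProduct_mulVec]; rfl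

theorem designObs_memLp (h : IsGPRegression P X k σ f ε) {n : ℕ} (a : Fin n → X) (i : Fin n) :
    MemLp (fun ω => designObs f ε a ω i) 2 P :=
  (h.gp_memLp (a i)).add (h.noise_memLp i)

theorem designObs_measurable (h : IsGPRegression P X k σ f ε) {n : ℕ} (a : Fin n → X) :
    Measurable (designObs f ε a) :=
  measurable_pi_iff.2 fun i => (h.gp.measurable _ (a i).2).add (h.noise.measurable i)

theorem covariance_designObs (h : IsGPRegression P X k σ f ε) {n : ℕ} (a : Fin n → X)
    (i j : Fin n) : cov[fun ω => designObs f ε a ω i, fun ω => designObs f ε a ω j; P]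
      = regGram k σ (fun i => (a i : Pt d)) i j := by
  have e : ∀ i, (fun ω => designObs f ε a ω i) = f (a i) + ε i := fun i => rfl
  rw [e, e, covariance_add_left (h.gp_memLp _) (h.noise_memLp _)
      ((h.gp_memLp _).add (h.noise_memLp _)),
    covariance_add_right (h.gp_memLp _) (h.gp_memLp _) (h.noise_memLp _),
    covariance_add_right (h.noise_memLp _) (h.gp_memLp _) (h.noise_memLp _),
    covariance_gp_noise h, covariance_comm (ε i), covariance_gp_noise h, covariance_noise h,
    h.gp.covariance _ (a i).2 _ (a j).2]
  simp [regGram, Matrix.one_apply, Fin.val_inj]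

theorem covariance_gp_designObs (h : IsGPRegression P X k σ f ε) {n : ℕ} (a : Fin n → X)
    (z : X) (j : Fin n) : cov[f z, fun ω => designObs f ε a ω j; P] = k z (a j) := by
  have e : (fun ω => designObs f ε a ω j) = f (a j) + ε j := rfl
  rw [e, covariance_add_right (h.gp_memLp _) (h.gp_memLp _) (h.noise_memLp _),
    covariance_gp_noise h, h.gp.covariance _ z.2 _ (a j).2, add_zero]

theorem covariance_noise_designObs (h : IsGPRegression P X k σ f ε) {n : ℕ} (a : Fin n → X)
    (j : Fin n) : cov[ε n, fun ω => designObs f ε a ω j; P] = 0 := by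
  have e : (fun ω => designObs f ε a ω j) = f (a j) + ε j := rfl
  rw [e, covariance_add_right (h.noise_memLp _) (h.gp_memLp _) (h.noise_memLp _),
    covariance_comm, covariance_gp_noise h, covariance_noise h, if_neg j.2.ne', add_zero]

/-- The quadratic form of `K` at `v` is the variance of `∑ v i * f (a i)`. A null vector of `K + σ²
I` would make this variance plus `σ² ‖v‖²` vanish. -/
theorem isUnit_regGram (h : IsGPRegression P X k σ f ε) {n : ℕ} (a : Fin n → X) :
    IsUnit (regGram k σ fun i => (a i : Pt d)).det := by
  rw [isUnit_iff_ne_zero]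
  intro h0
  obtain ⟨v, hv, hv0⟩ := Matrix.exists_mulVec_eq_zero_iff.2 h0
  have h1 : v ⬝ᵥ ((regGram k σ fun i => (a i : Pt d)) *ᵥ v) = 0 := by simp [hv0]
  have h2 : v ⬝ᵥ ((Matrix.of fun i j => k (a i) (a j)) *ᵥ v)
      = Var[fun ω => ∑ i, v i * f (a i) ω; P] := by
    rw [variance_fun_sum fun i => (h.gp_memLp (a i)).const_mul (v i)]
    simp only [covariance_const_mul_left, covariance_const_mul_right, dotProduct, Matrix.mulVec,
      Matrix.of_apply, Finset.mul_sum]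
    refine Finset.sum_congr rfl fun i _ => Finset.sum_congr rfl fun j _ => ?_
    rw [h.gp.covariance _ (a i).2 _ (a j).2]; ring
  rw [regGram, Matrix.add_mulVec, dotProduct_add, h2, Matrix.smul_mulVec, Matrix.one_mulVec,
    dotProduct_smul, smul_eq_mul] at h1
  have h3 : 0 < v ⬝ᵥ v := by
    have h0 : v ⬝ᵥ v ≠ 0 := fun h => hv (dotProduct_self_eq_zero.1 h)
    exact lt_of_le_of_ne (Finset.sum_nonneg fun i _ => mul_self_nonneg (v i)) h0.symm
  have := variance_nonneg (fun ω => ∑ i, v i * f (a i) ω) P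
  have := mul_pos (pow_pos h.sigma_pos 2) h3
  linarith

/-- The normal equations of linear prediction, the form in which the covariance computations use the
inverse matrix. -/
theorem postWeight_vecMul (h : IsGPRegression P X k σ f ε) {n : ℕ} (a : Fin n → X) (z : X) :
    postWeight k σ a z ᵥ* (regGram k σ fun i => (a i : Pt d)) = fun i => k z (a i) := by
  rw [postWeight, Matrix.vecMul_vecMul, Matrix.nonsing_inv_mul _ (h.isUnit_regGram a),
    Matrix.vecMul_one]

/-- The prediction error of the posterior mean at `z`, plus a multiple of a fresh noise term. -/
def residual (k : Pt d → Pt d → ℝ) (σ : ℝ) (f : Pt d → Ω → ℝ) (ε : ℕ → Ω → ℝ) {n : ℕ}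
    (a : Fin n → X) (z : X) (θ : ℝ) (ω : Ω) : ℝ :=
  f z ω - postMean k σ (fun i => (a i : Pt d)) (designObs f ε a ω) z + θ * ε n ω

theorem residual_memLp (h : IsGPRegression P X k σ f ε) {n : ℕ} (a : Fin n → X) (z : X) (θ : ℝ) :
    MemLp (residual k σ f ε a z θ) 2 P := by
  have : MemLp (fun ω => ∑ i, postWeight k σ a z i * designObs f ε a ω i) 2 P :=
    memLp_finsetSum _ fun i _ => (h.designObs_memLp a i).const_mul _
  have e : residual k σ f ε a z θ = (f z - fun ω => ∑ i, postWeight k σ a z i * designObs f ε a ω i)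
      + fun ω => θ * ε n ω := by
    ext ω; simp [residual, postMean_eq_sum]
  rw [e]
  exact ((h.gp_memLp z).sub this).add ((h.noise_memLp n).const_mul θ)

/-- By the normal equations the weighted observations have the same covariance with each observation
as `f z`; the noise `ε n` is fresh because the design uses indices below `n`. Later `θ = 0` gives
the posterior of `f z` and `θ = 1` the prediction error of the next observation. -/
theorem covariance_residual_designObs (h : IsGPRegression P X k σ f ε) {n : ℕ} (a : Fin n → X)
    (z : X) (θ : ℝ) (j : Fin n) :
    cov[residual k σ f ε a z θ, fun ω => designObs f ε a ω j; P] = 0 := by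
  have hm : ∀ i, MemLp (fun ω => postWeight k σ a z i * designObs f ε a ω i) 2 P :=
    fun i => (h.designObs_memLp a i).const_mul _
  have e : residual k σ f ε a z θ = (f z - fun ω => ∑ i, postWeight k σ a z i * designObs f ε a ω i)
      + fun ω => θ * ε n ω := by
    ext ω; simp [residual, postMean_eq_sum]
  rw [e, covariance_add_left ((h.gp_memLp z).sub (memLp_finsetSum _ fun i _ => hm i))
      ((h.noise_memLp n).const_mul θ) (h.designObs_memLp a j),
    covariance_sub_left (h.gp_memLp z) (memLp_finsetSum _ fun i _ => hm i) (h.designObs_memLp a j),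
    covariance_fun_sum_left hm (h.designObs_memLp a j), covariance_const_mul_left,
    h.covariance_noise_designObs, h.covariance_gp_designObs]
  simp only [covariance_const_mul_left, h.covariance_designObs]
  have := congrFun (h.postWeight_vecMul a z) j
  simp only [Matrix.vecMul, dotProduct] at this
  rw [this]; ring

theorem integral_residual (h : IsGPRegression P X k σ f ε) {n : ℕ} (a : Fin n → X) (z : X) (θ : ℝ) :
    ∫ ω, residual k σ f ε a z θ ω ∂P = 0 := by
  have hi : ∀ z : X, Integrable (f z) P := fun z => (h.gp_memLp z).integrable one_le_two
  have hn : ∀ t, Integrable (ε t) P := fun t => (h.noise_memLp t).integrable one_le_two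
  have hY : ∀ i, Integrable (fun ω => designObs f ε a ω i) P :=
    fun i => (h.designObs_memLp a i).integrable one_le_two
  have hY0 : ∀ i, ∫ ω, designObs f ε a ω i ∂P = 0 := fun i => by
    simp only [designObs]
    rw [integral_add (hi _) (hn _), h.gp.mean_zero _ (a i).2, h.integral_noise, add_zero]
  simp only [residual, postMean_eq_sum]
  have hS : Integrable (fun ω => ∑ i, postWeight k σ a z i * designObs f ε a ω i) P :=
    integrable_finsetSum _ fun i _ => (hY i).const_mul _
  rw [integral_add (f := fun ω => f z ω - ∑ i, postWeight k σ a z i * designObs f ε a ω i)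
      ((hi z).sub hS) ((hn n).const_mul θ), integral_sub (hi z) hS,
    integral_finsetSum _ fun i _ => (hY i).const_mul _, integral_const_mul, h.integral_noise,
    h.gp.mean_zero _ z.2]
  simp [integral_const_mul, hY0]

theorem variance_residual (h : IsGPRegression P X k σ f ε) {n : ℕ} (a : Fin n → X) (z : X) (θ : ℝ) :
    Var[residual k σ f ε a z θ; P] = postVar k σ (fun i => (a i : Pt d)) z + θ ^ 2 * σ ^ 2 := by
  have hm : ∀ i, MemLp (fun ω => postWeight k σ a z i * designObs f ε a ω i) 2 P :=
    fun i => (h.designObs_memLp a i).const_mul _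
  have hmS := memLp_finsetSum (μ := P) (p := 2) Finset.univ (fun i _ => hm i)
  have hR := h.residual_memLp a z θ
  have e : residual k σ f ε a z θ = (f z - fun ω => ∑ i, postWeight k σ a z i * designObs f ε a ω i)
      + fun ω => θ * ε n ω := by
    ext ω; simp [residual, postMean_eq_sum]
  have c0 : cov[residual k σ f ε a z θ, fun ω => ∑ i, postWeight k σ a z i * designObs f ε a ω i; P]
      = 0 := by
    rw [covariance_fun_sum_right hm hR]
    simp [covariance_const_mul_right, h.covariance_residual_designObs]
  have c1 : cov[residual k σ f ε a z θ, f z; P] = postVar k σ (fun i => (a i : Pt d)) z := by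
    rw [e, covariance_add_left ((h.gp_memLp z).sub hmS) ((h.noise_memLp n).const_mul θ)
      (h.gp_memLp z), covariance_sub_left (h.gp_memLp z) hmS (h.gp_memLp z),
      covariance_fun_sum_left hm (h.gp_memLp z), covariance_const_mul_left,
      covariance_comm (ε n), h.covariance_gp_noise, h.gp.covariance _ z.2 _ z.2, postVar_eq_sum]
    simp only [covariance_const_mul_left, mul_zero, add_zero]
    congr 2 with i
    rw [covariance_comm, h.covariance_gp_designObs]
  have c2 : cov[residual k σ f ε a z θ, fun ω => θ * ε n ω; P] = θ ^ 2 * σ ^ 2 := by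
    rw [e, covariance_add_left ((h.gp_memLp z).sub hmS) ((h.noise_memLp n).const_mul θ)
      ((h.noise_memLp n).const_mul θ), covariance_sub_left (h.gp_memLp z) hmS
      ((h.noise_memLp n).const_mul θ),
      covariance_fun_sum_left hm ((h.noise_memLp n).const_mul θ)]
    simp only [covariance_const_mul_right, h.covariance_gp_noise, h.covariance_noise,
      covariance_comm _ (ε n), h.covariance_noise_designObs]
    simp; ring
  rw [← covariance_self hR.aemeasurable]
  -- Only one argument of the covariance is expanded, so that the posterior mean drops out by
  -- orthogonality (`c0`).
  nth_rw 2 [e]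
  rw [covariance_add_right hR ((h.gp_memLp z).sub hmS) ((h.noise_memLp n).const_mul θ),
    covariance_sub_right hR (h.gp_memLp z) hmS, c0, c1, c2, sub_zero]

theorem postVar_nonneg (h : IsGPRegression P X k σ f ε) {n : ℕ} (a : Fin n → X) (z : X) :
    0 ≤ postVar k σ (fun i => (a i : Pt d)) z := by
  have := h.variance_residual a z 0
  have h0 := variance_nonneg (residual k σ f ε a z 0) P
  simp at this
  linarith

/-- Law of total variance: the prior variance `1` exceeds the posterior variance by the variance of
the posterior mean, which is nonnegative. -/
theorem postVar_le_one (h : IsGPRegression P X k σ f ε) {n : ℕ} (a : Fin n → X) (z : X) :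
    postVar k σ (fun i => (a i : Pt d)) z ≤ 1 := by
  have hm : ∀ i, MemLp (fun ω => postWeight k σ a z i * designObs f ε a ω i) 2 P :=
    fun i => (h.designObs_memLp a i).const_mul _
  have h0 := variance_nonneg (fun ω => ∑ i, postWeight k σ a z i * designObs f ε a ω i) P
  rw [variance_fun_sum hm] at h0
  simp only [covariance_const_mul_left, covariance_const_mul_right, h.covariance_designObs] at h0
  have h1 : ∑ i, ∑ j, postWeight k σ a z i * (postWeight k σ a z j *
      regGram k σ (fun i => (a i : Pt d)) i j) = ∑ j, postWeight k σ a z j * k z (a j) := by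
    rw [Finset.sum_comm]
    refine Finset.sum_congr rfl fun j _ => ?_
    rw [← congrFun (h.postWeight_vecMul a z) j]
    simp only [Matrix.vecMul, dotProduct, Finset.mul_sum]
    exact Finset.sum_congr rfl fun i _ => by ring
  rw [postVar_eq_sum, h.unit z z.2]
  simp only [mul_left_comm] at h0 h1
  linarith

theorem residual_process (h : IsGPRegression P X k σ f ε) {n : ℕ} (a : Fin n → X) (z : X) (θ : ℝ) :
    IsGaussianProcess (Sum.elim (fun _ : Unit => residual k σ f ε a z θ)
      (fun i ω => designObs f ε a ω i)) P := by
  let o : Fin n → (X ⊕ ℕ) →₀ ℝ := fun i =>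
    Finsupp.single (Sum.inl (a i)) 1 + Finsupp.single (Sum.inr (i : ℕ)) 1
  have := IsGaussianProcess_linearCombination h.pooled (Sum.elim
    (fun _ : Unit => Finsupp.single (Sum.inl z) 1 - ∑ i, postWeight k σ a z i • o i
      + Finsupp.single (Sum.inr n) θ) o)
  convert! this using 1
  ext s ω
  rcases s with s | i
  · simp [residual, postMean_eq_sum, o, designObs, mul_add]
  · simp [o, designObs]

/-- Uncorrelated and jointly Gaussian implies independent. This is what turns the matrix formulas
for the posterior into a conditional law. -/
theorem indepFun_residual (h : IsGPRegression P X k σ f ε) {n : ℕ} (a : Fin n → X) (z : X)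
    (θ : ℝ) : IndepFun (designObs f ε a) (residual k σ f ε a z θ) P := by
  have := (h.residual_process a z θ).indepFun_of_covariance_eq_zero
    (fun _ => (h.residual_memLp a z θ).aemeasurable) (fun i => (h.designObs_memLp a i).aemeasurable)
    (fun _ i => h.covariance_residual_designObs a z θ i)
  exact (this.comp (φ := fun v : Unit → ℝ => v ()) (ψ := id) (by fun_prop) measurable_id).symm

theorem map_residual (h : IsGPRegression P X k σ f ε) {n : ℕ} (a : Fin n → X) (z : X) (θ : ℝ) :
    P.map (residual k σ f ε a z θ) =
      gaussianReal 0 (postVar k σ (fun i => (a i : Pt d)) z + θ ^ 2 * σ ^ 2).toNNReal := by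
  have := ((h.residual_process a z θ).hasGaussianLaw_eval (Sum.inl ())).map_eq_gaussianReal
  simp only [Sum.elim_inl] at this
  rw [this, h.integral_residual, h.variance_residual]

end IsGPRegression

/-! ### Bayes' formula for a fixed design, at every vector of observations. -/

namespace IsGPRegression

variable {Ω : Type*} [MeasurableSpace Ω] {P : Measure Ω} [IsProbabilityMeasure P] {d : ℕ}
  {X : Set (Pt d)} {k : Pt d → Pt d → ℝ} {σ : ℝ} {f : Pt d → Ω → ℝ} {ε : ℕ → Ω → ℝ}

theorem toNNReal_ne_zero (h : IsGPRegression P X k σ f ε) : (σ ^ 2).toNNReal ≠ 0 := by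
  simpa using h.sigma_pos.ne'

/-- The joint law of a variable `Z` independent of the noise and of the observations of a fixed
design whose function values are determined by `Z`. -/
theorem lintegral_designObs (h : IsGPRegression P X k σ f ε) {B : Type*} [MeasurableSpace B]
    {Z : Ω → B} (hZ : Measurable Z) (hZε : IndepFun Z (fun ω t => ε t ω) P) {n : ℕ} (a : Fin n → X)
    {g : Fin n → B → ℝ} (hg : ∀ i, Measurable (g i)) (hgf : ∀ i ω, f (a i) ω = g i (Z ω))
    {H : B × (Fin n → ℝ) → ℝ≥0∞} (hH : Measurable H) :
    ∫⁻ ω, H (Z ω, designObs f ε a ω) ∂P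
      = ∫⁻ b, (∫⁻ y : Fin n → ℝ, H (b, y) *
          ∏ i : Fin n, gaussianPDF (g i b) (σ ^ 2).toNNReal (y i)) ∂(P.map Z) := by
  -- The noise model runs over all rounds, so the means are extended by `0` beyond the design.
  let g' : ℕ → B → ℝ := fun t b => if ht : t < n then g ⟨t, ht⟩ b else 0
  have hg' : ∀ t, Measurable (g' t) := fun t => by
    by_cases ht : t < n
    · simpa [g', ht] using hg ⟨t, ht⟩
    · simp [g', ht]
  have hN : IsNoiseModel P Z ε (fun t ω => g' t (Z ω) + ε t ω) (σ ^ 2).toNNReal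
      (fun t q => g' t q.1) :=
    { meas_Z := hZ
      meas_ε := h.noise.measurable
      meas_m := fun t => (hg' t).comp measurable_fst
      law := h.noise.law
      iIndep := h.noise.indep
      indep := hZε
      eq := fun t => ae_of_all _ fun ω => rfl }
  have := hN.lintegral_eq h.toNNReal_ne_zero n hH
  simp only [g', Fin.is_lt, dite_true, Fin.eta, ← hgf] at this
  exact this

theorem lintegral_gaussian_standardize {H : ℝ → ℝ≥0∞} (hH : Measurable H) {v : ℝ} (hv : 0 ≤ v)
    (m : ℝ) : ∫⁻ r, H (m + r) ∂(gaussianReal 0 v.toNNReal)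
      = ∫⁻ r, H (m + √v * r) ∂(gaussianReal 0 1) := by
  have : gaussianReal 0 v.toNNReal = (gaussianReal 0 1).map (√v * ·) := by
    rw [gaussianReal_map_const_mul]
    congr 1
    · simp
    · ext; simp [Real.sq_sqrt hv, Real.coe_toNNReal _ hv]
  rw [this, lintegral_map (f := fun r => H (m + r)) (hH.comp (by fun_prop)) (by fun_prop)]

theorem measurable_postMean_obs {n : ℕ} (a : Fin n → X) (z : X) :
    Measurable fun y => postMean k σ (fun i => (a i : Pt d)) y z := by
  simp only [postMean_eq_sum]
  fun_prop

theorem continuous_postMean_obs {n : ℕ} (a : Fin n → X) (z : X) :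
    Continuous fun y => postMean k σ (fun i => (a i : Pt d)) y z := by
  simp only [postMean_eq_sum]
  fun_prop

/-- Posterior of `f z` given the observations of a fixed design, integrated over the
observations. -/
theorem lintegral_gp_designObs (h : IsGPRegression P X k σ f ε) {n : ℕ} (a : Fin n → X) (z : X)
    {H : ℝ × (Fin n → ℝ) → ℝ≥0∞} (hH : Measurable H) :
    ∫⁻ ω, H (f z ω, designObs f ε a ω) ∂P
      = ∫⁻ ω, (∫⁻ r, H (postMean k σ (fun i => (a i : Pt d)) (designObs f ε a ω) z
          + √(postVar k σ (fun i => (a i : Pt d)) z) * r, designObs f ε a ω)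
            ∂(gaussianReal 0 1)) ∂P := by
  have hY := h.designObs_measurable a
  have hμ := measurable_postMean_obs (k := k) (σ := σ) a z
  have hR := (h.residual_memLp a z 0).aemeasurable
  have e : ∀ ω, f z ω = postMean k σ (fun i => (a i : Pt d)) (designObs f ε a ω) z
      + residual k σ f ε a z 0 ω := fun ω => by simp [residual]
  set G : (Fin n → ℝ) × ℝ → ℝ≥0∞ :=
    fun p => H (postMean k σ (fun i => (a i : Pt d)) p.1 z + p.2, p.1) with hG
  have hGm : Measurable G := hH.comp (by fun_prop)
  calc _ = ∫⁻ ω, G (designObs f ε a ω, residual k σ f ε a z 0 ω) ∂P :=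
        lintegral_congr fun ω => by rw [e ω]
    _ = ∫⁻ y, (∫⁻ r, G (y, r) ∂(P.map (residual k σ f ε a z 0))) ∂(P.map (designObs f ε a)) := by
        rw [← lintegral_prod _ hGm.aemeasurable,
          ← (indepFun_iff_map_prod_eq_prod_map_map hY.aemeasurable hR).1 (h.indepFun_residual a z 0),
          lintegral_map' hGm.aemeasurable (hY.aemeasurable.prodMk hR)]
    _ = ∫⁻ y, (∫⁻ r, H (postMean k σ (fun i => (a i : Pt d)) y z
          + √(postVar k σ (fun i => (a i : Pt d)) z) * r, y)
            ∂(gaussianReal 0 1)) ∂(P.map (designObs f ε a)) := by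
        refine lintegral_congr fun y => ?_
        rw [h.map_residual a z 0]
        simp only [hG, ne_eq, OfNat.ofNat_ne_zero, not_false_eq_true, zero_pow, zero_mul, add_zero]
        exact lintegral_gaussian_standardize (H := fun u => H (u, y))
          (hH.comp (by fun_prop)) (h.postVar_nonneg a z) _
    _ = _ := by
        rw [lintegral_map _ hY]
        refine Measurable.lintegral_prod_right' (f := fun p : (Fin n → ℝ) × ℝ =>
          H (postMean k σ (fun i => (a i : Pt d)) p.1 z
          + √(postVar k σ (fun i => (a i : Pt d)) z) * p.2, p.1)) (hH.comp (by fun_prop))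

/-- The likelihood of the observations `y` of a fixed design. -/
def likelihood (σ : ℝ) (f : Pt d → Ω → ℝ) {n : ℕ} (a : Fin n → X) (y : Fin n → ℝ) (ω : Ω) : ℝ :=
  ∏ i, gaussianPDFReal (f (a i) ω) (σ ^ 2).toNNReal (y i)

theorem ofReal_likelihood {n : ℕ} (a : Fin n → X) (y : Fin n → ℝ) (ω : Ω) :
    ENNReal.ofReal (likelihood σ f a y ω)
      = ∏ i, gaussianPDF (f (a i) ω) (σ ^ 2).toNNReal (y i) := by
  rw [likelihood, ENNReal.ofReal_prod_of_nonneg fun i _ => gaussianPDFReal_nonneg _ _ _]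
  rfl

theorem likelihood_nonneg {n : ℕ} (a : Fin n → X) (y : Fin n → ℝ) (ω : Ω) :
    0 ≤ likelihood σ f a y ω :=
  Finset.prod_nonneg fun _ _ => gaussianPDFReal_nonneg _ _ _

theorem gaussianPDFReal_le (m : ℝ) (v : NNReal) (x : ℝ) :
    gaussianPDFReal m v x ≤ (√(2 * Real.pi * v))⁻¹ := by
  rw [gaussianPDFReal]
  refine mul_le_of_le_one_right (by positivity) (Real.exp_le_one_iff.2 ?_)
  exact div_nonpos_of_nonpos_of_nonneg (neg_nonpos.2 (sq_nonneg _)) (by positivity)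

theorem likelihood_le {n : ℕ} (a : Fin n → X) (y : Fin n → ℝ) (ω : Ω) :
    likelihood σ f a y ω ≤ (√(2 * Real.pi * (σ ^ 2).toNNReal))⁻¹ ^ n := by
  rw [likelihood]
  calc _ ≤ ∏ _ : Fin n, (√(2 * Real.pi * (σ ^ 2).toNNReal))⁻¹ :=
        Finset.prod_le_prod (fun _ _ => gaussianPDFReal_nonneg _ _ _)
          fun _ _ => gaussianPDFReal_le _ _ _
    _ = _ := by simp

theorem measurable_likelihood (h : IsGPRegression P X k σ f ε) {n : ℕ} (a : Fin n → X) :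
    Measurable fun p : Ω × (Fin n → ℝ) => likelihood σ f a p.2 p.1 := by
  refine Finset.measurable_prod _ fun i _ => ?_
  have := h.gp.measurable _ (a i).2
  exact measurable_uncurry_gaussianPDFReal.comp ((this.comp measurable_fst).prodMk
    (measurable_const.prodMk ((measurable_pi_apply i).comp measurable_snd)))

theorem measurable_likelihood_left (h : IsGPRegression P X k σ f ε) {n : ℕ} (a : Fin n → X)
    (y : Fin n → ℝ) : Measurable fun ω => likelihood σ f a y ω := by
  refine Finset.measurable_prod _ fun i _ => ?_
  have := h.gp.measurable _ (a i).2
  exact measurable_uncurry_gaussianPDFReal.comp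
    (this.prodMk (measurable_const.prodMk (measurable_const (a := y i))))

theorem continuous_likelihood {n : ℕ} (a : Fin n → X) (ω : Ω) :
    Continuous fun y => likelihood σ f a y ω := by
  unfold likelihood gaussianPDFReal
  fun_prop

/-- Dominated convergence: the likelihood is bounded, uniformly in `y` and `ω`, by a power of the
peak of the normal density. -/
theorem continuous_integral_likelihood (h : IsGPRegression P X k σ f ε) {n : ℕ} (a : Fin n → X)
    {g : Ω → ℝ} (hg : Measurable g) {C : ℝ} (hC : ∀ ω, |g ω| ≤ C) :
    Continuous fun y => ∫ ω, g ω * likelihood σ f a y ω ∂P := by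
  refine continuous_of_dominated (bound := fun _ => C * (√(2 * Real.pi * (σ ^ 2).toNNReal))⁻¹ ^ n)
    (fun y => ?_) (fun y => ae_of_all _ fun ω => ?_) (integrable_const _)
    (ae_of_all _ fun ω => continuous_const.mul (continuous_likelihood a ω))
  · exact (hg.mul (h.measurable_likelihood_left a y)).aestronglyMeasurable
  · rw [norm_mul, Real.norm_eq_abs, Real.norm_eq_abs, abs_of_nonneg (likelihood_nonneg a y ω)]
    have := hC ω
    exact mul_le_mul this (likelihood_le a y ω) (likelihood_nonneg a y ω) ((abs_nonneg _).trans this)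

/-- The joint law of `f z` and the observations of a fixed design. -/
theorem lintegral_gp_designObs_likelihood (h : IsGPRegression P X k σ f ε) {n : ℕ} (a : Fin n → X)
    (z : X) {K : ℝ × (Fin n → ℝ) → ℝ≥0∞} (hK : Measurable K) :
    ∫⁻ ω, K (f z ω, designObs f ε a ω) ∂P
      = ∫⁻ y, ∫⁻ ω, K (f z ω, y) * ENNReal.ofReal (likelihood σ f a y ω) ∂P := by
  have hfz := h.gp.measurable z z.2
  have hlik := h.measurable_likelihood a
  have hZ : Measurable fun ω => (f z ω, fun i => f (a i) ω) :=
    hfz.prodMk (measurable_pi_iff.2 fun i => h.gp.measurable _ (a i).2)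
  have hZε : IndepFun (fun ω => (f z ω, fun i => f (a i) ω)) (fun ω t => ε t ω) P :=
    h.indep.comp (φ := fun v : X → ℝ => (v z, fun i => v (a i))) (ψ := id) (by fun_prop)
      measurable_id
  have h1 := h.lintegral_designObs hZ hZε a (g := fun i b => b.2 i) (fun i => by fun_prop)
    (fun i ω => rfl) (H := fun q => K (q.1.1, q.2)) (hK.comp (by fun_prop))
  rw [h1, lintegral_map _ hZ, lintegral_lintegral_swap]
  · simp only [ofReal_likelihood]
  · have : Measurable fun p : Ω × (Fin n → ℝ) =>
        K (f z p.1, p.2) * ENNReal.ofReal (likelihood σ f a p.2 p.1) :=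
      (hK.comp (by fun_prop)).mul (by fun_prop)
    simp only [ofReal_likelihood] at this
    exact this.aemeasurable
  · refine Measurable.lintegral_prod_right' (f := fun p : (ℝ × (Fin n → ℝ)) × (Fin n → ℝ) =>
      K (p.1.1, p.2) * ∏ i, gaussianPDF (p.1.2 i) (σ ^ 2).toNNReal (p.2 i)) ?_
    refine (hK.comp (by fun_prop)).mul (Finset.measurable_prod _ fun i _ => ?_)
    exact measurable_uncurry_gaussianPDF.comp (by fun_prop : Measurable
      fun p : (ℝ × (Fin n → ℝ)) × (Fin n → ℝ) => (p.1.2 i, (σ ^ 2).toNNReal, p.2 i))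

/-- Testing the joint law of `f z` and the observations on sets of observations gives the identity
for almost every `y`. For bounded continuous `g` both sides are continuous in `y`, and two
continuous functions that agree Lebesgue-almost everywhere are equal. -/
theorem lintegral_continuous_mul_likelihood (h : IsGPRegression P X k σ f ε) {n : ℕ}
    (a : Fin n → X) (z : X) (y : Fin n → ℝ) (g : BoundedContinuousFunction ℝ NNReal) :
    ∫⁻ ω, g (f z ω) * ENNReal.ofReal (likelihood σ f a y ω) ∂P
      = (∫⁻ r, g (postMean k σ (fun i => (a i : Pt d)) y z
          + √(postVar k σ (fun i => (a i : Pt d)) z) * r) ∂(gaussianReal 0 1))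
        * ∫⁻ ω, ENNReal.ofReal (likelihood σ f a y ω) ∂P := by
  set μ : (Fin n → ℝ) → ℝ := fun y => postMean k σ (fun i => (a i : Pt d)) y z with hμdef
  set s := √(postVar k σ (fun i => (a i : Pt d)) z)
  have hμ : Measurable μ := measurable_postMean_obs a z
  have hμc : Continuous μ := continuous_postMean_obs a z
  have hfz := h.gp.measurable z z.2
  have hlik := h.measurable_likelihood a
  have hliky : ∀ y, Measurable fun ω => likelihood σ f a y ω := h.measurable_likelihood_left a
  have hgm : Measurable fun x => (g x : ℝ≥0∞) := by
    have := g.continuous.measurable; fun_prop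
  have hgr : Measurable fun x => (g x : ℝ) := by
    have := g.continuous.measurable; fun_prop
  have hgc : Continuous fun x => (g x : ℝ) := by
    have := g.continuous; fun_prop
  obtain ⟨C, hC⟩ : ∃ C : ℝ, ∀ x, |(g x : ℝ)| ≤ C := by
    refine ⟨nndist g 0, fun x => ?_⟩
    have := g.dist_coe_le_dist (g := 0) x
    simpa [NNReal.dist_eq] using this
  set Λ := fun y ω => likelihood σ f a y ω
  have hΛ0 : ∀ y ω, 0 ≤ Λ y ω := fun y ω => likelihood_nonneg a y ω
  have intΛ : ∀ y, Integrable (Λ y) P := fun y =>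
    Integrable.of_bound (hliky y).aestronglyMeasurable
      ((√(2 * Real.pi * (σ ^ 2).toNNReal))⁻¹ ^ n) (ae_of_all _ fun ω => by
        rw [Real.norm_of_nonneg (hΛ0 y ω)]; exact likelihood_le a y ω)
  have intgΛ : ∀ y, Integrable (fun ω => (g (f z ω) : ℝ) * Λ y ω) P := fun y =>
    (intΛ y).bdd_mul (c := C) (hgr.comp hfz).aestronglyMeasurable (ae_of_all _ fun ω => hC _)
  have intJ : ∀ y, Integrable (fun r => (g (μ y + s * r) : ℝ)) (gaussianReal 0 1) := fun y =>
    Integrable.of_bound (hgr.comp (by fun_prop)).aestronglyMeasurable C (ae_of_all _ fun _ => hC _)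
  set L : (Fin n → ℝ) → ℝ := fun y => ∫ ω, (g (f z ω) : ℝ) * Λ y ω ∂P with hL
  set J : (Fin n → ℝ) → ℝ := fun y => ∫ r, (g (μ y + s * r) : ℝ) ∂(gaussianReal 0 1) with hJ
  set M : (Fin n → ℝ) → ℝ := fun y => ∫ ω, Λ y ω ∂P with hM
  have eL : ∀ y, ∫⁻ ω, g (f z ω) * ENNReal.ofReal (Λ y ω) ∂P = ENNReal.ofReal (L y) := by
    intro y
    rw [hL, ofReal_integral_eq_lintegral_ofReal (intgΛ y)
      (ae_of_all _ fun ω => mul_nonneg (NNReal.coe_nonneg _) (hΛ0 y ω))]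
    refine lintegral_congr fun ω => ?_
    rw [ENNReal.ofReal_mul (NNReal.coe_nonneg _), ENNReal.ofReal_coe_nnreal]
  have eJ : ∀ y, ∫⁻ r, g (μ y + s * r) ∂(gaussianReal 0 1) = ENNReal.ofReal (J y) := by
    intro y
    rw [hJ, ofReal_integral_eq_lintegral_ofReal (intJ y)
      (ae_of_all _ fun ω => NNReal.coe_nonneg _)]
    exact lintegral_congr fun r => (ENNReal.ofReal_coe_nnreal).symm
  have eM : ∀ y, ∫⁻ ω, ENNReal.ofReal (Λ y ω) ∂P = ENNReal.ofReal (M y) := fun y =>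
    (ofReal_integral_eq_lintegral_ofReal (intΛ y) (ae_of_all _ (hΛ0 y))).symm
  have L0 : ∀ y, 0 ≤ L y := fun y => integral_nonneg fun ω =>
    mul_nonneg (NNReal.coe_nonneg _) (hΛ0 y ω)
  have J0 : ∀ y, 0 ≤ J y := fun y => integral_nonneg fun ω => NNReal.coe_nonneg _
  have M0 : ∀ y, 0 ≤ M y := fun y => integral_nonneg (hΛ0 y)
  have cL : Continuous L := h.continuous_integral_likelihood a (hgr.comp hfz) fun ω => hC _
  have cM : Continuous M := by
    simpa using h.continuous_integral_likelihood a (g := fun _ => 1) measurable_const (C := 1)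
      (by simp)
  have cJ : Continuous J := by
    refine continuous_of_dominated (bound := fun _ => C) (fun y => (intJ y).aestronglyMeasurable)
      (fun y => ae_of_all _ fun r => hC _) (integrable_const _) (ae_of_all _ fun r => ?_)
    exact hgc.comp (by fun_prop)
  have hae : (fun y => ENNReal.ofReal (L y)) =ᵐ[volume]
      fun y => ENNReal.ofReal (J y * M y) := by
    refine ae_eq_of_forall_setLIntegral_eq_of_sigmaFinite (by fun_prop) (by fun_prop)
      fun S hS _ => ?_
    rw [← lintegral_indicator hS, ← lintegral_indicator hS]
    have k1 := h.lintegral_gp_designObs_likelihood a z (K := fun p => g p.1 * S.indicator 1 p.2) (by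
      refine (hgm.comp measurable_fst).mul ((measurable_one.indicator hS).comp measurable_snd))
    have hGm : Measurable fun y => ∫⁻ r, g (μ y + s * r) ∂(gaussianReal 0 1) :=
      Measurable.lintegral_prod_right' (f := fun p : (Fin n → ℝ) × ℝ => (g (μ p.1 + s * p.2) : ℝ≥0∞))
        (hgm.comp (by fun_prop))
    have k2 := h.lintegral_gp_designObs_likelihood a z (K := fun p => (∫⁻ r, g (μ p.2 + s * r) ∂(gaussianReal 0 1)) * S.indicator 1 p.2) (by
      refine (hGm.comp measurable_snd).mul ((measurable_one.indicator hS).comp measurable_snd))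
    have k3 := h.lintegral_gp_designObs a z (H := fun p => g p.1 * S.indicator 1 p.2) (by
      refine (hgm.comp measurable_fst).mul ((measurable_one.indicator hS).comp measurable_snd))
    -- `k1` turns the integral over `S` into one over `Ω`, `k3` inserts the conditional law of `f z`
    -- given the data, and `k2` returns to an integral over `y`.
    calc _ = ∫⁻ y, ∫⁻ ω, g (f z ω) * S.indicator 1 y * ENNReal.ofReal (Λ y ω) ∂P := by
          refine lintegral_congr fun y => ?_
          by_cases hy : y ∈ S <;> simp [hy, eL]
      _ = _ := by rw [← k1, k3]
      _ = ∫⁻ ω, (∫⁻ r, g (μ (designObs f ε a ω) + s * r) ∂(gaussianReal 0 1))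
            * S.indicator 1 (designObs f ε a ω) ∂P := by
          refine lintegral_congr fun ω => ?_
          change ∫⁻ r, (g (μ (designObs f ε a ω) + s * r) : ℝ≥0∞)
            * S.indicator 1 (designObs f ε a ω) ∂(gaussianReal 0 1) = _
          exact lintegral_mul_const _ (hgm.comp (g := fun x => (g x : ℝ≥0∞))
            (f := fun r => μ (designObs f ε a ω) + s * r) (by fun_prop))
      _ = _ := k2
      _ = _ := by
          refine lintegral_congr fun y => ?_
          by_cases hy : y ∈ S
          · simp only [hy, Set.indicator_of_mem, Pi.one_apply, mul_one]
            rw [lintegral_const_mul _ (by fun_prop), eJ, eM, ← ENNReal.ofReal_mul (J0 y)]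
          · simp [hy]
  have hae' : L =ᵐ[volume] fun y => J y * M y := by
    filter_upwards [hae] with y hy
    exact (ENNReal.ofReal_eq_ofReal_iff (L0 y) (mul_nonneg (J0 y) (M0 y))).1 hy
  have heq := (Continuous.ae_eq_iff_eq volume cL (cJ.mul cM)).1 hae'
  rw [eL, eJ, eM, ← ENNReal.ofReal_mul (J0 y)]
  exact congrArg _ (congrFun heq y)

/-- Bayes' formula for the posterior of `f z`, valid for every vector `y` of observations. -/
theorem lintegral_mul_likelihood (h : IsGPRegression P X k σ f ε) {n : ℕ} (a : Fin n → X) (z : X)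
    (y : Fin n → ℝ) {H : ℝ → ℝ≥0∞} (hH : Measurable H) :
    ∫⁻ ω, H (f z ω) * ENNReal.ofReal (likelihood σ f a y ω) ∂P
      = (∫⁻ r, H (postMean k σ (fun i => (a i : Pt d)) y z
          + √(postVar k σ (fun i => (a i : Pt d)) z) * r) ∂(gaussianReal 0 1))
        * ∫⁻ ω, ENNReal.ofReal (likelihood σ f a y ω) ∂P := by
  set μ : (Fin n → ℝ) → ℝ := fun y => postMean k σ (fun i => (a i : Pt d)) y z with hμdef
  set s := √(postVar k σ (fun i => (a i : Pt d)) z)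
  have hμ : Measurable μ := measurable_postMean_obs a z
  have hμc : Continuous μ := continuous_postMean_obs a z
  have hfz := h.gp.measurable z z.2
  have hlik := h.measurable_likelihood a
  have hliky : ∀ y, Measurable fun ω => likelihood σ f a y ω := h.measurable_likelihood_left a
  have hfin : ∫⁻ ω, ENNReal.ofReal (likelihood σ f a y ω) ∂P ≠ ∞ := by
    refine ((lintegral_mono fun ω => ENNReal.ofReal_le_ofReal (likelihood_le a y ω)).trans_lt
      ?_).ne
    simp
  have hwd : ∀ {K : ℝ → ℝ≥0∞}, Measurable K →
      ∫⁻ x, K x ∂((P.withDensity fun ω => ENNReal.ofReal (likelihood σ f a y ω)).map (f z))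
        = ∫⁻ ω, K (f z ω) * ENNReal.ofReal (likelihood σ f a y ω) ∂P := by
    intro K hK
    rw [lintegral_map hK hfz, lintegral_withDensity_eq_lintegral_mul _ (hliky y).ennreal_ofReal
      (g := fun ω => K (f z ω)) (hK.comp hfz)]
    simp only [Pi.mul_apply, mul_comm]
  -- equality of the two finite measures
  have hmeas : (P.withDensity fun ω => ENNReal.ofReal (likelihood σ f a y ω)).map (f z)
      = (∫⁻ ω, ENNReal.ofReal (likelihood σ f a y ω) ∂P) •
        (gaussianReal 0 1).map fun r => μ y + s * r := by
    have : IsFiniteMeasure (P.withDensity fun ω => ENNReal.ofReal (likelihood σ f a y ω)) :=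
      isFiniteMeasure_withDensity hfin
    have : IsFiniteMeasure ((∫⁻ ω, ENNReal.ofReal (likelihood σ f a y ω) ∂P) •
        (gaussianReal 0 1).map fun r => μ y + s * r) := Measure.smul_finite _ hfin
    refine ext_of_forall_lintegral_eq_of_IsFiniteMeasure fun g => ?_
    have hgm : Measurable fun x => (g x : ℝ≥0∞) := by
      have := g.continuous.measurable; fun_prop
    rw [hwd hgm, lintegral_smul_measure, lintegral_map hgm (by fun_prop), smul_eq_mul, mul_comm,
      ← h.lintegral_continuous_mul_likelihood a z y g]
  have := congrArg (fun ν => ∫⁻ x, H x ∂ν) hmeas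
  rw [hwd hH, lintegral_smul_measure, lintegral_map hH (by fun_prop), smul_eq_mul] at this
  rw [mul_comm, ← this]

end IsGPRegression

/-! ### Information gain and the sum of posterior variances. -/

/-- If `μ` and `ν` have positive densities `α` and `β` with respect to the same measure, then
`klDiv μ ν` is the integral of `log α - log β`. -/
theorem klDiv_withDensity_withDensity {E : Type*} [MeasurableSpace E] {base : Measure E}
    [SFinite base] {μ ν : Measure E} [IsProbabilityMeasure μ] [IsProbabilityMeasure ν]
    {α β : E → ℝ} (hα : Measurable α) (hβ : Measurable β) (hα0 : ∀ x, 0 < α x) (hβ0 : ∀ x, 0 < β x)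
    (hμ : μ = base.withDensity fun x => ENNReal.ofReal (α x))
    (hν : ν = base.withDensity fun x => ENNReal.ofReal (β x))
    (hint : Integrable (fun x => Real.log (α x) - Real.log (β x)) μ) :
    InformationTheory.klDiv μ ν
      = ENNReal.ofReal (∫ x, Real.log (α x) - Real.log (β x) ∂μ) := by
  have h1 : μ = ν.withDensity fun x => ENNReal.ofReal (α x / β x) := by
    rw [hν, ← withDensity_mul _ (by fun_prop) (by fun_prop), hμ]
    congr 1 with x
    rw [Pi.mul_apply, ← ENNReal.ofReal_mul (hβ0 x).le, mul_div_cancel₀ _ (hβ0 x).ne']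
  have hac : μ ≪ ν := by
    rw [h1]; exact withDensity_absolutelyContinuous _ _
  have h2 : μ.rnDeriv ν =ᵐ[ν] fun x => ENNReal.ofReal (α x / β x) := by
    nth_rw 1 [h1]
    exact Measure.rnDeriv_withDensity _ (by fun_prop)
  have h3 : llr μ ν =ᵐ[μ] fun x => Real.log (α x) - Real.log (β x) := by
    filter_upwards [hac.ae_le h2] with x hx
    rw [llr, hx, ENNReal.toReal_ofReal (div_pos (hα0 x) (hβ0 x)).le,
      Real.log_div (hα0 x).ne' (hβ0 x).ne']
  rw [InformationTheory.klDiv_of_ac_of_integrable hac (hint.congr h3.symm), integral_congr_ae h3]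
  simp

theorem log_gaussianPDFReal {m : ℝ} {v : NNReal} (hv : v ≠ 0) (x : ℝ) :
    Real.log (gaussianPDFReal m v x)
      = -(Real.log (2 * Real.pi * v) / 2) - (x - m) ^ 2 / (2 * v) := by
  have hv' : (0 : ℝ) < v := by positivity
  rw [gaussianPDFReal, Real.log_mul (by positivity) (by positivity), Real.log_exp, Real.log_inv,
    Real.log_sqrt (by positivity)]
  ring

/-- The sum of `log (1 + σ⁻² σ_t²(x_t)) / 2` over the first `T` rounds. -/
def infoGain {d : ℕ} (k : Pt d → Pt d → ℝ) (σ : ℝ) (xs : ℕ → Pt d) (T : ℕ) : ℝ :=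
  ∑ t ∈ Finset.range T, Real.log (1 + postVar k σ (fun i : Fin t => xs i) (xs t) / σ ^ 2) / 2

namespace IsGPRegression

variable {Ω : Type*} [MeasurableSpace Ω] {P : Measure Ω} [IsProbabilityMeasure P] {d : ℕ}
  {X : Set (Pt d)} {k : Pt d → Pt d → ℝ} {σ : ℝ} {f : Pt d → Ω → ℝ} {ε : ℕ → Ω → ℝ}

/-- Predictive density of the observations of a fixed design. -/
def predictiveDensity (k : Pt d → Pt d → ℝ) (σ : ℝ) (a : ℕ → X) (T : ℕ) (y : Fin T → ℝ) : ℝ :=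
  ∏ i : Fin T, gaussianPDFReal
    (postMean k σ (fun j : Fin i => (a j : Pt d)) (prefixFin y i) (a i))
    (postVar k σ (fun j : Fin i => (a j : Pt d)) (a i) + σ ^ 2).toNNReal (y i)

theorem predictiveVar_pos (h : IsGPRegression P X k σ f ε) {n : ℕ} (a : Fin n → X) (z : X) :
    0 < postVar k σ (fun j => (a j : Pt d)) z + σ ^ 2 :=
  add_pos_of_nonneg_of_pos (h.postVar_nonneg a z) (pow_pos h.sigma_pos 2)

theorem predictiveVar_ne_zero (h : IsGPRegression P X k σ f ε) {n : ℕ} (a : Fin n → X) (z : X) :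
    (postVar k σ (fun j => (a j : Pt d)) z + σ ^ 2).toNNReal ≠ 0 := by
  simpa using h.predictiveVar_pos a z

theorem measurable_predictiveDensity (a : ℕ → X) (T : ℕ) :
    Measurable (predictiveDensity k σ a T) := by
  refine Finset.measurable_prod _ fun i _ => ?_
  have h1 : Measurable fun y : Fin T → ℝ => prefixFin y i :=
    measurable_pi_iff.2 fun j => measurable_pi_apply _
  have h2 := (measurable_postMean_obs (k := k) (σ := σ) (fun j : Fin i => a j) (a i)).comp h1
  exact measurable_uncurry_gaussianPDFReal.comp
    (h2.prodMk (measurable_const.prodMk (measurable_pi_apply i)))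

/-- Chain rule for densities: the innovation of observation `t` is the residual with `θ = 1`,
independent of the earlier observations and normal with variance the posterior variance plus `σ²`.
-/
theorem map_designObs (h : IsGPRegression P X k σ f ε) (a : ℕ → X) (T : ℕ) :
    P.map (designObs f ε fun i : Fin T => a i)
      = volume.withDensity fun y => ENNReal.ofReal (predictiveDensity k σ a T y) := by
  have hY := h.designObs_measurable fun i : Fin T => a i
  have e : ∀ t, (fun ω => f (a t) ω + ε t ω - postMean k σ (fun j : Fin t => (a j : Pt d))
      (designObs f ε (fun j : Fin t => a j) ω) (a t))
      = residual k σ f ε (fun j : Fin t => a j) (a t) 1 := by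
    intro t; ext ω; simp [residual]; ring
  ext S hS
  have hseq := lintegral_sequential_gaussian (P := P) (Z := fun _ => ()) measurable_const
    (Y := fun t ω => f (a t) ω + ε t ω)
    (fun t => ((h.gp.measurable _ (a t).2).add (h.noise.measurable t)).aemeasurable)
    (v := fun t => (postVar k σ (fun j : Fin t => (a j : Pt d)) (a t) + σ ^ 2).toNNReal)
    (fun t => h.predictiveVar_ne_zero (fun j : Fin t => a j) (a t))
    (m := fun t q => postMean k σ (fun j : Fin t => (a j : Pt d)) q.2 (a t))
    (fun t => (measurable_postMean_obs (fun j : Fin t => a j) (a t)).comp measurable_snd) T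
    (fun t _ => ?_) (fun t _ => ?_) T le_rfl
    (H := fun q => S.indicator 1 q.2) ((measurable_one.indicator hS).comp measurable_snd)
  · rw [Measure.map_apply hY hS, withDensity_apply _ hS, ← lintegral_indicator_one (hY hS)]
    refine Eq.trans (lintegral_congr fun ω => ?_) (hseq.trans ?_)
    · rfl
    · rw [Measure.map_const, measure_univ, one_smul, lintegral_dirac, ← lintegral_indicator hS]
      refine lintegral_congr fun y => ?_
      by_cases hy : y ∈ S
      · simp only [hy, Set.indicator_of_mem, Pi.one_apply, one_mul, predictiveDensity]
        rw [ENNReal.ofReal_prod_of_nonneg fun i _ => gaussianPDFReal_nonneg _ _ _]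
        rfl
      · simp [hy]
  · have := (h.indepFun_residual (fun j : Fin t => a j) (a t) 1).comp
      (φ := fun y => ((), y)) (ψ := id) (by fun_prop) measurable_id
    rw [← e] at this
    exact this
  · have := h.map_residual (fun j : Fin t => a j) (a t) 1
    rw [← e] at this
    simp only [one_pow, one_mul] at this
    exact this

/-- The mutual information between the observations and the function values of a design. -/
theorem mutualInfo_designObs (h : IsGPRegression P X k σ f ε) (a : ℕ → X) (T : ℕ) :
    mutualInfo P (designObs f ε fun i : Fin T => a i) (fun ω (i : Fin T) => f (a i) ω)
      = ENNReal.ofReal (infoGain k σ (fun t => (a t : Pt d)) T) := by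
  set Y := designObs f ε fun i : Fin T => a i with hYdef
  set V := fun ω (i : Fin T) => f (a i) ω with hVdef
  have hY : Measurable Y := h.designObs_measurable _
  have hV : Measurable V := measurable_pi_iff.2 fun i => h.gp.measurable _ (a i).2
  have := Measure.isProbabilityMeasure_map (μ := P) hV.aemeasurable
  have := Measure.isProbabilityMeasure_map (μ := P) hY.aemeasurable
  have := Measure.isProbabilityMeasure_map (μ := P) (hY.prodMk hV).aemeasurable
  have hs := h.toNNReal_ne_zero
  have hβm := measurable_predictiveDensity (k := k) (σ := σ) a T
  set α : (Fin T → ℝ) × (Fin T → ℝ) → ℝ :=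
    fun p => ∏ i, gaussianPDFReal (p.2 i) (σ ^ 2).toNNReal (p.1 i) with hα
  have hαm : Measurable α := by
    refine Finset.measurable_prod _ fun i _ => ?_
    exact measurable_uncurry_gaussianPDFReal.comp (by fun_prop : Measurable
        fun p : (Fin T → ℝ) × (Fin T → ℝ) => (p.2 i, (σ ^ 2).toNNReal, p.1 i))
  have hα0 : ∀ p, 0 < α p := fun p => Finset.prod_pos fun i _ => gaussianPDFReal_pos _ _ _ hs
  have hβ0 : ∀ y, 0 < predictiveDensity k σ a T y := fun y => Finset.prod_pos fun i _ =>
    gaussianPDFReal_pos _ _ _ (h.predictiveVar_ne_zero (fun j : Fin i => a j) (a i))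
  -- The reference measure keeps the law of `V` as a factor, since `V` may have no Lebesgue density,
  -- for example when design points repeat.
  have hJ : P.map (fun ω => (Y ω, V ω))
      = (volume.prod (P.map V)).withDensity fun p => ENNReal.ofReal (α p) := by
    ext S hS
    have hVε : IndepFun V (fun ω t => ε t ω) P :=
      h.indep.comp (φ := fun v : X → ℝ => fun i : Fin T => v (a i)) (ψ := id) (by fun_prop)
        measurable_id
    have h1 := h.lintegral_designObs hV hVε (fun i : Fin T => a i) (g := fun i b => b i)
      (fun i => by fun_prop) (fun i ω => rfl) (H := fun q => S.indicator 1 (q.2, q.1))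
      ((measurable_one.indicator hS).comp measurable_swap)
    rw [Measure.map_apply (hY.prodMk hV) hS, withDensity_apply _ hS,
      ← lintegral_indicator_one ((hY.prodMk hV) hS), ← lintegral_indicator hS,
      lintegral_prod_symm _ ((hαm.ennreal_ofReal).indicator hS).aemeasurable]
    refine Eq.trans (lintegral_congr fun ω => rfl) (h1.trans ?_)
    refine lintegral_congr fun b => lintegral_congr fun y => ?_
    by_cases hy : (y, b) ∈ S
    · simp only [hy, Set.indicator_of_mem, Pi.one_apply, one_mul, hα]
      rw [ENNReal.ofReal_prod_of_nonneg fun i _ => gaussianPDFReal_nonneg _ _ _]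
      rfl
    · simp [hy]
  have hR : (P.map Y).prod (P.map V)
      = (volume.prod (P.map V)).withDensity
        fun p => ENNReal.ofReal (predictiveDensity k σ a T p.1) := by
    rw [hYdef, h.map_designObs a T, prod_withDensity_left (by fun_prop)]
  -- The log-ratio is the information gain plus the normalized squares of the noise and of the
  -- prediction errors. In expectation these contribute `-1/2` and `1/2` per round and cancel.
  have hlog : ∀ ω, Real.log (α (Y ω, V ω)) - Real.log (predictiveDensity k σ a T (Y ω))
      = ∑ t ∈ Finset.range T,
        (Real.log (1 + postVar k σ (fun i : Fin t => (a i : Pt d)) (a t) / σ ^ 2) / 2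
          - (ε t ω) ^ 2 / (2 * σ ^ 2)
          + (residual k σ f ε (fun i : Fin t => a i) (a t) 1 ω) ^ 2
            / (2 * (postVar k σ (fun i : Fin t => (a i : Pt d)) (a t) + σ ^ 2))) := by
    intro ω
    rw [hα, predictiveDensity, Real.log_prod fun i _ => (gaussianPDFReal_pos _ _ _ hs).ne',
      Real.log_prod fun (i : Fin T) _ => (gaussianPDFReal_pos _ _ _
        (h.predictiveVar_ne_zero (fun j : Fin i => a j) (a i))).ne',
      ← Finset.sum_sub_distrib, Finset.sum_range]
    refine Finset.sum_congr rfl fun i _ => ?_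
    have hp := h.predictiveVar_pos (fun j : Fin i => a j) (a i)
    have hp0 := h.postVar_nonneg (fun j : Fin i => a j) (a i)
    have hσ := pow_pos h.sigma_pos 2
    rw [log_gaussianPDFReal hs,
      log_gaussianPDFReal (h.predictiveVar_ne_zero (fun j : Fin i => a j) (a i)),
      Real.coe_toNNReal _ hp.le, Real.coe_toNNReal _ hσ.le]
    have e1 : Y ω i - V ω i = ε i ω := by simp [hYdef, hVdef, designObs]
    have e2 : Y ω i - postMean k σ (fun j : Fin i => (a j : Pt d)) (prefixFin (Y ω) i) (a i)
        = residual k σ f ε (fun i : Fin i => a i) (a i) 1 ω := by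
      simp only [residual, hYdef, one_mul]
      change f (a i) ω + ε i ω - postMean k σ (fun j : Fin i => (a j : Pt d))
        (designObs f ε (fun j : Fin i => a j) ω) (a i) = _
      ring
    have e3 : 1 + postVar k σ (fun j : Fin i => (a j : Pt d)) (a i) / σ ^ 2
        = 2 * Real.pi * (postVar k σ (fun j : Fin i => (a j : Pt d)) (a i) + σ ^ 2)
          / (2 * Real.pi * σ ^ 2) := by
      have := h.sigma_pos.ne'
      field_simp; ring
    have hpi := Real.pi_pos
    rw [e1, e2, e3, Real.log_div (by positivity) (by positivity)]
    ring
  have hres2 : ∀ t, Integrable (fun ω => (residual k σ f ε (fun i : Fin t => a i) (a t) 1 ω) ^ 2) P :=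
    fun t => (h.residual_memLp (fun i : Fin t => a i) (a t) 1).integrable_sq
  have hε2 : ∀ t, Integrable (fun ω => (ε t ω) ^ 2) P := fun t => (h.noise_memLp t).integrable_sq
  have hint1 : ∀ t, Integrable (fun ω =>
      Real.log (1 + postVar k σ (fun i : Fin t => (a i : Pt d)) (a t) / σ ^ 2) / 2
          - (ε t ω) ^ 2 / (2 * σ ^ 2)) P :=
    fun t => (integrable_const _).sub ((hε2 t).div_const _)
  have hint3 : ∀ t, Integrable (fun ω => (residual k σ f ε (fun i : Fin t => a i) (a t) 1 ω) ^ 2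
      / (2 * (postVar k σ (fun i : Fin t => (a i : Pt d)) (a t) + σ ^ 2))) P :=
    fun t => (hres2 t).div_const _
  have hint2 : ∀ t, Integrable (fun ω =>
      Real.log (1 + postVar k σ (fun i : Fin t => (a i : Pt d)) (a t) / σ ^ 2) / 2
          - (ε t ω) ^ 2 / (2 * σ ^ 2)
          + (residual k σ f ε (fun i : Fin t => a i) (a t) 1 ω) ^ 2
            / (2 * (postVar k σ (fun i : Fin t => (a i : Pt d)) (a t) + σ ^ 2))) P :=
    fun t => (hint1 t).add (hint3 t)
  have hint : Integrable (fun p => Real.log (α p) - Real.log (predictiveDensity k σ a T p.1))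
      (P.map fun ω => (Y ω, V ω)) := by
    rw [integrable_map_measure (by fun_prop) (hY.prodMk hV).aemeasurable]
    simp only [Function.comp_def, hlog]
    exact integrable_finsetSum _ fun t _ => hint2 t
  rw [mutualInfo, klDiv_withDensity_withDensity hαm (hβm.comp measurable_fst) hα0
    (fun p => hβ0 p.1) hJ hR hint, integral_map (hY.prodMk hV).aemeasurable (by fun_prop)]
  simp only [Function.comp_apply, hlog]
  congr 1
  rw [integral_finsetSum _ fun t _ => hint2 t, infoGain]
  refine Finset.sum_congr rfl fun t _ => ?_
  have hp := h.predictiveVar_pos (fun j : Fin t => a j) (a t)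
  have hσ := pow_pos h.sigma_pos 2
  have e1 : ∫ ω, (ε t ω) ^ 2 ∂P = σ ^ 2 := by
    rw [← h.variance_noise t, variance_of_integral_eq_zero (h.noise.measurable t).aemeasurable
      (h.integral_noise t)]
  have e2 : ∫ ω, (residual k σ f ε (fun i : Fin t => a i) (a t) 1 ω) ^ 2 ∂P
      = postVar k σ (fun i : Fin t => (a i : Pt d)) (a t) + σ ^ 2 := by
    rw [← variance_of_integral_eq_zero (h.residual_memLp _ _ _).aemeasurable
      (h.integral_residual _ _ _), h.variance_residual]
    ring
  rw [integral_add (hint1 t) (hint3 t), integral_sub (integrable_const _)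
    ((hε2 t).div_const _), integral_const, integral_div, integral_div, e1, e2,
    div_mul_cancel_right₀ hσ.ne', div_mul_cancel_right₀ hp.ne']
  simp

/-- A bound uniform over designs. It keeps the supremum in `maxInfoGain` finite, so that its
`toReal` is not the default value `0`. -/
theorem infoGain_le (h : IsGPRegression P X k σ f ε) (a : ℕ → X) (T : ℕ) :
    infoGain k σ (fun t => (a t : Pt d)) T ≤ T * (Real.log (1 + (σ ^ 2)⁻¹) / 2) := by
  have hσ := pow_pos h.sigma_pos 2
  calc _ ≤ ∑ _t ∈ Finset.range T, Real.log (1 + (σ ^ 2)⁻¹) / 2 := by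
        refine Finset.sum_le_sum fun t _ => div_le_div_of_nonneg_right
          (Real.log_le_log ?_ ?_) zero_le_two
        · have := div_nonneg (h.postVar_nonneg (fun j : Fin t => a j) (a t)) (sq_nonneg σ)
          linarith
        · rw [inv_eq_one_div]
          gcongr
          exact h.postVar_le_one (fun j : Fin t => a j) (a t)
    _ = _ := by simp

/-- The information gain of every design is at most the maximum information gain. -/
theorem infoGain_le_maxInfoGain (h : IsGPRegression P X k σ f ε) (a : ℕ → X) (T : ℕ) :
    infoGain k σ (fun t => (a t : Pt d)) T ≤ maxInfoGain P X f ε T := by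
  have key : ∀ b : Fin T → X, mutualInfo P (fun ω (i : Fin T) => f (b i) ω + ε i ω)
      (fun ω (i : Fin T) => f (b i) ω)
        ≤ ENNReal.ofReal (T * (Real.log (1 + (σ ^ 2)⁻¹) / 2)) := by
    intro b
    let b' : ℕ → X := fun t => if ht : t < T then b ⟨t, ht⟩ else a 0
    have hb : b = fun i : Fin T => b' i := by ext i; simp [b']
    rw [hb]
    exact (h.mutualInfo_designObs b' T).le.trans (ENNReal.ofReal_le_ofReal (h.infoGain_le b' T))
  rw [maxInfoGain, ← ENNReal.ofReal_le_iff_le_toReal ((iSup_le key).trans_lt ENNReal.ofReal_lt_top).ne,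
    ← h.mutualInfo_designObs a T]
  exact le_iSup (fun b : Fin T → X => mutualInfo P (fun ω (i : Fin T) => f (b i) ω + ε i ω)
      (fun ω (i : Fin T) => f (b i) ω)) fun i => a i

/-- The posterior variances along any sequence of queries are summable in terms of the maximum
information gain. -/
theorem sum_postVar_le (h : IsGPRegression P X k σ f ε) (a : ℕ → X) (T : ℕ) :
    ∑ t ∈ Finset.range T, postVar k σ (fun i : Fin t => (a i : Pt d)) (a t)
      ≤ C₁ σ * maxInfoGain P X f ε T := by
  have hσ := pow_pos h.sigma_pos 2
  have hσi := inv_pos.2 hσ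
  have hlog : 0 < Real.log (1 + (σ ^ 2)⁻¹) := Real.log_pos (by linarith)
  have hC : 0 ≤ C₁ σ := (div_pos two_pos hlog).le
  refine le_trans ?_ (mul_le_mul_of_nonneg_left (h.infoGain_le_maxInfoGain a T) hC)
  rw [infoGain, Finset.mul_sum]
  refine Finset.sum_le_sum fun t _ => ?_
  set v := postVar k σ (fun i : Fin t => (a i : Pt d)) (a t)
  have hv0 : 0 ≤ v := h.postVar_nonneg (fun j : Fin t => a j) (a t)
  have hv1 : v ≤ 1 := h.postVar_le_one (fun j : Fin t => a j) (a t)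
  -- On `[0, 1]` the concave function `v ↦ log (1 + v / σ²)` lies above its chord, which is `v * log
  -- (1 + σ⁻²)`.
  have hconc := strictConcaveOn_log_Ioi.concaveOn.2 (x := 1) (y := 1 + (σ ^ 2)⁻¹) (by simp)
    (by simp only [Set.mem_Ioi]; linarith) (sub_nonneg.2 hv1) hv0 (by ring)
  simp only [smul_eq_mul, Real.log_one, mul_zero, zero_add] at hconc
  have e : (1 - v) * 1 + v * (1 + (σ ^ 2)⁻¹) = 1 + v / σ ^ 2 := by field_simp; ring
  rw [e] at hconc
  rw [C₁, div_mul_div_comm, mul_comm, mul_div_mul_right _ _ two_ne_zero, le_div_iff₀ hlog]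
  exact hconc

/-- The first round alone contributes this amount, since the prior variance is `1`. The lower bound
does not depend on `T` and absorbs bounded regret terms in the rate. -/
theorem log_le_maxInfoGain (h : IsGPRegression P X k σ f ε) (z : X) {T : ℕ} (hT : 0 < T) :
    Real.log (1 + (σ ^ 2)⁻¹) / 2 ≤ maxInfoGain P X f ε T := by
  refine le_trans ?_ (h.infoGain_le_maxInfoGain (fun _ => z) T)
  have h1 := Finset.single_le_sum (f := fun t => Real.log (1 + postVar k σ
    (fun _ : Fin t => (z : Pt d)) z / σ ^ 2) / 2) (s := Finset.range T) (fun t _ => by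
      refine div_nonneg (Real.log_nonneg ?_) zero_le_two
      have := div_nonneg (h.postVar_nonneg (fun _ : Fin t => z) z) (sq_nonneg σ)
      linarith) (Finset.mem_range.2 hT)
  refine le_trans (le_of_eq ?_) h1
  simp [postVar, h.unit z z.2]

end IsGPRegression

/-! ### Measurability of the posterior -/

theorem measurable_matrix_det {B : Type*} [MeasurableSpace B] {n : ℕ}
    {A : B → Matrix (Fin n) (Fin n) ℝ} (hA : ∀ i j, Measurable fun b => A b i j) :
    Measurable fun b => (A b).det := by
  simp only [Matrix.det_apply]
  refine Finset.measurable_sum _ fun p _ => Measurable.const_smul ?_ _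
  exact Finset.measurable_prod _ fun i _ => hA _ _

/-- Cramer's rule: the entries are determinants divided by the determinant. At singular matrices
both the matrix inverse and the scalar one are `0`, so no case is excluded. -/
theorem measurable_matrix_inv {B : Type*} [MeasurableSpace B] {n : ℕ}
    {A : B → Matrix (Fin n) (Fin n) ℝ} (hA : ∀ i j, Measurable fun b => A b i j) (i j : Fin n) :
    Measurable fun b => (A b)⁻¹ i j := by
  simp only [Matrix.inv_def, Ring.inverse_eq_inv', Matrix.smul_apply, smul_eq_mul,
    Matrix.adjugate_apply]
  refine (measurable_matrix_det hA).inv.mul (measurable_matrix_det fun p q => ?_)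
  simp only [Matrix.updateRow_apply]
  split_ifs
  · exact measurable_const
  · exact hA p q

section Posterior

variable {B : Type*} [MeasurableSpace B] {d : ℕ} {X : Set (Pt d)} {k : Pt d → Pt d → ℝ} {σ : ℝ}
  {n : ℕ} {a : B → Fin n → X} {y : B → Fin n → ℝ} {z : B → X}

theorem measurable_regGram_inv (hk : Measurable fun p : X × X => k p.1 p.2) (ha : Measurable a)
    (i j : Fin n) : Measurable fun b => (regGram k σ fun i => (a b i : Pt d))⁻¹ i j := by
  refine measurable_matrix_inv (fun p q => ?_) i j
  simp only [regGram, Matrix.add_apply, Matrix.of_apply]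
  refine Measurable.add_const ?_ _
  exact hk.comp ((measurable_pi_iff.1 ha p).prodMk (measurable_pi_iff.1 ha q))

theorem measurable_kernel_vec (hk : Measurable fun p : X × X => k p.1 p.2) (ha : Measurable a)
    (hz : Measurable z) (i : Fin n) : Measurable fun b => k (z b) (a b i) :=
  hk.comp (hz.prodMk (measurable_pi_iff.1 ha i))

theorem measurable_postMean (hk : Measurable fun p : X × X => k p.1 p.2) (ha : Measurable a)
    (hy : Measurable y) (hz : Measurable z) :
    Measurable fun b => postMean k σ (fun i => (a b i : Pt d)) (y b) (z b) := by
  simp only [postMean, dotProduct, Matrix.mulVec]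
  refine Finset.measurable_sum _ fun i _ => (measurable_kernel_vec hk ha hz i).mul
    (Finset.measurable_sum _ fun j _ => (measurable_regGram_inv hk ha i j).mul
      (measurable_pi_iff.1 hy j))

theorem measurable_postVar (hk : Measurable fun p : X × X => k p.1 p.2) (ha : Measurable a)
    (hz : Measurable z) :
    Measurable fun b => postVar k σ (fun i => (a b i : Pt d)) (z b) := by
  simp only [postVar, dotProduct, Matrix.mulVec]
  refine Measurable.sub (hk.comp (hz.prodMk hz)) (Finset.measurable_sum _ fun i _ =>
    (measurable_kernel_vec hk ha hz i).mul (Finset.measurable_sum _ fun j _ =>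
      (measurable_regGram_inv hk ha i j).mul (measurable_kernel_vec hk ha hz j)))

end Posterior

/-! ### Continuous sample paths -/

/-- The space of continuous functions on `X` with the σ-algebra of pointwise evaluation. -/
abbrev PathSpace {d : ℕ} (X : Set (Pt d)) : Type := {v : X → ℝ // Continuous v}

/-- A function that is measurable in the path and continuous in the point is jointly measurable.
This is what makes the value of the process at a random query measurable. -/
theorem measurable_eval_path {d : ℕ} {X : Set (Pt d)} :
    Measurable fun p : PathSpace X × X => p.1.1 p.2 := by
  have := measurable_uncurry_of_continuous_of_measurable (u := fun (z : X) (v : PathSpace X) => v.1 z)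
    (fun v => v.2) (fun z => (measurable_pi_apply z).comp measurable_subtype_coe)
  exact this.comp measurable_swap

/-- Continuity holds only almost surely, possibly on a non-measurable set, so the paths are set to
`0` on a measurable null set containing the exceptional one. -/
theorem exists_path {Ω : Type*} [MeasurableSpace Ω] {P : Measure Ω} {d : ℕ} {X : Set (Pt d)}
    {f : Pt d → Ω → ℝ} (hf : ∀ z ∈ X, Measurable (f z))
    (hc : ∀ᵐ ω ∂P, Continuous fun z : X => f z ω) :
    ∃ F : Ω → PathSpace X, Measurable F ∧ ∀ᵐ ω ∂P, ∀ z : X, f z ω = (F ω).1 z := by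
  classical
  obtain ⟨G, hGsub, hG, hP⟩ := exists_measurable_superset_of_null hc
  have hGc : ∀ ω, ω ∉ G → Continuous fun z : X => f z ω := fun ω hω => by
    by_contra h
    exact hω (hGsub h)
  have hcont : ∀ ω, Continuous fun z : X => if ω ∈ G then 0 else f z ω := fun ω => by
    by_cases h : ω ∈ G
    · simpa [h] using continuous_const
    · simpa [h] using hGc ω h
  refine ⟨fun ω => ⟨_, hcont ω⟩, Measurable.subtype_mk (measurable_pi_iff.2 fun z : X =>
    Measurable.ite hG measurable_const (hf z z.2)), ?_⟩
  filter_upwards [measure_eq_zero_iff_ae_notMem.1 hP] with ω hω z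
  simp [hω]

/-- The σ-algebra of a subtype is pulled back along the coercion, so `F` and its coercion generate
the same σ-algebra on `Ω`. -/
theorem indepFun_prodMk_of_val {Ω C D E : Type*} [MeasurableSpace Ω] [MeasurableSpace C]
    [MeasurableSpace D] [MeasurableSpace E] {P : Measure Ω} {p : C → Prop} {F : Ω → Subtype p}
    {e : Ω → D} {G : Ω → E} (h : IndepFun (fun ω => ((F ω : C), e ω)) G P) :
    IndepFun (fun ω => (F ω, e ω)) G P := by
  rw [IndepFun_iff_Indep] at h ⊢
  have hc (u : Ω → C) : MeasurableSpace.comap (fun ω => (u ω, e ω)) inferInstance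
      = MeasurableSpace.comap u inferInstance ⊔ MeasurableSpace.comap e inferInstance :=
    MeasurableSpace.comap_prodMk _ _
  have hc' : MeasurableSpace.comap (fun ω => (F ω, e ω)) inferInstance
      = MeasurableSpace.comap F inferInstance ⊔ MeasurableSpace.comap e inferInstance :=
    MeasurableSpace.comap_prodMk _ _
  rw [hc] at h
  rw [hc']
  have : MeasurableSpace.comap F Subtype.instMeasurableSpace
      = MeasurableSpace.comap (fun ω => (F ω : C)) inferInstance := MeasurableSpace.comap_comp
  rw [this]
  exact h

/-! ### Adaptive designs and the posterior given adaptively collected data. -/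

/-- Points queried by the policy `φ` as functions of the observations. -/
def queryPt {𝒳 𝒲 : Type*} (φ : ∀ t : ℕ, (Fin t → 𝒳 × ℝ) × 𝒲 → 𝒳) :
    ∀ t : ℕ, (Fin t → ℝ) × 𝒲 → 𝒳
  | t, q => φ t (fun i => (queryPt φ i (prefixFin q.1 i, q.2), q.1 i), q.2)
termination_by t => t
decreasing_by exact i.2

theorem measurable_prefixFin {n : ℕ} (i : Fin n) : Measurable fun y : Fin n → ℝ => prefixFin y i :=
  measurable_pi_iff.2 fun _ => measurable_pi_apply _

theorem measurable_queryPt {𝒳 𝒲 : Type*} [MeasurableSpace 𝒳] [MeasurableSpace 𝒲]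
    {φ : ∀ t : ℕ, (Fin t → 𝒳 × ℝ) × 𝒲 → 𝒳} (hφ : ∀ t, Measurable (φ t)) (t : ℕ) :
    Measurable (queryPt φ t) := by
  induction t using Nat.strong_induction_on with
  | _ t ih =>
    have : queryPt φ t = fun q => φ t (fun i => (queryPt φ i (prefixFin q.1 i, q.2), q.1 i), q.2) := by
      ext q; rw [queryPt]
    rw [this]
    refine (hφ t).comp (Measurable.prodMk (measurable_pi_iff.2 fun i => ?_) measurable_snd)
    exact ((ih i i.2).comp (((measurable_prefixFin i).comp measurable_fst).prodMk
      measurable_snd)).prodMk ((measurable_pi_apply i).comp measurable_fst)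

/-- All points queried before round `n`. -/
def queryPts {𝒳 𝒲 : Type*} (φ : ∀ t : ℕ, (Fin t → 𝒳 × ℝ) × 𝒲 → 𝒳) (n : ℕ)
    (q : (Fin n → ℝ) × 𝒲) (i : Fin n) : 𝒳 :=
  queryPt φ i (prefixFin q.1 i, q.2)

theorem measurable_queryPts {𝒳 𝒲 : Type*} [MeasurableSpace 𝒳] [MeasurableSpace 𝒲]
    {φ : ∀ t : ℕ, (Fin t → 𝒳 × ℝ) × 𝒲 → 𝒳} (hφ : ∀ t, Measurable (φ t)) (n : ℕ) :
    Measurable (queryPts φ n) :=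
  measurable_pi_iff.2 fun i => (measurable_queryPt hφ i).comp
    (((measurable_prefixFin i).comp measurable_fst).prodMk measurable_snd)

/-- The queries `x` are chosen by the policy `φ` from past data and from the randomness `W`, which
is independent of the path and of the noise. -/
structure IsAdaptiveDesign {Ω 𝒲 : Type*} [MeasurableSpace Ω] [MeasurableSpace 𝒲] (P : Measure Ω)
    {d : ℕ} (X : Set (Pt d)) (f : Pt d → Ω → ℝ) (ε : ℕ → Ω → ℝ) (W : Ω → 𝒲)
    (φ : ∀ t : ℕ, (Fin t → X × ℝ) × 𝒲 → X) (x : ℕ → Ω → X) : Prop where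
  cont : ∀ᵐ ω ∂P, Continuous fun z : X => f z ω
  meas_W : Measurable W
  meas_policy : ∀ t, Measurable (φ t)
  indep : IndepFun (fun ω => ((fun z : X => f z ω), (fun t : ℕ => ε t ω))) W P
  query : ∀ t ω, x t ω = φ t (fun i : Fin t => (x i ω, f (x i ω) ω + ε i ω), W ω)

namespace IsAdaptiveDesign

variable {Ω 𝒲 : Type*} [MeasurableSpace Ω] [MeasurableSpace 𝒲] {P : Measure Ω}
  [IsProbabilityMeasure P] {d : ℕ} {X : Set (Pt d)} {f : Pt d → Ω → ℝ} {ε : ℕ → Ω → ℝ} {W : Ω → 𝒲}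
  {φ : ∀ t : ℕ, (Fin t → X × ℝ) × 𝒲 → X} {x : ℕ → Ω → X} {k : Pt d → Pt d → ℝ} {σ : ℝ}

/-- The observations before round `n`, together with the randomness of the algorithm. -/
def data (f : Pt d → Ω → ℝ) (ε : ℕ → Ω → ℝ) (W : Ω → 𝒲) (x : ℕ → Ω → X) (n : ℕ) (ω : Ω) :
    (Fin n → ℝ) × 𝒲 :=
  (fun i => f (x i ω) ω + ε i ω, W ω)

theorem query_eq (hx : IsAdaptiveDesign P X f ε W φ x) (t : ℕ) (ω : Ω) :
    x t ω = queryPt φ t (data f ε W x t ω) := by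
  induction t using Nat.strong_induction_on with
  | _ t ih =>
    rw [queryPt, hx.query t ω]
    congr 2
    ext i : 1
    exact Prod.ext (ih i i.2) rfl

theorem queryPts_eq (hx : IsAdaptiveDesign P X f ε W φ x) (n : ℕ) (ω : Ω) (i : Fin n) :
    queryPts φ n (data f ε W x n ω) i = x i ω :=
  (hx.query_eq i ω).symm

/-- With path and algorithmic randomness joined in one variable, the mean of an observation is the
path evaluated at a point computed from `W` and the earlier observations. The pair `(F, W)` is
independent of the noise because `W` is independent of `(F, ε)` and `F` of `ε`. -/
theorem isNoiseModel (hx : IsAdaptiveDesign P X f ε W φ x) (h : IsGPRegression P X k σ f ε)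
    {F : Ω → PathSpace X} (hF : Measurable F) (hfF : ∀ᵐ ω ∂P, ∀ z : X, f z ω = (F ω).1 z) :
    IndepFun F W P ∧
    IsNoiseModel P (fun ω => (F ω, W ω)) ε (fun t ω => f (x t ω) ω + ε t ω) (σ ^ 2).toNNReal
      (fun t q => q.1.1.1 (queryPt φ t (q.2, q.1.2))) := by
  have hFf : (fun ω (z : X) => f z ω) =ᵐ[P] fun ω => (F ω).1 := by
    filter_upwards [hfF] with ω hω
    ext z; exact hω z
  have hε : Measurable fun ω t => ε t ω := measurable_pi_iff.2 h.noise.measurable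
  have h1 : IndepFun F (fun ω t => ε t ω) P := by
    have h0 : IndepFun (fun ω => ((F ω).1, ())) (fun ω t => ε t ω) P :=
      (h.indep.congr hFf ae_eq_rfl).comp (φ := fun v => (v, ())) (ψ := id)
        (measurable_id.prodMk measurable_const) measurable_id
    exact (indepFun_prodMk_of_val h0).comp measurable_fst measurable_id
  have h2 : IndepFun W (fun ω => (F ω, fun t => ε t ω)) P := by
    refine IndepFun.symm ?_
    have h3 : IndepFun (fun ω => ((F ω).1, fun t => ε t ω)) W P := by
      refine hx.indep.congr ?_ ae_eq_rfl
      filter_upwards [hFf] with ω hω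
      rw [← hω]
    exact indepFun_prodMk_of_val h3
  have h4 := indepFun_prodMk_assoc hx.meas_W.aemeasurable hF.aemeasurable hε.aemeasurable h2 h1
  refine ⟨(h2.comp measurable_id measurable_fst).symm, ?_⟩
  exact
    { meas_Z := hF.prodMk hx.meas_W
      meas_ε := h.noise.measurable
      meas_m := fun t => by
        have := measurable_queryPt hx.meas_policy t
        exact measurable_eval_path.comp ((measurable_fst.comp measurable_fst).prodMk
          (this.comp (measurable_snd.prodMk (measurable_snd.comp measurable_fst))))
      law := h.noise.law
      iIndep := h.noise.indep
      indep := h4.comp (φ := Prod.swap) (ψ := id) measurable_swap measurable_id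
      eq := fun t => by
        filter_upwards [hfF] with ω hω
        have := hx.query_eq t ω
        simp only [data] at this
        rw [← this, hω] }


/-- Law of the sample path and of the data. -/
theorem lintegral_data (hx : IsAdaptiveDesign P X f ε W φ x) (h : IsGPRegression P X k σ f ε)
    {F : Ω → PathSpace X} (hF : Measurable F) (hfF : ∀ᵐ ω ∂P, ∀ z : X, f z ω = (F ω).1 z) (n : ℕ)
    {K : PathSpace X × ((Fin n → ℝ) × 𝒲) → ℝ≥0∞} (hK : Measurable K) :
    ∫⁻ ω, K (F ω, data f ε W x n ω) ∂P
      = ∫⁻ w, (∫⁻ y : Fin n → ℝ, (∫⁻ ω, K (F ω, (y, w)) *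
          ENNReal.ofReal (IsGPRegression.likelihood σ f (queryPts φ n (y, w)) y ω) ∂P)) ∂(P.map W) := by
  obtain ⟨hFW, hN⟩ := hx.isNoiseModel h hF hfF
  let H : (PathSpace X × 𝒲) × (Fin n → ℝ) → ℝ≥0∞ := fun q => K (q.1.1, (q.2, q.1.2))
  have hH : Measurable H := hK.comp ((measurable_fst.comp measurable_fst).prodMk
    (measurable_snd.prodMk (measurable_snd.comp measurable_fst)))
  have h1 := hN.lintegral_eq h.toNNReal_ne_zero n hH
  have hprod : P.map (fun ω => (F ω, W ω)) = (P.map F).prod (P.map W) :=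
    (indepFun_iff_map_prod_eq_prod_map_map hF.aemeasurable hx.meas_W.aemeasurable).1 hFW
  have : IsProbabilityMeasure (P.map F) := Measure.isProbabilityMeasure_map hF.aemeasurable
  have : IsProbabilityMeasure (P.map W) := Measure.isProbabilityMeasure_map hx.meas_W.aemeasurable
  have hm : Measurable fun q : (PathSpace X × 𝒲) × (Fin n → ℝ) => H q *
      ∏ i : Fin n, gaussianPDF (q.1.1.1 (queryPts φ n (q.2, q.1.2) i)) (σ ^ 2).toNNReal (q.2 i) := by
    refine hH.mul (Finset.measurable_prod _ fun i _ => ?_)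
    refine (measurable_uncurry_gaussianPDFReal.comp (Measurable.prodMk ?_
      (measurable_const.prodMk ((measurable_pi_apply i).comp measurable_snd)))).ennreal_ofReal
    exact measurable_eval_path.comp ((measurable_fst.comp measurable_fst).prodMk
      ((measurable_pi_iff.1 (measurable_queryPts hx.meas_policy n) i).comp
        (measurable_snd.prodMk (measurable_snd.comp measurable_fst))))
  calc ∫⁻ ω, K (F ω, data f ε W x n ω) ∂P
      = ∫⁻ b, (∫⁻ y : Fin n → ℝ, H (b, y) *
          ∏ i : Fin n, gaussianPDF (b.1.1 (queryPts φ n (y, b.2) i)) (σ ^ 2).toNNReal (y i))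
          ∂(P.map (fun ω => (F ω, W ω))) := h1
    -- Independence of `F` and `W` allows `w` and `y` to be frozen before the path is integrated.
    -- For frozen `w` and `y` the design is deterministic.
    _ = ∫⁻ w, (∫⁻ v, (∫⁻ y : Fin n → ℝ, H ((v, w), y) *
          ∏ i : Fin n, gaussianPDF (v.1 (queryPts φ n (y, w) i)) (σ ^ 2).toNNReal (y i))
          ∂(P.map F)) ∂(P.map W) := by
        rw [hprod, lintegral_prod_symm']
        exact hm.lintegral_prod_right'
    _ = ∫⁻ w, (∫⁻ y : Fin n → ℝ, (∫⁻ v, H ((v, w), y) *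
          ∏ i : Fin n, gaussianPDF (v.1 (queryPts φ n (y, w) i)) (σ ^ 2).toNNReal (y i)
          ∂(P.map F))) ∂(P.map W) := by
        refine lintegral_congr fun w => ?_
        rw [lintegral_lintegral_swap]
        exact (hm.comp ((measurable_fst.prodMk measurable_const).prodMk
          measurable_snd)).aemeasurable
    _ = _ := by
        refine lintegral_congr fun w => lintegral_congr fun y => ?_
        have hm' : Measurable fun v : PathSpace X => H ((v, w), y) *
            ∏ i : Fin n, gaussianPDF (v.1 (queryPts φ n (y, w) i)) (σ ^ 2).toNNReal (y i) :=
          hm.comp ((measurable_id.prodMk measurable_const).prodMk measurable_const)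
        rw [lintegral_map hm' hF]
        refine lintegral_congr_ae ?_
        filter_upwards [hfF] with ω hω
        rw [IsGPRegression.ofReal_likelihood]
        simp only [hω]
        rfl

/-- The kernel of a process with continuous paths is measurable. -/
theorem measurable_kernel (h : IsGPRegression P X k σ f ε)
    {F : Ω → PathSpace X} (hF : Measurable F) (hfF : ∀ᵐ ω ∂P, ∀ z : X, f z ω = (F ω).1 z) :
    Measurable fun p : X × X => k p.1 p.2 := by
  -- Joint measurability of `k` is read off from its representation as the mean of a product of path
  -- values.
  have hk : (fun p : X × X => k p.1 p.2) = fun p => ∫ ω, (F ω).1 p.1 * (F ω).1 p.2 ∂P := by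
    ext p
    rw [← h.gp.covariance _ p.1.2 _ p.2.2, covariance, h.gp.mean_zero _ p.1.2,
      h.gp.mean_zero _ p.2.2]
    refine integral_congr_ae ?_
    filter_upwards [hfF] with ω hω
    simp [hω]
  rw [hk]
  refine StronglyMeasurable.measurable (StronglyMeasurable.integral_prod_right'
    (f := fun q : (X × X) × Ω => (F q.2).1 q.1.1 * (F q.2).1 q.1.2) ?_)
  refine Measurable.stronglyMeasurable ?_
  exact (measurable_eval_path.comp ((hF.comp measurable_snd).prodMk
      (measurable_fst.comp measurable_fst))).mul (measurable_eval_path.comp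
      ((hF.comp measurable_snd).prodMk (measurable_snd.comp measurable_fst)))

/-- Given the data of an adaptive design, the value of the process at a point computed from the
data is normal with the posterior mean and the posterior variance. -/
theorem lintegral_posterior (hx : IsAdaptiveDesign P X f ε W φ x)
    (h : IsGPRegression P X k σ f ε) (n : ℕ) {z : (Fin n → ℝ) × 𝒲 → X} (hz : Measurable z)
    {H : ℝ × ((Fin n → ℝ) × 𝒲) → ℝ≥0∞} (hH : Measurable H) :
    ∫⁻ ω, H (f (z (data f ε W x n ω)) ω, data f ε W x n ω) ∂P
      = ∫⁻ ω, (∫⁻ r, H (postMean k σ (fun i : Fin n => (x i ω : Pt d))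
            (data f ε W x n ω).1 (z (data f ε W x n ω))
          + √(postVar k σ (fun i : Fin n => (x i ω : Pt d)) (z (data f ε W x n ω))) * r,
          data f ε W x n ω) ∂(gaussianReal 0 1)) ∂P := by
  obtain ⟨F, hF, hfF⟩ := exists_path h.gp.measurable hx.cont
  have hk := measurable_kernel h hF hfF
  have hqp := measurable_queryPts hx.meas_policy n
  let μ : (Fin n → ℝ) × 𝒲 → ℝ := fun q =>
    postMean k σ (fun i => ((queryPts φ n q i : X) : Pt d)) q.1 (z q)
  let s : (Fin n → ℝ) × 𝒲 → ℝ := fun q =>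
    √(postVar k σ (fun i => ((queryPts φ n q i : X) : Pt d)) (z q))
  have hμ : Measurable μ := measurable_postMean hk hqp measurable_fst hz
  have hs : Measurable s := (measurable_postVar hk hqp hz).sqrt
  have hR : Measurable fun q => ∫⁻ r, H (μ q + s q * r, q) ∂(gaussianReal 0 1) :=
    Measurable.lintegral_prod_right' (f := fun p : ((Fin n → ℝ) × 𝒲) × ℝ =>
      H (μ p.1 + s p.1 * p.2, p.1)) (hH.comp (((hμ.comp measurable_fst).add
        ((hs.comp measurable_fst).mul measurable_snd)).prodMk measurable_fst))
  have h1 := hx.lintegral_data h hF hfF n (K := fun p => H (p.1.1 (z p.2), p.2))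
    (hH.comp ((measurable_eval_path.comp (measurable_fst.prodMk (hz.comp measurable_snd))).prodMk
      measurable_snd))
  have h2 := hx.lintegral_data h hF hfF n
    (K := fun p => ∫⁻ r, H (μ p.2 + s p.2 * r, p.2) ∂(gaussianReal 0 1)) (hR.comp measurable_snd)
  calc _ = ∫⁻ ω, H ((F ω).1 (z (data f ε W x n ω)), data f ε W x n ω) ∂P := by
        refine lintegral_congr_ae ?_
        filter_upwards [hfF] with ω hω
        rw [hω]
    _ = ∫⁻ ω, ∫⁻ r, H (μ (data f ε W x n ω) + s (data f ε W x n ω) * r, data f ε W x n ω)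
          ∂(gaussianReal 0 1) ∂P := by
        rw [h1, h2]
        refine lintegral_congr fun w => lintegral_congr fun y => ?_
        simp only
        -- For frozen `(y, w)` both the design and the point are fixed, and Bayes' formula applies
        -- to this very `y`, although the design was computed from it.
        rw [lintegral_const_mul _ (h.measurable_likelihood_left _ _).ennreal_ofReal]
        have := h.lintegral_mul_likelihood (queryPts φ n (y, w)) (z (y, w)) y
          (H := fun r => H (r, (y, w))) (hH.comp (measurable_id.prodMk measurable_const))
        rw [← this]
        refine lintegral_congr_ae ?_
        filter_upwards [hfF] with ω hω
        rw [hω]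
    _ = _ := by
        simp only [μ, s, hx.queryPts_eq]

end IsAdaptiveDesign

/-! ### Auxiliary estimates: normal tails, square roots, suprema of paths. -/

/-- For `r > c ≥ 0` one has `r - c ≤ r`, and `r` times the normal density has minus that density as
antiderivative. With `c = √ζ` this is the source of the terms `M_t(-1/2) / √(2π)`. -/
theorem lintegral_gaussian_sub_le {c : ℝ} (hc : 0 ≤ c) :
    ∫⁻ r, ENNReal.ofReal (r - c) ∂(gaussianReal 0 1)
      ≤ ENNReal.ofReal (Real.exp (-c ^ 2 / 2) / √(2 * Real.pi)) := by
  have hd : ∀ r : ℝ, HasDerivAt (fun r => -(Real.exp (-r ^ 2 / 2) / √(2 * Real.pi)))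
      (r * (Real.exp (-r ^ 2 / 2) / √(2 * Real.pi))) r := fun r => by
    have h1 : HasDerivAt (fun r : ℝ => -r ^ 2 / 2) (-r) r :=
      (((hasDerivAt_pow 2 r).fun_neg).div_const 2).congr_deriv (by simp; ring)
    exact (((h1.exp).div_const √(2 * Real.pi)).fun_neg).congr_deriv (by ring)
  have hlim : Tendsto (fun r : ℝ => -(Real.exp (-r ^ 2 / 2) / √(2 * Real.pi))) atTop (nhds 0) := by
    have h1 : Tendsto (fun r : ℝ => r ^ 2 / 2) atTop atTop :=
      (tendsto_pow_atTop two_ne_zero).atTop_div_const two_pos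
    have h2 := (Real.tendsto_exp_neg_atTop_nhds_zero.comp h1).div_const √(2 * Real.pi)
    simpa [neg_div, Function.comp_def] using h2.neg
  have hnn : ∀ r ∈ Set.Ioi c, 0 ≤ r * (Real.exp (-r ^ 2 / 2) / √(2 * Real.pi)) := fun r hr =>
    mul_nonneg (hc.trans (le_of_lt hr)) (by positivity)
  have hI := integral_Ioi_of_hasDerivAt_of_nonneg' (fun r _ => hd r) hnn hlim
  have hi := integrableOn_Ioi_deriv_of_nonneg' (fun r _ => hd r) hnn hlim
  rw [gaussianReal_of_var_ne_zero _ one_ne_zero,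
    lintegral_withDensity_eq_lintegral_mul _ (measurable_gaussianPDF _ _) (by fun_prop)]
  calc _ ≤ ∫⁻ r, (Set.Ioi c).indicator
        (fun r => ENNReal.ofReal (r * (Real.exp (-r ^ 2 / 2) / √(2 * Real.pi)))) r := by
        refine lintegral_mono fun r => ?_
        by_cases hr : r ∈ Set.Ioi c
        · rw [Set.indicator_of_mem hr, Pi.mul_apply, gaussianPDF,
            ← ENNReal.ofReal_mul (gaussianPDFReal_nonneg _ _ _)]
          refine ENNReal.ofReal_le_ofReal ?_
          rw [mul_comm, gaussianPDFReal]
          have : (√(2 * Real.pi * (1 : NNReal)))⁻¹ * Real.exp (-(r - 0) ^ 2 / (2 * (1 : NNReal)))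
              = Real.exp (-r ^ 2 / 2) / √(2 * Real.pi) := by
            simp [div_eq_inv_mul]
          rw [this]
          gcongr
          linarith
        · simp only [Set.mem_Ioi, not_lt] at hr
          simp [ENNReal.ofReal_of_nonpos (sub_nonpos.2 hr)]
    _ = ENNReal.ofReal (∫ r in Set.Ioi c, r * (Real.exp (-r ^ 2 / 2) / √(2 * Real.pi))) := by
        rw [lintegral_indicator measurableSet_Ioi, ofReal_integral_eq_lintegral_ofReal hi]
        exact (ae_restrict_iff' measurableSet_Ioi).2 (ae_of_all _ hnn)
    _ = _ := by rw [hI]; simp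

theorem lintegral_gaussian_neg (H : ℝ → ℝ≥0∞) :
    ∫⁻ r, H (-r) ∂(gaussianReal 0 1) = ∫⁻ r, H r ∂(gaussianReal 0 1) := by
  have : (gaussianReal 0 1).map (fun r => -r) = gaussianReal 0 1 := by
    simpa using gaussianReal_map_neg (μ := 0) (v := 1)
  conv_rhs => rw [← this]
  exact (lintegral_map_equiv H (MeasurableEquiv.neg ℝ)).symm

/-- Jensen's inequality for the square root, in the form that the variance of `√Z` is nonnegative.
-/
theorem integral_sqrt_le {Ω : Type*} [MeasurableSpace Ω] {P : Measure Ω} [IsProbabilityMeasure P]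
    {Z : Ω → ℝ} (hZ : Integrable Z P) (h0 : ∀ᵐ ω ∂P, 0 ≤ Z ω) :
    Integrable (fun ω => √(Z ω)) P ∧ ∫ ω, √(Z ω) ∂P ≤ √(∫ ω, Z ω ∂P) := by
  have hm : AEStronglyMeasurable (fun ω => √(Z ω)) P :=
    Real.continuous_sqrt.comp_aestronglyMeasurable hZ.1
  have hsq : (fun ω => √(Z ω) ^ 2) =ᵐ[P] Z := by
    filter_upwards [h0] with ω hω using Real.sq_sqrt hω
  have h2 : MemLp (fun ω => √(Z ω)) 2 P :=
    (memLp_two_iff_integrable_sq hm).2 (hZ.congr hsq.symm)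
  refine ⟨h2.integrable one_le_two, Real.le_sqrt_of_sq_le ?_⟩
  have := variance_nonneg (fun ω => √(Z ω)) P
  rw [variance_eq_sub h2] at this
  have h3 : ∫ ω, ((fun ω => √(Z ω)) ^ 2) ω ∂P = ∫ ω, Z ω ∂P := integral_congr_ae hsq
  linarith

theorem bddAbove_range_path {d : ℕ} {X : Set (Pt d)} (hX : IsCompact X) (v : PathSpace X) :
    BddAbove (Set.range v.1) := by
  have := isCompact_iff_compactSpace.1 hX
  exact (isCompact_range v.2).bddAbove

/-- By continuity the supremum may be taken over a countable dense set. -/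
theorem measurable_iSup_path {d : ℕ} {X : Set (Pt d)} (hX : IsCompact X) :
    Measurable fun v : PathSpace X => ⨆ z, v.1 z := by
  obtain ⟨D, hDc, hD⟩ := TopologicalSpace.exists_countable_dense X
  have := hDc.to_subtype
  have h : (fun v : PathSpace X => ⨆ z, v.1 z) = fun v => ⨆ z : D, v.1 z := by
    ext v
    exact (hD.ciSup v.2 (bddAbove_range_path hX v)).symm
  rw [h]
  exact Measurable.iSup fun z => (measurable_pi_apply _).comp measurable_subtype_coe

/-! ### Failure of the confidence bound and unbiasedness of the posterior mean. -/

namespace IsAdaptiveDesign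

variable {Ω 𝒲 : Type*} [MeasurableSpace Ω] [MeasurableSpace 𝒲] {P : Measure Ω}
  [IsProbabilityMeasure P] {d : ℕ} {X : Set (Pt d)} {f : Pt d → Ω → ℝ} {ε : ℕ → Ω → ℝ} {W : Ω → 𝒲}
  {φ : ∀ t : ℕ, (Fin t → X × ℝ) × 𝒲 → X} {x : ℕ → Ω → X} {k : Pt d → Pt d → ℝ} {σ : ℝ}
  {g : 𝒲 → ℝ}

theorem aemeasurable_data (hx : IsAdaptiveDesign P X f ε W φ x) (h : IsGPRegression P X k σ f ε)
    (n : ℕ) : AEMeasurable (data f ε W x n) P := by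
  obtain ⟨F, hF, hfF⟩ := exists_path h.gp.measurable hx.cont
  obtain ⟨_, hN⟩ := hx.isNoiseModel h hF hfF
  have h1 : AEMeasurable (fun ω (i : Fin n) => f (x i ω) ω + ε i ω) P :=
    aemeasurable_pi_iff.2 fun i => hN.aemeasurable_obs i
  exact h1.prodMk hx.meas_W.aemeasurable

theorem aemeasurable_query (hx : IsAdaptiveDesign P X f ε W φ x) (h : IsGPRegression P X k σ f ε)
    (n : ℕ) : AEMeasurable (x n) P := by
  rw [show x n = fun ω => queryPt φ n (data f ε W x n ω) from funext (hx.query_eq n)]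
  exact (measurable_queryPt hx.meas_policy n).comp_aemeasurable (hx.aemeasurable_data h n)

theorem aemeasurable_eval (hx : IsAdaptiveDesign P X f ε W φ x) (h : IsGPRegression P X k σ f ε)
    {z : Ω → X} (hz : AEMeasurable z P) : AEMeasurable (fun ω => f (z ω) ω) P := by
  obtain ⟨F, hF, hfF⟩ := exists_path h.gp.measurable hx.cont
  refine (measurable_eval_path.comp_aemeasurable (hF.aemeasurable.prodMk hz)).congr ?_
  filter_upwards [hfF] with ω hω
  exact (hω _).symm

theorem aemeasurable_iSup (hx : IsAdaptiveDesign P X f ε W φ x) (h : IsGPRegression P X k σ f ε)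
    (hX : IsCompact X) : AEMeasurable (fun ω => ⨆ z : X, f z ω) P := by
  obtain ⟨F, hF, hfF⟩ := exists_path h.gp.measurable hx.cont
  refine ((measurable_iSup_path hX).comp_aemeasurable hF.aemeasurable).congr ?_
  filter_upwards [hfF] with ω hω
  simp [hω]

theorem le_iSup (hx : IsAdaptiveDesign P X f ε W φ x) (hX : IsCompact X) :
    ∀ᵐ ω ∂P, ∀ z : X, f z ω ≤ ⨆ z : X, f z ω := by
  filter_upwards [hx.cont] with ω hω z
  exact le_ciSup (bddAbove_range_path hX ⟨_, hω⟩) z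

/-- The upper confidence bound at a fixed point fails by a small amount on average. -/
theorem lintegral_sub_ucb_le (hx : IsAdaptiveDesign P X f ε W φ x)
    (h : IsGPRegression P X k σ f ε) (n : ℕ) (z : X) (hg : Measurable g)
    (hg0 : ∀ᵐ ω ∂P, 0 ≤ g (W ω)) :
    ∫⁻ ω, ENNReal.ofReal (f z ω - ucb k σ (fun i : Fin n => (x i ω : Pt d))
        (fun i : Fin n => f (x i ω) ω + ε i ω) (g (W ω)) z) ∂P
      ≤ ∫⁻ ω, ENNReal.ofReal (Real.exp (-g (W ω) / 2) / √(2 * Real.pi)) ∂P := by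
  obtain ⟨F, hF, hfF⟩ := exists_path h.gp.measurable hx.cont
  have hk := measurable_kernel h hF hfF
  have hqp := measurable_queryPts hx.meas_policy n
  have hz : Measurable fun _ : (Fin n → ℝ) × 𝒲 => z := measurable_const
  have hH : Measurable fun p : ℝ × ((Fin n → ℝ) × 𝒲) => ENNReal.ofReal (p.1 -
      (postMean k σ (fun i => ((queryPts φ n p.2 i : X) : Pt d)) p.2.1 z + √(g p.2.2) *
        √(postVar k σ (fun i => ((queryPts φ n p.2 i : X) : Pt d)) z))) := by
    have hs : Measurable fun p : ℝ × ((Fin n → ℝ) × 𝒲) => p.2 := measurable_snd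
    have h1 := (measurable_postMean (σ := σ) hk hqp measurable_fst hz).comp hs
    have h2 := (measurable_postVar (σ := σ) hk hqp hz).sqrt.comp hs
    have h3 := (hg.comp measurable_snd).sqrt.comp hs
    exact (measurable_fst.sub (h1.add (h3.mul h2))).ennreal_ofReal
  have key := hx.lintegral_posterior h n hz hH
  simp only [hx.queryPts_eq] at key
  refine key.trans_le (lintegral_mono_ae ?_)
  filter_upwards [hg0] with ω hω
  have h0 := Real.sqrt_nonneg (postVar k σ (fun i : Fin n => (x i ω : Pt d)) z)
  have h1 := Real.sqrt_le_one.2 (h.postVar_le_one (fun i : Fin n => x i ω) z)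
  have h2 := lintegral_gaussian_sub_le (Real.sqrt_nonneg (g (W ω)))
  rw [Real.sq_sqrt hω] at h2
  refine (lintegral_mono fun r => ?_).trans h2
  -- The posterior mean cancels and `s * r - √ζ * s` remains, with `0 ≤ s ≤ 1`; its positive part is
  -- at most that of `r - √ζ`.
  simp only [add_sub_add_left_eq_sub]
  change ENNReal.ofReal (_ - √(g (W ω)) * _) ≤ _
  rcases le_total r √(g (W ω)) with hr | hr
  · rw [ENNReal.ofReal_of_nonpos]
    · exact zero_le
    · nlinarith
  · refine ENNReal.ofReal_le_ofReal ?_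
    nlinarith

theorem integrable_sub_ucb (hx : IsAdaptiveDesign P X f ε W φ x)
    (h : IsGPRegression P X k σ f ε) (n : ℕ) (z : X) (hg : Measurable g)
    (hg0 : ∀ᵐ ω ∂P, 0 ≤ g (W ω)) :
    Integrable (fun ω => max (f z ω - ucb k σ (fun i : Fin n => (x i ω : Pt d))
        (fun i : Fin n => f (x i ω) ω + ε i ω) (g (W ω)) z) 0) P ∧
    ∫ ω, max (f z ω - ucb k σ (fun i : Fin n => (x i ω : Pt d))
        (fun i : Fin n => f (x i ω) ω + ε i ω) (g (W ω)) z) 0 ∂P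
      ≤ 1 / √(2 * Real.pi) * mgf (fun ω => g (W ω)) P (-1 / 2) := by
  obtain ⟨F, hF, hfF⟩ := exists_path h.gp.measurable hx.cont
  have hk := measurable_kernel h hF hfF
  have hqp := measurable_queryPts hx.meas_policy n
  have hle := hx.lintegral_sub_ucb_le h n z hg hg0
  set D : Ω → ℝ := fun ω => f z ω - ucb k σ (fun i : Fin n => (x i ω : Pt d))
        (fun i : Fin n => f (x i ω) ω + ε i ω) (g (W ω)) z with hD
  have hexp : Integrable (fun ω => Real.exp (-g (W ω) / 2) / √(2 * Real.pi)) P := by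
    refine Integrable.div_const ?_ _
    refine Integrable.of_bound (C := 1) ?_ ?_
    · exact ((((hg.comp hx.meas_W).neg).div_const 2).exp).aestronglyMeasurable
    · filter_upwards [hg0] with ω hω
      rw [Real.norm_eq_abs, Real.abs_exp]
      exact Real.exp_le_one_iff.2 (by linarith)
  have hDm : AEMeasurable D P := by
    have hz : Measurable fun _ : (Fin n → ℝ) × 𝒲 => z := measurable_const
    have h1 := (measurable_postMean (σ := σ) hk hqp measurable_fst hz).comp_aemeasurable
      (hx.aemeasurable_data h n)
    have h2 := (measurable_postVar (σ := σ) hk hqp hz).comp_aemeasurable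
      (hx.aemeasurable_data h n)
    simp only [Function.comp_def, hx.queryPts_eq] at h1 h2
    exact (h.gp.measurable z z.2).aemeasurable.sub
      (h1.add ((hg.comp hx.meas_W).sqrt.aemeasurable.mul h2.sqrt))
  have hof : ∀ ω, ENNReal.ofReal (max (D ω) 0) = ENNReal.ofReal (D ω) := fun ω => by
    rcases le_total (D ω) 0 with h0 | h0
    · simp [h0]
    · simp [h0]
  rw [← ofReal_integral_eq_lintegral_ofReal hexp (ae_of_all _ fun ω => by positivity)] at hle
  have hm : AEStronglyMeasurable (fun ω => max (D ω) 0) P :=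
    (hDm.max aemeasurable_const).aestronglyMeasurable
  have hmax : 0 ≤ᵐ[P] fun ω => max (D ω) 0 := ae_of_all _ fun ω => le_max_right _ _
  have hI : Integrable (fun ω => max (D ω) 0) P := by
    refine ⟨hm, ?_⟩
    rw [hasFiniteIntegral_iff_ofReal hmax]
    simp only [hof]
    exact hle.trans_lt ENNReal.ofReal_lt_top
  refine ⟨hI, ?_⟩
  change ∫ ω, max (D ω) 0 ∂P ≤ _
  rw [integral_eq_lintegral_of_nonneg_ae hmax hm]
  simp only [hof]
  refine (ENNReal.toReal_mono ENNReal.ofReal_ne_top hle).trans ?_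
  rw [ENNReal.toReal_ofReal (integral_nonneg fun ω => by positivity), integral_div, mgf]
  refine le_of_eq ?_
  rw [div_eq_inv_mul, one_div]
  congr 2
  ext ω
  congr 1
  ring

/-- The posterior mean at the query point is unbiased. -/
theorem integral_sub_postMean (hx : IsAdaptiveDesign P X f ε W φ x)
    (h : IsGPRegression P X k σ f ε) (n : ℕ) :
    Integrable (fun ω => f (x n ω) ω - postMean k σ (fun i : Fin n => (x i ω : Pt d))
        (fun i : Fin n => f (x i ω) ω + ε i ω) (x n ω)) P ∧
    ∫ ω, (f (x n ω) ω - postMean k σ (fun i : Fin n => (x i ω : Pt d))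
        (fun i : Fin n => f (x i ω) ω + ε i ω) (x n ω)) ∂P = 0 := by
  obtain ⟨F, hF, hfF⟩ := exists_path h.gp.measurable hx.cont
  have hk := measurable_kernel h hF hfF
  have hqp := measurable_queryPts hx.meas_policy n
  -- The query is itself a function of the data, because the data include `W`. Hence it is an
  -- admissible point for `lintegral_posterior`.
  have hz := measurable_queryPt hx.meas_policy n
  have hμ := measurable_postMean (σ := σ) hk hqp measurable_fst hz
  set D : Ω → ℝ := fun ω => f (x n ω) ω - postMean k σ (fun i : Fin n => (x i ω : Pt d))
        (fun i : Fin n => f (x i ω) ω + ε i ω) (x n ω) with hD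
  have hDm : AEStronglyMeasurable D P := by
    have h1 := hμ.comp_aemeasurable (hx.aemeasurable_data h n)
    simp only [Function.comp_def, hx.queryPts_eq, ← hx.query_eq] at h1
    exact ((hx.aemeasurable_eval h (hx.aemeasurable_query h n)).sub h1).aestronglyMeasurable
  have key : ∀ u : ℝ → ℝ≥0∞, Measurable u → ∫⁻ ω, u (D ω) ∂P
      = ∫⁻ ω, (∫⁻ r, u (√(postVar k σ (fun i : Fin n => (x i ω : Pt d)) (x n ω)) * r)
        ∂(gaussianReal 0 1)) ∂P := fun u hu => by
    have := hx.lintegral_posterior h n hz (H := fun p => u (p.1 -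
      postMean k σ (fun i => ((queryPts φ n p.2 i : X) : Pt d)) p.2.1 ((queryPt φ n p.2 : X) : Pt d)))
      (hu.comp (measurable_fst.sub (hμ.comp measurable_snd)))
    simp only [hx.queryPts_eq, ← hx.query_eq, add_sub_cancel_left] at this
    exact this
  have hpos := key (fun r => ENNReal.ofReal r) ENNReal.measurable_ofReal
  have hneg := key (fun r => ENNReal.ofReal (-r)) (ENNReal.measurable_ofReal.comp measurable_neg)
  -- Symmetry of the normal law equates the integrals of the positive and the negative part. They
  -- are finite by the tail bound at `c = 0`, so the mean vanishes.
  have hsym : ∫⁻ ω, ENNReal.ofReal (-D ω) ∂P = ∫⁻ ω, ENNReal.ofReal (D ω) ∂P := by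
    rw [hpos, hneg]
    refine lintegral_congr fun ω => ?_
    rw [← lintegral_gaussian_neg]
    simp
  have hfin : ∫⁻ ω, ENNReal.ofReal (D ω) ∂P < ⊤ := by
    rw [hpos]
    refine lt_of_le_of_lt (lintegral_mono (g := fun _ => ENNReal.ofReal
      (Real.exp (-0 ^ 2 / 2) / √(2 * Real.pi))) fun ω => ?_)
      (by rw [lintegral_const, measure_univ, mul_one]; exact ENNReal.ofReal_lt_top)
    refine le_trans (lintegral_mono fun r => ENNReal.ofReal_le_ofReal_iff'.2 ?_)
      (lintegral_gaussian_sub_le le_rfl)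
    have h0 := Real.sqrt_nonneg (postVar k σ (fun i : Fin n => (x i ω : Pt d)) (x n ω))
    have h1 := Real.sqrt_le_one.2 (h.postVar_le_one (fun i : Fin n => x i ω) (x n ω))
    rcases le_total r 0 with hr | hr
    · right; exact mul_nonpos_of_nonneg_of_nonpos h0 hr
    · left; nlinarith
  have hI : Integrable D P := by
    refine ⟨hDm, ?_⟩
    rw [hasFiniteIntegral_iff_norm]
    have : ∀ ω, ENNReal.ofReal ‖D ω‖ ≤ ENNReal.ofReal (D ω) + ENNReal.ofReal (-D ω) := fun ω => by
      rw [Real.norm_eq_abs]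
      rcases abs_cases (D ω) with ⟨he, _⟩ | ⟨he, _⟩ <;> rw [he]
      · exact le_self_add
      · exact le_add_self
    refine (lintegral_mono this).trans_lt ?_
    rw [lintegral_add_left' hDm.aemeasurable.ennreal_ofReal, hsym]
    exact ENNReal.add_lt_top.2 ⟨hfin, hfin⟩
  refine ⟨hI, ?_⟩
  rw [integral_eq_lintegral_pos_part_sub_lintegral_neg_part hI, hsym, sub_self]

end IsAdaptiveDesign

/-! ### From the regret of one round to the cumulative regret. -/

namespace IsAdaptiveDesign

variable {Ω 𝒲 : Type*} [MeasurableSpace Ω] [MeasurableSpace 𝒲] {P : Measure Ω}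
  [IsProbabilityMeasure P] {d : ℕ} {X : Set (Pt d)} {f : Pt d → Ω → ℝ} {ε : ℕ → Ω → ℝ} {W : Ω → 𝒲}
  {φ : ∀ t : ℕ, (Fin t → X × ℝ) × 𝒲 → X} {x : ℕ → Ω → X} {k : Pt d → Pt d → ℝ} {σ : ℝ}

/-- Regret of one round up to the width of the confidence band, for a finite set of
reference points. -/
theorem exists_round_bound (hx : IsAdaptiveDesign P X f ε W φ x)
    (h : IsGPRegression P X k σ f ε) (n : ℕ) {g : 𝒲 → ℝ} (hg : Measurable g)
    (hg0 : ∀ᵐ ω ∂P, 0 ≤ g (W ω))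
    (hmax : ∀ᵐ ω ∂P, ∀ z : X,
      ucb k σ (fun i : Fin n => (x i ω : Pt d)) (fun i : Fin n => f (x i ω) ω + ε i ω) (g (W ω)) z ≤
      ucb k σ (fun i : Fin n => (x i ω : Pt d)) (fun i : Fin n => f (x i ω) ω + ε i ω) (g (W ω))
        (x n ω))
    {A : Ω → ℝ} (hA : Integrable A P) (G : Finset X)
    (hG : ∀ᵐ ω ∂P, ∀ z : X, ∃ p ∈ G, f z ω ≤ f p ω + A ω) :
    ∃ V : Ω → ℝ, Integrable V P ∧
      ∫ ω, V ω ∂P ≤ ∫ ω, A ω ∂P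
        + G.card / √(2 * Real.pi) * mgf (fun ω => g (W ω)) P (-1 / 2) ∧
      ∀ᵐ ω ∂P, (⨆ z : X, f z ω) - f (x n ω) ω
        ≤ V ω + √(g (W ω)) * √(postVar k σ (fun i : Fin n => (x i ω : Pt d)) (x n ω)) := by
  let B : X → Ω → ℝ := fun z ω => max (f z ω - ucb k σ (fun i : Fin n => (x i ω : Pt d))
        (fun i : Fin n => f (x i ω) ω + ε i ω) (g (W ω)) z) 0
  let D : Ω → ℝ := fun ω => f (x n ω) ω - postMean k σ (fun i : Fin n => (x i ω : Pt d))
        (fun i : Fin n => f (x i ω) ω + ε i ω) (x n ω)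
  have hB : ∀ z, Integrable (B z) P ∧ ∫ ω, B z ω ∂P
      ≤ 1 / √(2 * Real.pi) * mgf (fun ω => g (W ω)) P (-1 / 2) :=
    fun z => hx.integrable_sub_ucb h n z hg hg0
  have hD : Integrable D P ∧ ∫ ω, D ω ∂P = 0 := hx.integral_sub_postMean h n
  have hS : Integrable (fun ω => ∑ z ∈ G, B z ω) P := integrable_finsetSum _ fun z _ => (hB z).1
  refine ⟨fun ω => A ω + ∑ z ∈ G, B z ω - D ω, (hA.add hS).sub hD.1, ?_, ?_⟩
  · have hAS : Integrable (fun ω => A ω + ∑ z ∈ G, B z ω) P := hA.add hS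
    simp only
    rw [integral_sub hAS hD.1, integral_add hA hS, hD.2,
      integral_finsetSum _ fun z _ => (hB z).1, sub_zero]
    gcongr
    refine (Finset.sum_le_card_nsmul _ _ _ fun z _ => (hB z).2).trans_eq ?_
    rw [nsmul_eq_mul]
    ring
  · filter_upwards [hmax, hG] with ω hm hω
    have : Nonempty X := ⟨x n ω⟩
    rw [sub_le_iff_le_add]
    refine ciSup_le fun z => ?_
    obtain ⟨p, hp, hzp⟩ := hω z
    -- The reference point `p` depends on `ω`, so the failure at `p` is replaced by the sum of the
    -- failures over all of `G`, each with a known bound on its mean.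
    have h1 : B p ω ≤ ∑ z ∈ G, B z ω :=
      Finset.single_le_sum (f := fun z => B z ω) (fun z _ => le_max_right _ _) hp
    let u : X → ℝ := fun z => ucb k σ (fun i : Fin n => (x i ω : Pt d))
      (fun i : Fin n => f (x i ω) ω + ε i ω) (g (W ω)) z
    have h2 : f p ω - u p ≤ B p ω := le_max_left _ _
    have h3 : u p ≤ u (x n ω) := hm p
    have h4 : u (x n ω) = f (x n ω) ω - D ω
        + √(g (W ω)) * √(postVar k σ (fun i : Fin n => (x i ω : Pt d)) (x n ω)) := by
      simp [u, D, ucb]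
    linarith

/-- Cumulative regret from bounds on the regret of the rounds. -/
theorem integrable_cumRegret (hx : IsAdaptiveDesign P X f ε W φ x)
    (h : IsGPRegression P X k σ f ε) (hX : IsCompact X) (T : ℕ) {ζ : ℕ → Ω → ℝ}
    (hζ0 : ∀ t, ∀ᵐ ω ∂P, 0 ≤ ζ t ω) (hζ : ∀ t, Integrable (ζ t) P)
    {V : ℕ → Ω → ℝ} (hV : ∀ t, Integrable (V t) P)
    (hb : ∀ t, ∀ᵐ ω ∂P, (⨆ z : X, f z ω) - f (x t ω) ω
        ≤ V t ω + √(ζ t ω) * √(postVar k σ (fun i : Fin t => (x i ω : Pt d)) (x t ω))) :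
    Integrable (cumRegret X f (fun t ω => (x t ω : Pt d)) T) P ∧
      0 ≤ BCR P X f (fun t ω => (x t ω : Pt d)) T ∧
      BCR P X f (fun t ω => (x t ω : Pt d)) T ≤ ∑ t ∈ Finset.range T, ∫ ω, V t ω ∂P
        + √(C₁ σ * maxInfoGain P X f ε T * ∑ t ∈ Finset.range T, ∫ ω, ζ t ω ∂P) := by
  set c := C₁ σ * maxInfoGain P X f ε T with hc
  have hZ : Integrable (fun ω => ∑ t ∈ Finset.range T, ζ t ω) P :=
    integrable_finsetSum _ fun t _ => hζ t
  have hZ0 : ∀ᵐ ω ∂P, 0 ≤ ∑ t ∈ Finset.range T, ζ t ω := by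
    filter_upwards [ae_all_iff.2 hζ0] with ω hω using Finset.sum_nonneg fun t _ => hω t
  obtain ⟨hsi, hsle⟩ := integral_sqrt_le hZ hZ0
  have hVs : Integrable (fun ω => ∑ t ∈ Finset.range T, V t ω) P :=
    integrable_finsetSum _ fun t _ => hV t
  have hbound : Integrable (fun ω => ∑ t ∈ Finset.range T, V t ω
      + √c * √(∑ t ∈ Finset.range T, ζ t ω)) P := hVs.add (hsi.const_mul _)
  have hle : ∀ᵐ ω ∂P, cumRegret X f (fun t ω => (x t ω : Pt d)) T ω
      ≤ ∑ t ∈ Finset.range T, V t ω + √c * √(∑ t ∈ Finset.range T, ζ t ω) := by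
    filter_upwards [ae_all_iff.2 hb, ae_all_iff.2 hζ0] with ω hω h0
    refine (Finset.sum_le_sum fun t _ => hω t).trans ?_
    rw [Finset.sum_add_distrib]
    gcongr
    -- Cauchy-Schwarz on each sample path. The sum of posterior variances has a deterministic bound
    -- valid for every sequence of queries, so its dependence on `ζ` is harmless.
    refine (Real.sum_sqrt_mul_sqrt_le (Finset.range T) (fun t => h0 t) fun t =>
      h.postVar_nonneg (fun i : Fin t => x i ω) (x t ω)).trans ?_
    rw [mul_comm]
    gcongr
    exact h.sum_postVar_le (fun t => x t ω) T
  have h0 : ∀ᵐ ω ∂P, 0 ≤ cumRegret X f (fun t ω => (x t ω : Pt d)) T ω := by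
    filter_upwards [hx.le_iSup hX] with ω hω
    exact Finset.sum_nonneg fun t _ => sub_nonneg.2 (hω _)
  have hm : AEMeasurable (cumRegret X f (fun t ω => (x t ω : Pt d)) T) P :=
    Finset.aemeasurable_fun_sum _ fun t _ => (hx.aemeasurable_iSup h hX).sub
      (hx.aemeasurable_eval h (hx.aemeasurable_query h t))
  have hI : Integrable (cumRegret X f (fun t ω => (x t ω : Pt d)) T) P := by
    refine hbound.mono' hm.aestronglyMeasurable ?_
    filter_upwards [hle, h0] with ω h1 h2
    rwa [Real.norm_eq_abs, abs_of_nonneg h2]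
  refine ⟨hI, integral_nonneg_of_ae h0, (integral_mono_ae hI hbound hle).trans ?_⟩
  rw [integral_add hVs (hsi.const_mul _), integral_finsetSum _ fun t _ => hV t,
    integral_const_mul]
  gcongr
  have hc0 : 0 ≤ c := by
    refine le_trans ?_ (h.sum_postVar_le (fun t => x t (Classical.choice P.nonempty_of_neZero)) T)
    exact Finset.sum_nonneg fun t _ => h.postVar_nonneg (fun i : Fin t => x i _) (x t _)
  rw [Real.sqrt_mul hc0]
  rw [integral_finsetSum _ fun t _ => hζ t] at hsle
  gcongr

end IsAdaptiveDesign

/-! ### RGP-UCB as an adaptive design; finite domains. -/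

/-- A policy takes values in the whole space and is known to hit `X` only along realized data.
Composing with `ρ` yields a policy into `X` without changing any query. -/
theorem exists_measurable_retract {d : ℕ} {X : Set (Pt d)} (hX : MeasurableSet X) (x₀ : X) :
    ∃ ρ : Pt d → X, Measurable ρ ∧ ∀ z : X, ρ z = z := by
  classical
  have h : ∀ p : Pt d, (if p ∈ X then p else x₀) ∈ X := fun p => by
    split_ifs with hp
    · exact hp
    · exact x₀.2
  refine ⟨fun p => ⟨_, h p⟩, (Measurable.ite hX measurable_id measurable_const).subtype_mk,
    fun z => Subtype.ext (if_pos z.2)⟩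

/-- RGP-UCB is an adaptive design. -/
theorem IsRGPUCB.exists_design {Ω S : Type*} [MeasurableSpace Ω] [MeasurableSpace S]
    {P : Measure Ω} [IsProbabilityMeasure P] {d : ℕ} {X : Set (Pt d)} {k : Pt d → Pt d → ℝ} {σ : ℝ}
    {f : Pt d → Ω → ℝ} {ε ζ : ℕ → Ω → ℝ} {U : Ω → S} {x : ℕ → Ω → Pt d}
    (hx : IsRGPUCB P X k σ f ε ζ U x) (hX : MeasurableSet X)
    (hc : ∀ᵐ ω ∂P, Continuous fun z : X => f z ω)
    (hζ : ∀ t, Measurable (ζ t)) (hU : Measurable U)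
    (hind : IndepFun (fun ω => ((fun z : X => f z ω), (fun t : ℕ => ε t ω)))
      (fun ω => ((fun t : ℕ => ζ t ω), U ω)) P) :
    ∃ φ : ∀ t : ℕ, (Fin t → X × ℝ) × ((ℕ → ℝ) × S) → X,
      IsAdaptiveDesign P X f ε (fun ω => ((fun t : ℕ => ζ t ω), U ω)) φ
        (fun t ω => ⟨x t ω, hx.mem t ω⟩) := by
  obtain ⟨ω₀⟩ := P.nonempty_of_neZero
  obtain ⟨ρ, hρ, hρe⟩ := exists_measurable_retract hX ⟨x 0 ω₀, hx.mem 0 ω₀⟩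
  choose φ hφ hφe using hx.policy
  refine ⟨fun t p => ρ (φ t (fun i => (((p.1 i).1 : Pt d), (p.1 i).2), p.2.1 t, p.2.2)), ?_⟩
  exact
    { cont := hc
      meas_W := (measurable_pi_iff.2 hζ).prodMk hU
      meas_policy := fun t => by
        refine hρ.comp ((hφ t).comp (Measurable.prodMk (measurable_pi_iff.2 fun i => ?_)
          (Measurable.prodMk ?_ (measurable_snd.comp measurable_snd))))
        · have h1 : Measurable fun p : (Fin t → X × ℝ) × ((ℕ → ℝ) × S) => p.1 i :=
            (measurable_pi_apply i).comp measurable_fst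
          exact (measurable_subtype_coe.comp (measurable_fst.comp h1)).prodMk
            (measurable_snd.comp h1)
        · exact (measurable_pi_apply t).comp (measurable_fst.comp measurable_snd)
      indep := hind
      query := fun t ω => by
        have := hφe t ω
        simp only [obs] at this
        simp only [← this]
        exact (hρe ⟨x t ω, hx.mem t ω⟩).symm }

/-- Regret on a finite domain. -/
theorem IsAdaptiveDesign.finite_regret {Ω 𝒲 : Type*} [MeasurableSpace Ω] [MeasurableSpace 𝒲]
    {P : Measure Ω} [IsProbabilityMeasure P] {d : ℕ} {X : Set (Pt d)} {f : Pt d → Ω → ℝ}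
    {ε : ℕ → Ω → ℝ} {W : Ω → 𝒲} {φ : ∀ t : ℕ, (Fin t → X × ℝ) × 𝒲 → X} {x : ℕ → Ω → X}
    {k : Pt d → Pt d → ℝ} {σ : ℝ} (hx : IsAdaptiveDesign P X f ε W φ x)
    (h : IsGPRegression P X k σ f ε) (hX : X.Finite) {g : ℕ → 𝒲 → ℝ} (hg : ∀ t, Measurable (g t))
    (hg0 : ∀ t, ∀ᵐ ω ∂P, 0 ≤ g t (W ω)) (hgi : ∀ t, Integrable (fun ω => g t (W ω)) P)
    (hmax : ∀ n, ∀ᵐ ω ∂P, ∀ z : X,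
      ucb k σ (fun i : Fin n => (x i ω : Pt d)) (fun i : Fin n => f (x i ω) ω + ε i ω) (g n (W ω)) z
      ≤ ucb k σ (fun i : Fin n => (x i ω : Pt d)) (fun i : Fin n => f (x i ω) ω + ε i ω) (g n (W ω))
        (x n ω)) (T : ℕ) :
    Integrable (cumRegret X f (fun t ω => (x t ω : Pt d)) T) P ∧
      0 ≤ BCR P X f (fun t ω => (x t ω : Pt d)) T ∧
      BCR P X f (fun t ω => (x t ω : Pt d)) T ≤ (X.ncard : ℝ) / √(2 * Real.pi) *
          ∑ t ∈ Finset.range T, mgf (fun ω => g t (W ω)) P (-1 / 2)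
        + √(C₁ σ * maxInfoGain P X f ε T * ∑ t ∈ Finset.range T, ∫ ω, g t (W ω) ∂P) := by
  have := hX.fintype
  have key : ∀ n, _ := fun n => hx.exists_round_bound h n (hg n) (hg0 n) (hmax n)
    (A := fun _ => 0) (integrable_zero _ _ _) Finset.univ
    (ae_of_all _ fun ω z => ⟨z, Finset.mem_univ z, by simp⟩)
  choose V hV hVle hb using key
  obtain ⟨h1, h2, h3⟩ := hx.integrable_cumRegret h hX.isCompact T hg0 hgi hV hb
  refine ⟨h1, h2, h3.trans ?_⟩
  gcongr
  rw [Finset.mul_sum]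
  refine Finset.sum_le_sum fun t _ => (hVle t).trans_eq ?_
  rw [integral_zero, zero_add, Set.ncard_eq_toFinset_card', Set.toFinset_card, Finset.card_univ]

/-! ### Regret rate. -/

/-- `exp (-E ζ / 2) ≤ E exp (-ζ / 2)`. -/
theorem exp_integral_le {Ω : Type*} [MeasurableSpace Ω] {P : Measure Ω} [IsProbabilityMeasure P]
    {Z : Ω → ℝ} (hZ : Integrable Z P) (h0 : ∀ᵐ ω ∂P, 0 ≤ Z ω) :
    Real.exp (-(∫ ω, Z ω ∂P) / 2) ≤ ∫ ω, Real.exp (-Z ω / 2) ∂P := by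
  have hi : Integrable (fun ω => Real.exp (-Z ω / 2)) P := by
    refine Integrable.of_bound (C := 1)
      (Real.continuous_exp.comp_aestronglyMeasurable (hZ.neg.div_const 2).1) ?_
    filter_upwards [h0] with ω hω
    rw [Real.norm_eq_abs, Real.abs_exp]
    exact Real.exp_le_one_iff.2 (by linarith)
  have hl : Integrable (fun ω => -Z ω / 2) P := hZ.neg.div_const 2
  have := convexOn_exp.map_integral_le Real.continuous_exp.continuousOn isClosed_univ
    (ae_of_all P fun ω => Set.mem_univ (-Z ω / 2)) hl hi
  rwa [integral_div, integral_neg] at this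

/-- The regret rate follows from the regret bound. -/
theorem hasRegretRate_of_bound {Ω : Type*} [MeasurableSpace Ω] {P : Measure Ω}
    [IsProbabilityMeasure P] {d : ℕ} {X : Set (Pt d)} {f : Pt d → Ω → ℝ} {ε ζ : ℕ → Ω → ℝ}
    {x : ℕ → Ω → Pt d} {N : ℕ → ℝ} {c₁ c₂ K K' : ℝ} (hζ0 : ∀ t, ∀ᵐ ω ∂P, 0 ≤ ζ t ω)
    (hζ : ∀ t, Integrable (ζ t) P) (hN0 : 0 < N 0) (hN : ∀ t, N 0 ≤ N t)
    (hrate : RateCondition P ζ N) (hc₁ : 0 < c₁)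
    (hγ : ∀ T, 0 < T → c₁ ≤ maxInfoGain P X f ε T) (hc₂ : 0 ≤ c₂) (hK : 0 ≤ K) (hK' : 0 ≤ K')
    (h0 : ∀ T, 0 ≤ BCR P X f x T)
    (hb : ∀ T, BCR P X f x T ≤ K + K' * ∑ t ∈ Finset.range T, N t * mgf (ζ t) P (-1 / 2)
      + √(c₂ * maxInfoGain P X f ε T * ∑ t ∈ Finset.range T, ∫ ω, ζ t ω ∂P)) :
    HasRegretRate P X f ε ζ x := by
  set e : ℕ → ℝ := fun t => ∫ ω, ζ t ω ∂P with he
  set m : ℕ → ℝ := fun t => ∫ ω, Real.exp (-ζ t ω / 2) ∂P with hm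
  have hmgf : ∀ t, mgf (ζ t) P (-1 / 2) = m t := fun t => by
    refine integral_congr_ae (ae_of_all _ fun ω => ?_)
    simp only
    congr 1
    ring
  have he0 : ∀ t, 0 ≤ e t := fun t => integral_nonneg_of_ae (hζ0 t)
  have hNpos : ∀ t, 0 < N t := fun t => hN0.trans_le (hN t)
  have hm0 : ∀ t, 0 < m t := fun t => (Real.exp_pos _).trans_le (exp_integral_le (hζ t) (hζ0 t))
  obtain ⟨C, hC0, hC⟩ := hrate.1.exists_pos
  obtain ⟨C', hC'0, hC'⟩ := hrate.2.exists_pos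
  rw [Asymptotics.isBigOWith_iff] at hC hC'
  have hlog : Tendsto (fun t : ℕ => Real.log ((t : ℝ) + 1)) atTop atTop :=
    Real.tendsto_log_atTop.comp (tendsto_atTop_add_const_right _ _ tendsto_natCast_atTop_atTop)
  have hlog0 : ∀ t : ℕ, 0 ≤ Real.log ((t : ℝ) + 1) := fun t =>
    Real.log_nonneg (by have : (0 : ℝ) ≤ t := t.cast_nonneg; linarith)
  -- the mean is at least of logarithmic order
  have hlow : ∀ᶠ t : ℕ in atTop, Real.log ((t : ℝ) + 1) ≤ e t := by
    -- Jensen's inequality yields `e t ≥ 4 log (t + 1) - 2 log (C' / N 0)`; beyond the threshold the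
    -- last term costs at most one `log (t + 1)`.
    filter_upwards [hC', hlog.eventually_ge_atTop (2 * Real.log (C' / N 0))] with t ht hl
    have hl0 := hlog0 t
    have ht1 : (0 : ℝ) < (t : ℝ) + 1 := by positivity
    have h1 : m t ≤ C' / N 0 / ((t : ℝ) + 1) ^ 2 := by
      have h2 : 0 < 1 / (N t * ((t : ℝ) + 1) ^ 2) := by have := hNpos t; positivity
      rw [Real.norm_of_nonneg (hm0 t).le, Real.norm_of_nonneg h2.le] at ht
      refine ht.trans ?_
      rw [mul_one_div, div_div]
      have := hN t
      gcongr
    have h3 := (exp_integral_le (hζ t) (hζ0 t)).trans h1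
    have h4 := Real.log_le_log (Real.exp_pos _) h3
    rw [Real.log_exp, Real.log_div (by positivity) (by positivity), Real.log_pow] at h4
    push_cast at h4
    change -e t / 2 ≤ _ at h4
    linarith
  -- the upper bound for the sum of means
  obtain ⟨t₀, ht₀⟩ := eventually_atTop.1 hC
  have hup : ∀ t, t₀ ≤ t → e t ≤ C * Real.log ((t : ℝ) + 1) := fun t ht => by
    have := ht₀ t ht
    rwa [Real.norm_of_nonneg (he0 t), Real.norm_of_nonneg (hlog0 t)] at this
  set K₀ := ∑ t ∈ Finset.range t₀, e t with hK₀
  have hK₀0 : 0 ≤ K₀ := Finset.sum_nonneg fun t _ => he0 t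
  have hsum : ∀ n : ℕ, ∑ t ∈ Finset.range (n + 1), e t
      ≤ K₀ + C * (((n : ℝ) + 1) * Real.log ((n : ℝ) + 1)) := fun n => by
    -- The rounds before `t₀`, where the logarithmic bound is not available, contribute at most `K₀`
    -- in total.
    have h1 : ∀ t ∈ Finset.range (n + 1), e t
        ≤ (if t ∈ Finset.range t₀ then e t else 0) + C * Real.log ((n : ℝ) + 1) := fun t ht => by
      have htn : (t : ℝ) ≤ n := by
        exact_mod_cast Nat.lt_succ_iff.1 (Finset.mem_range.1 ht)
      split_ifs with h
      · have := mul_nonneg hC0.le (hlog0 n)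
        linarith
      · rw [Finset.mem_range, not_lt] at h
        rw [zero_add]
        refine (hup t h).trans ?_
        gcongr
    refine (Finset.sum_le_sum h1).trans ?_
    rw [Finset.sum_add_distrib, Finset.sum_const, Finset.card_range, nsmul_eq_mul]
    refine add_le_add ?_ (le_of_eq (by push_cast; ring))
    rw [← Finset.sum_filter]
    refine Finset.sum_le_sum_of_subset_of_nonneg (fun t ht => (Finset.mem_filter.1 ht).2)
      fun t _ _ => he0 t
  -- the failure terms are summable
  have hsm : Summable fun t => N t * m t := by
    have h1 : (fun t => N t * m t) =O[atTop] fun t : ℕ => 1 / ((t : ℝ) + 1) ^ 2 := by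
      refine ((Asymptotics.isBigO_refl N atTop).mul hrate.2).congr_right fun t => ?_
      have := (hNpos t).ne'
      field_simp
    have h2 : Summable fun t : ℕ => 1 / ((t : ℝ) + 1) ^ 2 := by
      have := (summable_nat_add_iff 1).2 (Real.summable_one_div_nat_pow.2 one_lt_two)
      exact_mod_cast this
    exact summable_of_isBigO_nat h2 h1
  have hsm0 : ∀ t, 0 ≤ N t * m t := fun t => mul_nonneg (hNpos t).le (hm0 t).le
  set K₁ := K + K' * ∑' t, N t * m t with hK₁
  have hK₁0 : 0 ≤ K₁ := add_nonneg hK (mul_nonneg hK' (tsum_nonneg hsm0))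
  -- Once `e n ≥ 1`, the comparison function is at least `√c₁`, so the bounded part `K₁` costs `K₁ /
  -- √c₁`. The other constant comes from the sum of means after replacing `log (n + 1)` by `e n`.
  refine Asymptotics.IsBigO.of_bound (K₁ / √c₁ + √(c₂ * (K₀ + C))) ?_
  filter_upwards [hlow, hlog.eventually_ge_atTop 1] with n hn hl
  have hγn := hγ (n + 1) n.succ_pos
  set γ := maxInfoGain P X f ε (n + 1)
  have hγ0 : 0 < γ := hc₁.trans_le hγn
  have hn1 : (1 : ℝ) ≤ (n : ℝ) + 1 := by have : (0 : ℝ) ≤ n := n.cast_nonneg; linarith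
  rw [Real.norm_of_nonneg (h0 _), Real.norm_of_nonneg (Real.sqrt_nonneg _), add_mul]
  refine (hb (n + 1)).trans (add_le_add ?_ ?_)
  · have h1 : K + K' * ∑ t ∈ Finset.range (n + 1), N t * mgf (ζ t) P (-1 / 2) ≤ K₁ := by
      simp only [hmgf]
      exact add_le_add le_rfl
        (mul_le_mul_of_nonneg_left (hsm.sum_le_tsum _ fun t _ => hsm0 t) hK')
    have h2 : c₁ ≤ ((n : ℝ) + 1) * γ * e n := by
      have : 1 ≤ e n := hl.trans hn
      calc c₁ ≤ 1 * γ * 1 := by linarith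
        _ ≤ _ := by gcongr
    refine h1.trans ?_
    rw [div_mul_eq_mul_div, le_div_iff₀ (Real.sqrt_pos.2 hc₁)]
    exact mul_le_mul_of_nonneg_left (Real.sqrt_le_sqrt h2) hK₁0
  · rw [← Real.sqrt_mul (by positivity)]
    refine Real.sqrt_le_sqrt ?_
    have h1 : ∑ t ∈ Finset.range (n + 1), e t ≤ (K₀ + C) * (((n : ℝ) + 1) * e n) := by
      refine (hsum n).trans ?_
      rw [add_mul K₀]
      have h3 : 1 ≤ ((n : ℝ) + 1) * e n := by
        have : 1 ≤ e n := hl.trans hn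
        nlinarith
      have h4 : K₀ ≤ K₀ * (((n : ℝ) + 1) * e n) := le_mul_of_one_le_right hK₀0 h3
      exact add_le_add h4 (mul_le_mul_of_nonneg_left
        (mul_le_mul_of_nonneg_left hn (zero_le_one.trans hn1)) hC0.le)
    calc c₂ * γ * ∑ t ∈ Finset.range (n + 1), e t
        ≤ c₂ * γ * ((K₀ + C) * (((n : ℝ) + 1) * e n)) := by gcongr
      _ = _ := by ring

/-! ### Three families of confidence parameters. -/

/-- Multiplying the density by `y` raises the shape by one and produces the factor `κ / r`; the new
density integrates to `1`. -/
theorem lintegral_ofReal_gammaMeasure {κ r : ℝ} (hκ : 0 < κ) (hr : 0 < r) :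
    ∫⁻ y, ENNReal.ofReal y ∂(gammaMeasure κ r) = ENNReal.ofReal (κ / r) := by
  have hm : ∀ a, Measurable (gammaPDF a r) := fun a => (measurable_gammaPDFReal a r).ennreal_ofReal
  rw [gammaMeasure, lintegral_withDensity_eq_lintegral_mul _ (hm κ) ENNReal.measurable_ofReal]
  have h : ∀ y, (gammaPDF κ r * ENNReal.ofReal) y
      = ENNReal.ofReal (κ / r) * gammaPDF (κ + 1) r y := fun y => by
    rw [Pi.mul_apply]
    rcases lt_trichotomy y 0 with hy | rfl | hy
    · simp [gammaPDF_of_neg hy]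
    · simp [gammaPDF_of_nonneg, hκ.ne']
    · rw [gammaPDF_of_nonneg hy.le, gammaPDF_of_nonneg hy.le, ← ENNReal.ofReal_mul (by positivity),
        ← ENNReal.ofReal_mul (by positivity), Real.Gamma_add_one hκ.ne', Real.rpow_add hr,
        Real.rpow_one, add_sub_cancel_right]
      congr 1
      have := (Real.Gamma_pos_of_pos hκ).ne'
      rw [Real.rpow_sub_one hy.ne']
      field_simp
  rw [lintegral_congr h, lintegral_const_mul _ (hm _), lintegral_gammaPDF_eq_one (by linarith) hr,
    mul_one]

/-- Exponential tilting shifts the rate from `r` to `r + c`, and the change of normalizing constant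
is the value. -/
theorem lintegral_exp_gammaMeasure {κ r c : ℝ} (hκ : 0 < κ) (hr : 0 < r) (hc : 0 ≤ c) :
    ∫⁻ y, ENNReal.ofReal (Real.exp (-(c * y))) ∂(gammaMeasure κ r)
      = ENNReal.ofReal ((r / (r + c)) ^ κ) := by
  have hm : ∀ q, Measurable (gammaPDF κ q) := fun q => (measurable_gammaPDFReal κ q).ennreal_ofReal
  have hrc : 0 < r + c := by linarith
  rw [gammaMeasure, lintegral_withDensity_eq_lintegral_mul _ (hm r) (by fun_prop)]
  have h : ∀ y, (gammaPDF κ r * fun y => ENNReal.ofReal (Real.exp (-(c * y)))) y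
      = ENNReal.ofReal ((r / (r + c)) ^ κ) * gammaPDF κ (r + c) y := fun y => by
    rw [Pi.mul_apply]
    rcases lt_or_ge y 0 with hy | hy
    · simp [gammaPDF_of_neg hy]
    · rw [gammaPDF_of_nonneg hy, gammaPDF_of_nonneg hy, ← ENNReal.ofReal_mul (by positivity),
        ← ENNReal.ofReal_mul (by positivity), Real.div_rpow hr.le hrc.le]
      congr 1
      have h1 := (Real.Gamma_pos_of_pos hκ).ne'
      have h2 := (Real.rpow_pos_of_pos hrc κ).ne'
      have h3 : Real.exp (-((r + c) * y)) = Real.exp (-(r * y)) * Real.exp (-(c * y)) := by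
        rw [← Real.exp_add]
        congr 1
        ring
      rw [h3]
      field_simp
  rw [lintegral_congr h, lintegral_const_mul _ (hm _), lintegral_gammaPDF_eq_one hκ hrc, mul_one]

section Schedules

variable {Ω : Type*} [MeasurableSpace Ω] {P : Measure Ω} [IsProbabilityMeasure P]

theorem integral_le_of_lintegral_ofReal_le {Z : Ω → ℝ} (hZ : AEMeasurable Z P)
    (h0 : ∀ᵐ ω ∂P, 0 ≤ Z ω) {B : ℝ} (hB : 0 ≤ B)
    (h : ∫⁻ ω, ENNReal.ofReal (Z ω) ∂P ≤ ENNReal.ofReal B) : ∫ ω, Z ω ∂P ≤ B := by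
  rw [integral_eq_lintegral_of_nonneg_ae h0 hZ.aestronglyMeasurable]
  exact ENNReal.toReal_le_of_le_ofReal hB h

theorem one_isBigO_log : (fun _ : ℕ => (1 : ℝ)) =O[atTop] fun t : ℕ => Real.log ((t : ℝ) + 1) := by
  have hlog : Tendsto (fun t : ℕ => Real.log ((t : ℝ) + 1)) atTop atTop :=
    Real.tendsto_log_atTop.comp (tendsto_atTop_add_const_right _ _ tendsto_natCast_atTop_atTop)
  refine Asymptotics.IsBigO.of_bound 1 ?_
  filter_upwards [hlog.eventually_ge_atTop 1] with t ht
  rw [norm_one, one_mul]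
  exact ht.trans (le_abs_self _)

theorem rateCondition_of_le {ζ : ℕ → Ω → ℝ} {N B : ℕ → ℝ} {c C : ℝ} (hN : ∀ t, 0 < N t)
    (hB : B =O[atTop] fun t : ℕ => Real.log ((t : ℝ) + 1))
    (hζ0 : ∀ t, ∀ᵐ ω ∂P, 0 ≤ ζ t ω) (hmean : ∀ t, ∫ ω, ζ t ω ∂P ≤ c * B t + C)
    (hexp : ∀ t : ℕ, ∫ ω, Real.exp (-ζ t ω / 2) ∂P ≤ C / (N t * ((t : ℝ) + 1) ^ 2)) :
    RateCondition P ζ N := by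
  constructor
  · refine Asymptotics.IsBigO.trans (Asymptotics.IsBigO.of_bound 1 (Eventually.of_forall fun t => ?_))
      ((hB.const_mul_left c).add (one_isBigO_log.const_mul_left C))
    rw [one_mul, Real.norm_of_nonneg (integral_nonneg_of_ae (hζ0 t)), mul_one]
    exact (hmean t).trans (le_abs_self _)
  · refine Asymptotics.IsBigO.of_bound C (Eventually.of_forall fun t => ?_)
    have := hN t
    rw [Real.norm_of_nonneg (integral_nonneg fun ω => (Real.exp_pos _).le),
      Real.norm_of_nonneg (by positivity), mul_one_div]
    exact hexp t

theorem GammaSchedule.rateCondition {ζ : ℕ → Ω → ℝ} {N : ℕ → ℝ} (hN : ∀ t, 0 < N t)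
    (hζ0 : ∀ t, ∀ᵐ ω ∂P, 0 ≤ ζ t ω) (h : GammaSchedule P ζ N) : RateCondition P ζ N := by
  obtain ⟨θ, κ, hθ, hκ, hO⟩ := h
  refine rateCondition_of_le (c := θ) (C := 1) hN hO hζ0 (fun t => ?_) fun t => ?_
  · obtain ⟨h1, -, hl⟩ := hκ t
    refine integral_le_of_lintegral_ofReal_le hl.aemeasurable (hζ0 t) (by positivity) ?_
    rw [← lintegral_map' (f := fun y => ENNReal.ofReal y) (by fun_prop) hl.aemeasurable, hl.map_eq,
      lintegral_ofReal_gammaMeasure h1 (inv_pos.2 hθ)]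
    refine ENNReal.ofReal_le_ofReal ?_
    rw [div_inv_eq_mul]
    linarith
  · obtain ⟨h1, h2, hl⟩ := hκ t
    have hNt := hN t
    have hθ2 : 0 < Real.log (1 + θ / 2) := Real.log_pos (by linarith)
    refine integral_le_of_lintegral_ofReal_le (by have := hl.aemeasurable; fun_prop)
      (ae_of_all _ fun ω => (Real.exp_pos _).le) (by positivity) ?_
    have h3 : ∫⁻ ω, ENNReal.ofReal (Real.exp (-ζ t ω / 2)) ∂P
        = ∫⁻ ω, (fun y => ENNReal.ofReal (Real.exp (-(1 / 2 * y)))) (ζ t ω) ∂P := by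
      refine lintegral_congr fun ω => ?_
      simp only
      congr 2
      ring
    rw [h3, ← lintegral_map' (f := fun y => ENNReal.ofReal (Real.exp (-(1 / 2 * y)))) (by fun_prop)
      hl.aemeasurable, hl.map_eq,
      lintegral_exp_gammaMeasure h1 (inv_pos.2 hθ) (by norm_num)]
    refine ENNReal.ofReal_le_ofReal ?_
    -- The second parameter of `gammaMeasure` is a rate, the inverse of the scale, so the transform
    -- at `1/2` is `(1 + θ/2) ^ (-κ)`. Taking logarithms turns the required bound into the lower
    -- bound on the shape.
    have h4 : θ⁻¹ / (θ⁻¹ + 1 / 2) = (1 + θ / 2)⁻¹ := by field_simp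
    rw [h4, Real.inv_rpow (by positivity), ← one_div]
    refine one_div_le_one_div_of_le (by positivity) ?_
    rw [div_le_iff₀ hθ2] at h2
    rw [← Real.log_le_log_iff (by positivity) (by positivity), Real.log_rpow (by positivity)]
    exact h2

theorem ExponentialSchedule.rateCondition {ζ : ℕ → Ω → ℝ} {N : ℕ → ℝ} (hN : ∀ t, 0 < N t)
    (hζ0 : ∀ t, ∀ᵐ ω ∂P, 0 ≤ ζ t ω) (h : ExponentialSchedule P ζ N) : RateCondition P ζ N := by
  obtain ⟨r, s, hr, hs, hO⟩ := h
  have := isProbabilityMeasure_expMeasure hr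
  refine rateCondition_of_le (c := 1) (C := max 1 (1 / r)) hN hO hζ0 (fun t => ?_) fun t => ?_
  · obtain ⟨h1, -, hl⟩ := hs t
    refine (integral_le_of_lintegral_ofReal_le hl.aemeasurable (hζ0 t) (B := s t + 1 / r)
      (by positivity) ?_).trans (by rw [one_mul]; gcongr; exact le_max_right _ _)
    rw [← lintegral_map' (f := fun y => ENNReal.ofReal y) (by fun_prop) hl.aemeasurable, hl.map_eq,
      lintegral_map (by fun_prop) (by fun_prop), ENNReal.ofReal_add h1 (by positivity)]
    refine (lintegral_mono fun y => ENNReal.ofReal_add_le).trans ?_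
    rw [lintegral_add_left measurable_const, lintegral_const, measure_univ, mul_one, expMeasure,
      lintegral_ofReal_gammaMeasure one_pos hr]
  · obtain ⟨h1, h2, hl⟩ := hs t
    have hNt := hN t
    refine integral_le_of_lintegral_ofReal_le (by have := hl.aemeasurable; fun_prop)
      (ae_of_all _ fun ω => (Real.exp_pos _).le) (by positivity) ?_
    rw [← lintegral_map' (f := fun y => ENNReal.ofReal (Real.exp (-y / 2))) (by fun_prop)
      hl.aemeasurable, hl.map_eq, lintegral_map (by fun_prop) (by fun_prop)]
    have h3 : ∀ y, ENNReal.ofReal (Real.exp (-(s t + y) / 2))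
        = ENNReal.ofReal (Real.exp (-s t / 2)) * ENNReal.ofReal (Real.exp (-(1 / 2 * y))) :=
      fun y => by
        rw [← ENNReal.ofReal_mul (Real.exp_pos _).le, ← Real.exp_add]
        congr 2
        ring
    rw [lintegral_congr h3, lintegral_const_mul _ (by fun_prop), expMeasure,
      lintegral_exp_gammaMeasure one_pos hr (by norm_num), ← ENNReal.ofReal_mul (Real.exp_pos _).le]
    refine ENNReal.ofReal_le_ofReal ?_
    -- The shift `s t` alone provides the decay, so the factor of the exponential part is bounded by
    -- `1`.
    have h4 : (r / (r + 1 / 2)) ^ (1 : ℝ) ≤ 1 := by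
      rw [Real.rpow_one, div_le_one (by positivity)]
      linarith
    have h5 : Real.exp (-s t / 2) ≤ 1 / (N t * ((t : ℝ) + 1) ^ 2) := by
      rw [← Real.log_le_log_iff (Real.exp_pos _) (by positivity), Real.log_exp, one_div,
        Real.log_inv]
      linarith
    calc _ ≤ Real.exp (-s t / 2) * 1 := by gcongr
      _ ≤ 1 / (N t * ((t : ℝ) + 1) ^ 2) := by rwa [mul_one]
      _ ≤ _ := by gcongr; exact le_max_left _ _

theorem TruncatedNormalSchedule.rateCondition {ζ : ℕ → Ω → ℝ} {N : ℕ → ℝ} (hN : ∀ t, 0 < N t)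
    (hζ0 : ∀ t, ∀ᵐ ω ∂P, 0 ≤ ζ t ω) (hζ : ∀ t, Integrable (ζ t) P)
    (h : TruncatedNormalSchedule P ζ N) : RateCondition P ζ N := by
  obtain ⟨m, hm, hO⟩ := h
  have hmem : ∀ t, ∀ᵐ ω ∂P, ζ t ω ∈ Set.Icc (m t - 1) (m t + 1) := fun t => by
    obtain ⟨-, -, hl⟩ := hm t
    refine ae_of_ae_map hl.aemeasurable ?_
    rw [hl.map_eq]
    exact ae_cond_mem measurableSet_Icc
  -- The constant `e` serves twice: `m + 1 ≤ m + e` bounds the mean, and `e` covers the factor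
  -- `e^{1/2}` lost by bounding `ζ` below by the left end `m - 1` of its support.
  refine rateCondition_of_le (c := 1) (C := Real.exp 1) hN hO hζ0 (fun t => ?_) fun t => ?_
  · have h1 : ∫ ω, ζ t ω ∂P ≤ ∫ _, (m t + 1) ∂P :=
      integral_mono_ae (hζ t) (integrable_const _) (by
        filter_upwards [hmem t] with ω hω using hω.2)
    rw [integral_const, probReal_univ, one_smul] at h1
    linarith [Real.add_one_le_exp 1]
  · obtain ⟨-, h2, -⟩ := hm t
    have hNt := hN t
    have h5 : Real.exp (-(m t - 1) / 2) ≤ Real.exp 1 / (N t * ((t : ℝ) + 1) ^ 2) := by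
      rw [← Real.log_le_log_iff (Real.exp_pos _) (by positivity), Real.log_exp,
        Real.log_div (by positivity) (by positivity), Real.log_exp]
      linarith
    have hb : ∀ᵐ ω ∂P, Real.exp (-ζ t ω / 2) ≤ Real.exp (-(m t - 1) / 2) := by
      filter_upwards [hmem t] with ω hω
      exact Real.exp_le_exp.2 (by linarith [hω.1])
    have hi : Integrable (fun ω => Real.exp (-ζ t ω / 2)) P := by
      refine Integrable.of_bound (C := Real.exp (-(m t - 1) / 2))
        (Real.continuous_exp.comp_aestronglyMeasurable ((hζ t).neg.div_const 2).1) ?_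
      filter_upwards [hb] with ω hω
      rwa [Real.norm_eq_abs, Real.abs_exp]
    have h6 := integral_mono_ae hi (integrable_const _) hb
    rw [integral_const, probReal_univ, one_smul] at h6
    exact h6.trans h5

end Schedules

/-! ### Sub-Gaussian tails -/

/-- With `s = √(log c)` one has `c ≤ exp (s²)`, also for `c < 1`, where `s = 0`. For `u = t / b ≥ s`
moreover `s² - u² ≤ -(u - s)²`. -/
theorem tail_le_gaussian {b c t : ℝ} (hb : 0 < b) (hc : 0 < c) (ht : b * √(Real.log c) ≤ t) :
    c * Real.exp (-(t / b) ^ 2) ≤ Real.exp (-(1 / b ^ 2) * (t - b * √(Real.log c)) ^ 2) := by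
  set s := √(Real.log c) with hs
  have hs0 : 0 ≤ s := Real.sqrt_nonneg _
  have h1 : Real.log c ≤ s ^ 2 := by
    rcases le_total 0 (Real.log c) with h | h
    · rw [hs, Real.sq_sqrt h]
    · exact h.trans (sq_nonneg _)
  have h2 : c ≤ Real.exp (s ^ 2) := by
    rw [← Real.log_le_iff_le_exp hc]
    exact h1
  have h3 : s ^ 2 + -(t / b) ^ 2 ≤ -(1 / b ^ 2) * (t - b * s) ^ 2 := by
    have h4 : t / b - s = (t - b * s) / b := by field_simp
    have h5 : 0 ≤ t / b - s := by
      rw [h4]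
      exact div_nonneg (by linarith) hb.le
    have h6 : (1 / b ^ 2) * (t - b * s) ^ 2 = (t / b - s) ^ 2 := by
      rw [h4, div_pow]
      ring
    have h7 : -(1 / b ^ 2) * (t - b * s) ^ 2 = -(t / b - s) ^ 2 := by rw [neg_mul, h6]
    rw [h7]
    nlinarith
  calc _ ≤ Real.exp (s ^ 2) * Real.exp (-(t / b) ^ 2) := by gcongr
    _ ≤ _ := by rw [← Real.exp_add]; exact Real.exp_le_exp.2 h3

/-- Up to `b √(log c)` the tail is bounded by `1`; beyond it, by a shifted half-Gaussian of mass `b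
√π / 2`. The sum is the factor appearing in `gridSize`. -/
theorem lintegral_min_tail_le {b c : ℝ} (hb : 0 < b) (hc : 0 < c) :
    ∫⁻ t in Set.Ioi (0 : ℝ), min 1 (ENNReal.ofReal (c * Real.exp (-(t / b) ^ 2)))
      ≤ ENNReal.ofReal (b * (√(Real.log c) + √Real.pi / 2)) := by
  set s := √(Real.log c) with hs
  have hs0 : 0 ≤ s := Real.sqrt_nonneg _
  let G : ℝ → ℝ≥0∞ := (Set.Ioi (0 : ℝ)).indicator
    fun u => ENNReal.ofReal (Real.exp (-(1 / b ^ 2) * u ^ 2))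
  have hG : Measurable G := Measurable.indicator (by fun_prop) measurableSet_Ioi
  have hGI : ∫⁻ u, G u = ENNReal.ofReal (b * (√Real.pi / 2)) := by
    have hb2 : 0 < 1 / b ^ 2 := by positivity
    rw [lintegral_indicator measurableSet_Ioi, ← ofReal_integral_eq_lintegral_ofReal
      (integrable_exp_neg_mul_sq hb2).integrableOn (ae_of_all _ fun u => (Real.exp_pos _).le),
      integral_gaussian_Ioi]
    congr 1
    rw [div_div_eq_mul_div, div_one, Real.sqrt_mul Real.pi_pos.le, Real.sqrt_sq hb.le]
    ring
  have hle : ∀ t ∈ Set.Ioi (0 : ℝ), min 1 (ENNReal.ofReal (c * Real.exp (-(t / b) ^ 2)))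
      ≤ (Set.Ioc 0 (b * s)).indicator 1 t + G (t - b * s) := fun t ht => by
    rcases le_or_gt t (b * s) with h | h
    · have hm : t ∈ Set.Ioc 0 (b * s) := ⟨ht, h⟩
      rw [Set.indicator_of_mem hm]
      exact (min_le_left _ _).trans le_self_add
    · refine (min_le_right _ _).trans (le_trans ?_ le_add_self)
      have : t - b * s ∈ Set.Ioi (0 : ℝ) := sub_pos.2 h
      simp only [G]
      rw [Set.indicator_of_mem this]
      exact ENNReal.ofReal_le_ofReal (tail_le_gaussian hb hc h.le)
  calc _ ≤ ∫⁻ t in Set.Ioi (0 : ℝ), ((Set.Ioc 0 (b * s)).indicator 1 t + G (t - b * s)) :=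
        setLIntegral_mono' measurableSet_Ioi hle
    _ ≤ ∫⁻ t, ((Set.Ioc 0 (b * s)).indicator 1 t + G (t - b * s)) := setLIntegral_le_lintegral _ _
    _ = ENNReal.ofReal (b * s) + ENNReal.ofReal (b * (√Real.pi / 2)) := by
        rw [lintegral_add_left (measurable_one.indicator measurableSet_Ioc),
          lintegral_indicator_one measurableSet_Ioc, lintegral_sub_right_eq_self, hGI,
          Real.volume_Ioc, sub_zero]
    _ = _ := by
        rw [← ENNReal.ofReal_add (by positivity) (by positivity), mul_add]

theorem integrable_of_tail {Ω : Type*} [MeasurableSpace Ω] {P : Measure Ω} [IsProbabilityMeasure P]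
    {Z : Ω → ℝ} (hZ : Measurable Z) (h0 : ∀ ω, 0 ≤ Z ω) {b c : ℝ} (hb : 0 < b) (hc : 0 < c)
    (ht : ∀ t, 0 < t → P {ω | t < Z ω} ≤ ENNReal.ofReal (c * Real.exp (-(t / b) ^ 2))) :
    Integrable Z P ∧ ∫ ω, Z ω ∂P ≤ b * (√(Real.log c) + √Real.pi / 2) := by
  have h1 : ∫⁻ ω, ENNReal.ofReal (Z ω) ∂P ≤ ENNReal.ofReal (b * (√(Real.log c) + √Real.pi / 2)) := by
    rw [lintegral_eq_lintegral_meas_lt P (ae_of_all _ h0) hZ.aemeasurable]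
    exact (setLIntegral_mono' measurableSet_Ioi fun t htp => le_min prob_le_one (ht t htp)).trans
      (lintegral_min_tail_le hb hc)
  refine ⟨⟨hZ.aestronglyMeasurable, ?_⟩,
    integral_le_of_lintegral_ofReal_le hZ.aemeasurable (ae_of_all _ h0) (by positivity) h1⟩
  rw [hasFiniteIntegral_iff_ofReal (ae_of_all _ h0)]
  exact h1.trans_lt ENNReal.ofReal_lt_top

/-! ### Lipschitz constant of the sample paths -/

theorem EuclideanSpace.norm_le_sqrt_mul {d : ℕ} {v : Pt d} {L : ℝ} (hL : 0 ≤ L)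
    (h : ∀ j, |v j| ≤ L) : ‖v‖ ≤ √d * L := by
  rw [EuclideanSpace.norm_eq]
  refine Real.sqrt_le_iff.2 ⟨by positivity, ?_⟩
  calc ∑ j, ‖v j‖ ^ 2 ≤ ∑ _j : Fin d, L ^ 2 := by
        refine Finset.sum_le_sum fun j _ => ?_
        rw [Real.norm_eq_abs]
        have := h j
        gcongr
    _ = (√d * L) ^ 2 := by
        rw [mul_pow, Real.sq_sqrt d.cast_nonneg]
        simp

theorem sub_le_of_gradient_le {d : ℕ} {X : Set (Pt d)} (hX : Convex ℝ X) {u : Pt d → ℝ}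
    {G : Pt d → Pt d} (hG : ∀ z ∈ X, HasGradientWithinAt u (G z) X z) {L : ℝ} (hL : 0 ≤ L)
    (h : ∀ z ∈ X, ∀ j, |G z j| ≤ L) {y z : Pt d} (hy : y ∈ X) (hz : z ∈ X) :
    |u z - u y| ≤ L * (√d * ‖z - y‖) := by
  have := hX.norm_image_sub_le_of_norm_hasFDerivWithin_le (C := √d * L)
    (fun p hp => (hG p hp).hasFDerivWithinAt) (fun p hp => by
      rw [LinearIsometryEquiv.norm_map]
      exact EuclideanSpace.norm_le_sqrt_mul hL (h p hp)) hy hz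
  rw [Real.norm_eq_abs] at this
  linarith

namespace IsRegularContinuous

variable {Ω : Type*} [MeasurableSpace Ω] {P : Measure Ω} [IsProbabilityMeasure P] {d : ℕ}
  {X : Set (Pt d)} {f : Pt d → Ω → ℝ} {r a b : ℝ}

theorem ae_continuous (h : IsRegularContinuous P X f r a b) :
    ∀ᵐ ω ∂P, Continuous fun z : X => f z ω := by
  obtain ⟨g, hg, -⟩ := h.gradient
  filter_upwards [hg] with ω hω
  have : ContinuousOn (fun z => f z ω) X := fun z hz =>
    (hω z hz).hasFDerivWithinAt.continuousWithinAt
  exact continuousOn_iff_continuous_domRestrict.1 this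

/-- The difference quotients over a countable dense set have a measurable supremum, while a supremum
of the gradient need not be measurable. Its tail is controlled by the gradient tails through the
mean value inequality and a union bound over the `d` coordinates, whence `a * d`. -/
theorem exists_lipschitz (h : IsRegularContinuous P X f r a b) (hf : ∀ z ∈ X, Measurable (f z))
    (hd : 0 < d) (hne : X.Nonempty) :
    ∃ Λ : Ω → ℝ, Integrable Λ P ∧ (∀ ω, 0 ≤ Λ ω) ∧
      ∫ ω, Λ ω ∂P ≤ b * (√(Real.log (a * d)) + √Real.pi / 2) ∧
      ∀ᵐ ω ∂P, ∀ y z : X, f y ω - f z ω ≤ Λ ω * (√d * ‖(y : Pt d) - z‖) := by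
  obtain ⟨g, hg, htail⟩ := h.gradient
  have hdR : (0 : ℝ) < d := Nat.cast_pos.2 hd
  have hsd : 0 < √(d : ℝ) := Real.sqrt_pos.2 hdR
  have := hne.to_subtype
  -- If all partial derivatives are bounded by `L`, the gradient has norm at most `√d * L`. With the
  -- normalization by `√d` the quotients are then at most `L` itself.
  let q : X → X → Ω → ℝ := fun y z ω => |f y ω - f z ω| / (√d * ‖(y : Pt d) - z‖)
  let bad : ℝ → Set Ω := fun L => {ω | ∃ j, ∃ z ∈ X, L < |g z ω j|}
  have hbad : ∀ L, 0 < L → P (bad L) ≤ ENNReal.ofReal (a * d * Real.exp (-(L / b) ^ 2)) :=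
    fun L hL => by
      have h1 : bad L = ⋃ j, {ω | ∃ z ∈ X, L < |g z ω j|} := by ext ω; simp [bad]
      rw [h1]
      refine (measure_iUnion_fintype_le P _).trans ((Finset.sum_le_sum fun j _ =>
        htail j L hL).trans_eq ?_)
      rw [Finset.sum_const, Finset.card_univ, Fintype.card_fin, nsmul_eq_mul,
        ← ENNReal.ofReal_natCast, ← ENNReal.ofReal_mul d.cast_nonneg]
      congr 1
      ring
  have hgood : ∀ᵐ ω ∂P, ∀ L, 0 ≤ L → ω ∉ bad L → ∀ y z : X, q y z ω ≤ L := by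
    filter_upwards [hg] with ω hω L hL hb y z
    have h1 : |f y ω - f z ω| ≤ L * (√d * ‖(y : Pt d) - z‖) := by
      refine sub_le_of_gradient_le h.convex hω hL (fun p hp j => ?_) z.2 y.2
      by_contra hc
      exact hb ⟨j, p, hp, not_le.1 hc⟩
    exact div_le_of_le_mul₀ (by positivity) hL h1
  -- The quotients are almost surely bounded; for an unbounded family the real supremum would take
  -- the default value `0` and bound nothing.
  have hex : ∀ᵐ ω ∂P, ∃ n : ℕ, ω ∉ bad n := by
    have h1 : Tendsto (fun n : ℕ => ENNReal.ofReal (a * d * Real.exp (-((n : ℝ) / b) ^ 2)))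
        atTop (nhds 0) := by
      rw [← ENNReal.ofReal_zero]
      refine ENNReal.tendsto_ofReal ?_
      have h2 : Tendsto (fun n : ℕ => ((n : ℝ) / b) ^ 2) atTop atTop :=
        (tendsto_pow_atTop two_ne_zero).comp
          (tendsto_natCast_atTop_atTop.atTop_div_const h.b_pos)
      simpa using (Real.tendsto_exp_neg_atTop_nhds_zero.comp h2).const_mul (a * d)
    have h3 : P (⋂ n : ℕ, bad n) ≤ 0 := by
      refine ge_of_tendsto h1 ?_
      filter_upwards [eventually_gt_atTop 0] with n hn
      exact (measure_mono (Set.iInter_subset _ n)).trans (hbad n (Nat.cast_pos.2 hn))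
    have h4 := measure_eq_zero_iff_ae_notMem.1 (le_antisymm h3 (zero_le))
    filter_upwards [h4] with ω hω
    simpa using hω
  obtain ⟨D, hDc, hD⟩ := TopologicalSpace.exists_countable_dense X
  have hDct := hDc.to_subtype
  have hDne : Nonempty D := hD.nonempty.to_subtype
  let Λ : Ω → ℝ := fun ω => ⨆ p : D × D, q p.1 p.2 ω
  have hq0 : ∀ y z ω, 0 ≤ q y z ω := fun y z ω => by positivity
  have hΛm : Measurable Λ := Measurable.iSup fun p => by
    have h1 := hf _ (p.1 : X).2
    have h2 := hf _ (p.2 : X).2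
    have h3 : Measurable fun ω => |f (p.1 : X) ω - f (p.2 : X) ω| := (h1.sub h2).abs
    exact h3.div_const _
  have hΛ0 : ∀ ω, 0 ≤ Λ ω := fun ω => Real.iSup_nonneg fun p => hq0 _ _ ω
  obtain ⟨hI, hle⟩ := integrable_of_tail (P := P) hΛm hΛ0 h.b_pos (mul_pos h.a_pos hdR)
    fun L hL => by
      refine (measure_mono_ae ?_).trans (hbad L hL)
      filter_upwards [hgood] with ω hω hlt
      by_contra hb
      exact absurd (ciSup_le fun p : D × D => hω L hL.le hb p.1 p.2) (not_le.2 hlt)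
  refine ⟨Λ, hI, hΛ0, hle, ?_⟩
  filter_upwards [hgood, hex, h.ae_continuous] with ω hω ⟨n, hn⟩ hc y z
  have hbdd : BddAbove (Set.range fun p : D × D => q p.1 p.2 ω) :=
    ⟨n, by rintro _ ⟨p, rfl⟩; exact hω n n.cast_nonneg hn _ _⟩
  have hclosed : IsClosed {p : X × X | f p.1 ω - f p.2 ω ≤ Λ ω * (√d * ‖(p.1 : Pt d) - p.2‖)} := by
    refine isClosed_le ?_ ?_
    · exact (hc.comp continuous_fst).sub (hc.comp continuous_snd)
    · fun_prop
  have hsub : D ×ˢ D ⊆ {p : X × X | f p.1 ω - f p.2 ω ≤ Λ ω * (√d * ‖(p.1 : Pt d) - p.2‖)} := by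
    rintro ⟨u, v⟩ ⟨hu, hv⟩
    have h1 : q u v ω ≤ Λ ω := le_ciSup hbdd ((⟨u, hu⟩, ⟨v, hv⟩) : D × D)
    rcases eq_or_ne u v with rfl | huv
    · simp
    · have h2 : 0 < √(d : ℝ) * ‖(u : Pt d) - v‖ :=
        mul_pos hsd (norm_pos_iff.2 (sub_ne_zero.2 fun he => huv (Subtype.ext he)))
      exact (le_abs_self _).trans ((div_le_iff₀ h2).1 h1)
  have := (hclosed.closure_subset_iff.2 hsub)
  rw [(hD.prod hD).closure_eq] at this
  exact this (Set.mem_univ (y, z))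

end IsRegularContinuous

/-! ### Discretization of a convex domain -/

theorem exists_cell {r : ℝ} (hr : 0 < r) {n : ℕ} (hn : 0 < n) {u : ℝ} (h0 : 0 ≤ u) (h1 : u ≤ r) :
    ∃ i : Fin n, |u - (i + 1 / 2) * (r / n)| ≤ r / (2 * n) := by
  have hnR : (0 : ℝ) < n := Nat.cast_pos.2 hn
  have hδ : 0 < r / n := by positivity
  have he : r / (2 * n) = r / n / 2 := by rw [div_div, mul_comm]
  rw [he]
  have hrn : r = n * (r / n) := by field_simp
  rcases h1.lt_or_eq with h1 | rfl
  · have hlt : u / (r / n) < n := by rw [div_lt_iff₀ hδ]; linarith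
    have h2 := Nat.floor_le (div_nonneg h0 hδ.le)
    have h3 := Nat.lt_floor_add_one (u / (r / n))
    rw [le_div_iff₀ hδ] at h2
    rw [div_lt_iff₀ hδ] at h3
    refine ⟨⟨⌊u / (r / n)⌋₊, (Nat.floor_lt (div_nonneg h0 hδ.le)).2 hlt⟩, abs_le.2 ⟨?_, ?_⟩⟩
    · simp only
      nlinarith
    · simp only
      nlinarith
  -- At the right end of the interval the floor would be `n`, which is out of range, so the point is
  -- assigned to the last cell.
  · refine ⟨⟨n - 1, by omega⟩, ?_⟩
    have : ((n - 1 : ℕ) : ℝ) = n - 1 := by rw [Nat.cast_sub hn, Nat.cast_one]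
    simp only [this]
    rw [abs_le]
    constructor <;> linarith

/-- The nearest point of a convex set sees `c` and any point of `X` at an obtuse or right angle, so
it is at least as close as `c` to every point of `X`. Cell centers outside `X` can thus be moved
into `X` without enlarging the mesh. -/
theorem exists_projection {d : ℕ} {X : Set (Pt d)} (hX : IsCompact X) (hc : Convex ℝ X)
    (hne : X.Nonempty) (c : Pt d) : ∃ p : X, ∀ z : X, ‖(z : Pt d) - p‖ ≤ ‖(z : Pt d) - c‖ := by
  obtain ⟨p, hp, hmin⟩ := exists_norm_eq_iInf_of_complete_convex hne hX.isComplete hc c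
  rw [norm_eq_iInf_iff_real_inner_le_zero hc hp] at hmin
  refine ⟨⟨p, hp⟩, fun z => ?_⟩
  have h1 := hmin z z.2
  have h2 : (z : Pt d) - c = ((z : Pt d) - p) - (c - p) := by abel
  have h3 := norm_sub_sq_real ((z : Pt d) - p) (c - p)
  rw [← h2, real_inner_comm] at h3
  refine le_of_sq_le_sq ?_ (norm_nonneg _)
  nlinarith [sq_nonneg ‖c - p‖]

theorem exists_net {d : ℕ} {X : Set (Pt d)} (hX : IsCompact X) (hc : Convex ℝ X)
    (hne : X.Nonempty) {r : ℝ} (hr : 0 < r) (hbox : ∀ z ∈ X, ∀ j, 0 ≤ z j ∧ z j ≤ r) {n : ℕ}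
    (hn : 0 < n) : ∃ G : Finset X, G.card ≤ n ^ d ∧
      ∀ z : X, ∃ p ∈ G, ‖(z : Pt d) - p‖ ≤ √d * (r / (2 * n)) := by
  classical
  choose π hπ using exists_projection hX hc hne
  let c : (Fin d → Fin n) → Pt d := fun s => WithLp.toLp 2 fun j => ((s j : ℝ) + 1 / 2) * (r / n)
  refine ⟨Finset.univ.image fun s => π (c s), ?_, fun z => ?_⟩
  · refine Finset.card_image_le.trans ?_
    simp
  · choose s hs using fun j => exists_cell hr hn (hbox z z.2 j).1 (hbox z z.2 j).2
    refine ⟨π (c s), Finset.mem_image_of_mem _ (Finset.mem_univ s), (hπ (c s) z).trans ?_⟩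
    exact EuclideanSpace.norm_le_sqrt_mul (by positivity) hs

theorem sum_inv_sq_le (T : ℕ) :
    ∑ t ∈ Finset.range T, 1 / ((t : ℝ) + 1) ^ 2 ≤ Real.pi ^ 2 / 6 := by
  have h := sum_le_hasSum (Finset.range (T + 1)) (fun i _ => by positivity) hasSum_zeta_two
  rw [Finset.sum_range_succ'] at h
  simpa using h

theorem gridSize_eq (d : ℕ) (r a b : ℝ) (t : ℕ) :
    gridSize d r a b t
      = d * r * ((t : ℝ) + 1) ^ 2 * (b * (√(Real.log (a * d)) + √Real.pi / 2)) := by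
  rw [gridSize]
  ring

theorem gridSize_pos {d : ℕ} (hd : 0 < d) {r a b : ℝ} (hr : 0 < r) (hb : 0 < b) (t : ℕ) :
    0 < gridSize d r a b t := by
  have : (0 : ℝ) < d := Nat.cast_pos.2 hd
  have := Real.sqrt_pos.2 Real.pi_pos
  have := Real.sqrt_nonneg (Real.log (a * d))
  rw [gridSize]
  positivity

theorem gridSize_zero_le (d : ℕ) {r a b : ℝ} (hr : 0 < r) (hb : 0 < b) (t : ℕ) :
    gridSize d r a b 0 ≤ gridSize d r a b t := by
  rw [gridSize, gridSize]
  have h : (1 : ℝ) ≤ (t : ℝ) + 1 := by have : (0 : ℝ) ≤ t := t.cast_nonneg; linarith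
  gcongr
  simp

/-! ### Regret on a compact convex domain. -/

/-- Regret on a compact convex domain. -/
theorem IsAdaptiveDesign.convex_regret {Ω 𝒲 : Type*} [MeasurableSpace Ω] [MeasurableSpace 𝒲]
    {P : Measure Ω} [IsProbabilityMeasure P] {d : ℕ} {X : Set (Pt d)} {f : Pt d → Ω → ℝ}
    {ε : ℕ → Ω → ℝ} {W : Ω → 𝒲} {φ : ∀ t : ℕ, (Fin t → X × ℝ) × 𝒲 → X} {x : ℕ → Ω → X}
    {k : Pt d → Pt d → ℝ} {σ r a b : ℝ} (hx : IsAdaptiveDesign P X f ε W φ x)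
    (h : IsGPRegression P X k σ f ε) (hX : IsRegularContinuous P X f r a b)
    {g : ℕ → 𝒲 → ℝ} (hg : ∀ t, Measurable (g t))
    (hg0 : ∀ t, ∀ᵐ ω ∂P, 0 ≤ g t (W ω)) (hgi : ∀ t, Integrable (fun ω => g t (W ω)) P)
    (hmax : ∀ n, ∀ᵐ ω ∂P, ∀ z : X,
      ucb k σ (fun i : Fin n => (x i ω : Pt d)) (fun i : Fin n => f (x i ω) ω + ε i ω) (g n (W ω)) z
      ≤ ucb k σ (fun i : Fin n => (x i ω : Pt d)) (fun i : Fin n => f (x i ω) ω + ε i ω) (g n (W ω))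
        (x n ω)) (T : ℕ) :
    Integrable (cumRegret X f (fun t ω => (x t ω : Pt d)) T) P ∧
      0 ≤ BCR P X f (fun t ω => (x t ω : Pt d)) T ∧
      BCR P X f (fun t ω => (x t ω : Pt d)) T ≤ Real.pi ^ 2 / 6 + 1 / √(2 * Real.pi) *
          ∑ t ∈ Finset.range T, gridSize d r a b t ^ d * mgf (fun ω => g t (W ω)) P (-1 / 2)
        + √(C₁ σ * maxInfoGain P X f ε T * ∑ t ∈ Finset.range T, ∫ ω, g t (W ω) ∂P) := by
  obtain ⟨ω₀⟩ := P.nonempty_of_neZero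
  have hne : X.Nonempty := ⟨x 0 ω₀, (x 0 ω₀).2⟩
  -- In dimension `0` the domain is a single point and `gridSize ^ 0 = 1`, so the finite bound
  -- already suffices.
  rcases Nat.eq_zero_or_pos d with rfl | hd
  · obtain ⟨h1, h2, h3⟩ := hx.finite_regret h (Set.toFinite X) hg hg0 hgi hmax T
    refine ⟨h1, h2, h3.trans ?_⟩
    have hcard : X.ncard ≤ 1 := Set.ncard_le_one_of_subsingleton X
    have hM : 0 ≤ ∑ t ∈ Finset.range T, mgf (fun ω => g t (W ω)) P (-1 / 2) :=
      Finset.sum_nonneg fun t _ => mgf_nonneg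
    simp only [pow_zero, one_mul]
    have h4 : (X.ncard : ℝ) / √(2 * Real.pi) ≤ 1 / √(2 * Real.pi) := by
      gcongr
      exact_mod_cast hcard
    have h5 := mul_le_mul_of_nonneg_right h4 hM
    have : 0 ≤ Real.pi ^ 2 / 6 := by positivity
    linarith
  · have hr := hX.r_pos
    have hdR : (0 : ℝ) < d := Nat.cast_pos.2 hd
    obtain ⟨Λ, hΛi, hΛ0, hΛ, hlip⟩ := hX.exists_lipschitz h.gp.measurable hd hne
    set E := b * (√(Real.log (a * d)) + √Real.pi / 2) with hE
    have hτ : ∀ t, gridSize d r a b t = d * r * ((t : ℝ) + 1) ^ 2 * E := gridSize_eq d r a b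
    have hτ0 : ∀ t, 0 < gridSize d r a b t := gridSize_pos hd hr hX.b_pos
    have hsd : √(d : ℝ) * √d = d := Real.mul_self_sqrt hdR.le
    have key : ∀ n : ℕ, ∃ V : Ω → ℝ, Integrable V P ∧
        ∫ ω, V ω ∂P ≤ 1 / ((n : ℝ) + 1) ^ 2 + 1 / √(2 * Real.pi) *
          (gridSize d r a b n ^ d * mgf (fun ω => g n (W ω)) P (-1 / 2)) ∧
        ∀ᵐ ω ∂P, (⨆ z : X, f z ω) - f (x n ω) ω
          ≤ V ω + √(g n (W ω)) * √(postVar k σ (fun i : Fin n => (x i ω : Pt d)) (x n ω)) := by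
      intro n
      have hn1 : (0 : ℝ) < ((n : ℝ) + 1) ^ 2 := by positivity
      have hM : 0 ≤ mgf (fun ω => g n (W ω)) P (-1 / 2) := mgf_nonneg
      have hpow := pow_pos (hτ0 n) d
      -- If `τ < 1` there is no grid to use, but none is needed: the box gives regret at most `Λ * d
      -- * r`, whose mean is at most `d * r * E = τ / (n + 1)²`, less than `1 / (n + 1)²`.
      rcases lt_or_ge (gridSize d r a b n) 1 with hlt | hge
      · refine ⟨fun ω => Λ ω * (d * r), hΛi.mul_const _, ?_, ?_⟩
        · rw [integral_mul_const]
          have h1 : d * r * E ≤ 1 / ((n : ℝ) + 1) ^ 2 := by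
            rw [le_div_iff₀ hn1]
            have := hτ n
            nlinarith
          have h2 : (∫ ω, Λ ω ∂P) * (d * r) ≤ E * (d * r) := by gcongr
          have h3 : 0 ≤ 1 / √(2 * Real.pi) *
            (gridSize d r a b n ^ d * mgf (fun ω => g n (W ω)) P (-1 / 2)) := by positivity
          linarith
        · filter_upwards [hlip] with ω hω
          have : Nonempty X := hne.to_subtype
          have h0 : 0 ≤ √(g n (W ω)) * √(postVar k σ (fun i : Fin n => (x i ω : Pt d)) (x n ω)) := by
            positivity
          rw [sub_le_iff_le_add]
          refine ciSup_le fun z => ?_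
          have h1 := hω z (x n ω)
          have h2 : ‖(z : Pt d) - x n ω‖ ≤ √d * r := by
            refine EuclideanSpace.norm_le_sqrt_mul hr.le fun j => ?_
            have hz := hX.box z z.2 j
            have hy := hX.box _ (x n ω).2 j
            rw [PiLp.sub_apply, abs_le]
            constructor <;> linarith [hz.1, hz.2, hy.1, hy.2]
          have h3 : Λ ω * (√d * ‖(z : Pt d) - x n ω‖) ≤ Λ ω * (d * r) := by
            refine mul_le_mul_of_nonneg_left ?_ (hΛ0 ω)
            calc √(d : ℝ) * ‖(z : Pt d) - x n ω‖ ≤ √d * (√d * r) := by gcongr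
              _ = d * r := by rw [← mul_assoc, hsd]
          linarith
      -- With `m = ⌊τ⌋` cells per side the net has at most `τ ^ d` points. Since `τ < m + 1 ≤ 2 m`,
      -- the mean discretization error `d r E / (2 m)` is at most `1 / (n + 1)²`.
      · set m := ⌊gridSize d r a b n⌋₊ with hm
        have hm1 : 1 ≤ m := (Nat.one_le_floor_iff _).2 hge
        have hmR : (1 : ℝ) ≤ m := by exact_mod_cast hm1
        have hmle : (m : ℝ) ≤ gridSize d r a b n := Nat.floor_le (hτ0 n).le
        have hlt : gridSize d r a b n < 2 * m := by
          have := Nat.lt_floor_add_one (gridSize d r a b n)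
          rw [← hm] at this
          linarith
        obtain ⟨G, hGc, hG⟩ := exists_net hX.compact hX.convex hne hr hX.box
          (Nat.lt_of_lt_of_le Nat.zero_lt_one hm1)
        have hA : Integrable (fun ω => Λ ω * (d * (r / (2 * m)))) P := hΛi.mul_const _
        obtain ⟨V, hV, hVle, hb⟩ := hx.exists_round_bound h n (hg n) (hg0 n) (hmax n) hA G (by
          filter_upwards [hlip] with ω hω z
          obtain ⟨p, hp, hzp⟩ := hG z
          refine ⟨p, hp, ?_⟩
          have h1 := hω z p
          have h3 : Λ ω * (√d * ‖(z : Pt d) - p‖) ≤ Λ ω * (d * (r / (2 * m))) := by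
            refine mul_le_mul_of_nonneg_left ?_ (hΛ0 ω)
            calc √(d : ℝ) * ‖(z : Pt d) - p‖ ≤ √d * (√d * (r / (2 * m))) := by gcongr
              _ = _ := by rw [← mul_assoc, hsd]
          linarith)
        refine ⟨V, hV, hVle.trans (add_le_add ?_ ?_), hb⟩
        · rw [integral_mul_const]
          calc (∫ ω, Λ ω ∂P) * (d * (r / (2 * m))) ≤ E * (d * (r / (2 * m))) := by gcongr
            _ = d * r * E / (2 * m) := by ring
            _ ≤ 1 / ((n : ℝ) + 1) ^ 2 := by
                rw [div_le_div_iff₀ (by linarith) hn1, one_mul]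
                have := hτ n
                linarith
        · have h1 : (G.card : ℝ) ≤ gridSize d r a b n ^ d := by
            calc (G.card : ℝ) ≤ (m : ℝ) ^ d := by exact_mod_cast hGc
              _ ≤ _ := by gcongr
          calc _ ≤ gridSize d r a b n ^ d / √(2 * Real.pi) *
                mgf (fun ω => g n (W ω)) P (-1 / 2) := by gcongr
            _ = _ := by ring
    choose V hV hVle hb using key
    obtain ⟨h1, h2, h3⟩ := hx.integrable_cumRegret h hX.compact T hg0 hgi hV hb
    refine ⟨h1, h2, h3.trans ?_⟩
    gcongr
    refine (Finset.sum_le_sum fun t _ => hVle t).trans ?_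
    rw [Finset.sum_add_distrib, ← Finset.mul_sum]
    gcongr
    exact sum_inv_sq_le T

/-! ### The theorem. -/

theorem theorem6 {Ω S : Type*} [MeasurableSpace Ω] [MeasurableSpace S]
    (P : Measure Ω) [IsProbabilityMeasure P] {d : ℕ} (X : Set (Pt d))
    (k : Pt d → Pt d → ℝ) (σ : ℝ) (f : Pt d → Ω → ℝ) (ε ζ : ℕ → Ω → ℝ) (U : Ω → S)
    (x : ℕ → Ω → Pt d)
    (hσ : 0 < σ)
    (hk_stat : IsStationaryOn X k) (hk_one : ∀ z ∈ X, k z z = 1)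
    (hf : IsCenteredGP P X k f)
    (hε : IsGaussianNoise P σ ε)
    (hζ_meas : ∀ t, Measurable (ζ t)) (hζ_nonneg : ∀ t, ∀ᵐ ω ∂P, 0 ≤ ζ t ω)
    (hζ_int : ∀ t, Integrable (ζ t) P)
    (hU : Measurable U)
    -- the prior sample path, the noise, and the randomness of the algorithm are independent
    (h_indep_noise : IndepFun (fun ω (z : X) => f z ω) (fun ω (t : ℕ) => ε t ω) P)
    (h_indep_alg : IndepFun (fun ω => ((fun z : X => f z ω), (fun t : ℕ => ε t ω)))
      (fun ω => ((fun t : ℕ => ζ t ω), U ω)) P)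
    (hx : IsRGPUCB P X k σ f ε ζ U x) :
    -- finite domain: bound and rate
    (X.Finite →
      (∀ T : ℕ, Integrable (cumRegret X f x T) P ∧
        BCR P X f x T ≤
          (X.ncard : ℝ) / √(2 * Real.pi) * ∑ t ∈ Finset.range T, mgf (ζ t) P (-1 / 2)
          + √(C₁ σ * maxInfoGain P X f ε T * ∑ t ∈ Finset.range T, ∫ ω, ζ t ω ∂P)) ∧
      (RateCondition P ζ (fun _ => 1) → HasRegretRate P X f ε ζ x)) ∧
    -- continuous domain: bound and rate
    (∀ r a b : ℝ, IsRegularContinuous P X f r a b →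
      (∀ T : ℕ, Integrable (cumRegret X f x T) P ∧
        BCR P X f x T ≤
          Real.pi ^ 2 / 6
          + 1 / √(2 * Real.pi) *
            ∑ t ∈ Finset.range T, gridSize d r a b t ^ d * mgf (ζ t) P (-1 / 2)
          + √(C₁ σ * maxInfoGain P X f ε T * ∑ t ∈ Finset.range T, ∫ ω, ζ t ω ∂P)) ∧
      (RateCondition P ζ (fun t => gridSize d r a b t ^ d) → HasRegretRate P X f ε ζ x)) ∧
    -- the rate condition holds for three families of distributions
    (∀ N : ℕ → ℝ, (∀ t, 0 < N t) →
      (GammaSchedule P ζ N ∨ ExponentialSchedule P ζ N ∨ TruncatedNormalSchedule P ζ N) →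
      RateCondition P ζ N) := by
  have h : IsGPRegression P X k σ f ε := ⟨hσ, hf, hk_one, hε, h_indep_noise⟩
  obtain ⟨ω₀⟩ := P.nonempty_of_neZero
  have hσi : 0 < (σ ^ 2)⁻¹ := by positivity
  have hlog : 0 < Real.log (1 + (σ ^ 2)⁻¹) := Real.log_pos (by linarith)
  have hγ : ∀ T, 0 < T → Real.log (1 + (σ ^ 2)⁻¹) / 2 ≤ maxInfoGain P X f ε T :=
    fun T hT => h.log_le_maxInfoGain ⟨x 0 ω₀, hx.mem 0 ω₀⟩ hT
  have hC₁ : 0 ≤ C₁ σ := by rw [C₁]; positivity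
  have hg : ∀ t, Measurable fun w : (ℕ → ℝ) × S => w.1 t := fun t =>
    (measurable_pi_apply t).comp measurable_fst
  refine ⟨fun hX => ?_, fun r a b hX => ?_, fun N hN hs => ?_⟩
  · have hc : ∀ᵐ ω ∂P, Continuous fun z : X => f z ω := by
      have := hX.to_subtype
      exact ae_of_all _ fun ω => continuous_of_discreteTopology
    obtain ⟨φ, hφ⟩ := hx.exists_design hX.measurableSet hc hζ_meas hU h_indep_alg
    have key := hφ.finite_regret h hX hg hζ_nonneg hζ_int (fun n => by
      filter_upwards [hx.argmax n] with ω hω z using hω z z.2)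
    refine ⟨fun T => ⟨(key T).1, (key T).2.2⟩, fun hrate => ?_⟩
    refine hasRegretRate_of_bound (K := 0) (K' := (X.ncard : ℝ) / √(2 * Real.pi)) hζ_nonneg hζ_int
      one_pos (fun _ => le_rfl) hrate (half_pos hlog) hγ hC₁ le_rfl (by positivity)
      (fun T => (key T).2.1) fun T => ?_
    simp only [zero_add, one_mul]
    exact (key T).2.2
  · obtain ⟨φ, hφ⟩ := hx.exists_design hX.compact.measurableSet hX.ae_continuous hζ_meas hU
      h_indep_alg
    have key := hφ.convex_regret h hX hg hζ_nonneg hζ_int (fun n => by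
      filter_upwards [hx.argmax n] with ω hω z using hω z z.2)
    -- In dimension `0` the number `gridSize` vanishes, but its zeroth power is `1`.
    have hN : ∀ t, 0 < gridSize d r a b t ^ d := fun t => by
      rcases Nat.eq_zero_or_pos d with rfl | hd
      · simp
      · exact pow_pos (gridSize_pos hd hX.r_pos hX.b_pos t) d
    refine ⟨fun T => ⟨(key T).1, (key T).2.2⟩, fun hrate => ?_⟩
    refine hasRegretRate_of_bound (K := Real.pi ^ 2 / 6) (K' := 1 / √(2 * Real.pi)) hζ_nonneg
      hζ_int (hN 0) (fun t => ?_) hrate (half_pos hlog) hγ hC₁ (by positivity) (by positivity)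
      (fun T => (key T).2.1) fun T => (key T).2.2
    rcases Nat.eq_zero_or_pos d with rfl | hd
    · simp
    · exact pow_le_pow_left₀ (gridSize_pos hd hX.r_pos hX.b_pos 0).le
        (gridSize_zero_le d hX.r_pos hX.b_pos t) d
  · rcases hs with hs | hs | hs
    · exact hs.rateCondition hN hζ_nonneg
    · exact hs.rateCondition hN hζ_nonneg
    · exact hs.rateCondition hN hζ_nonneg hζ_int

end
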